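/- Throughout, $I$ is a nonempty finite set. A forest on $I$ is a set of rooted binary (non-planar) trees whose leaves are bijectively labelled by $I$; $V(F)$ is the set of inner vertices of $F$. At each inner vertex there are three half-edges, two incoming and one outgoing (towards the root). An orientation of a finite set $X$ is a generator of $\Lambda^{|X|}\mathbb{Z}X$. An inner-oriented forest $o\otimes F$ consists of a forest $F$, a global orientation $o$, i.e. an orientation of $V(F)\sqcup\{R\}$ with $R$ an auxiliary element, and, implicitly in the notation, a local orientation at each inner vertex, i.e. an orientation of its three half-edges. $\mathrm{Bess}(I)$ is the $\mathbb{Q}$-vector space spanned by the inner-oriented forests on $I$, multilinear in the orientations (so that it has a basis indexed by the forests on $I$), graded by the number of inner vertices. These spaces form an operad $\mathrm{Bess}$ in graded vector spaces with Koszul signs. The composition $(o_1\otimes F_1)\circ_\star(o_2\otimes F_2)$ is the sum, over all maps $s$ from the set of inner vertices on the path of $F_1$ from the leaf $\star$ to the root to the set of trees of $F_2$, of $o\otimes F_s$. Here $F_s$ is obtained from $F_1$ and $F_2$ by removing $\star$ and attaching, successively from the leaf $\star$ towards the root, the branch of each vertex $v$ of this path that does not contain $\star$ to the root of the current tree grown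 from $s(v)$, by a vertex which is identified with $v$; the trees of $F_1$ that do not contain $\star$ are kept. The local orientations are unchanged, and $o$ is $o_1\wedge r\wedge o_2$ modulo $R_1\wedge r\wedge R_2=R$. The operad $\mathrm{Bess}$ is generated by $E_{i,j}$, which is $R$ tensored with the forest on $\{i,j\}$ without inner vertex, and $\Omega_{i,j}$, which is the tree on $\{i,j\}$ with one inner vertex $v$, global orientation $R\wedge v$ and local orientation $\mathrm{root}\wedge i\wedge j$. For forests $F',F$ on $I$, write $F'\le F$ if there is a map $F'\to F$ that is increasing with respect to the orientation towards the root, restricts to the identity on leaves, maps inner vertices to inner vertices injectively, and at each inner vertex sends the two incoming half-edges to the two different incoming half-edges at its image. Such a map is unique if it exists. For $V\subseteq V(F)$, let $\gamma(F,V)$ be the sum of the forests $F'\le F$ such that the image of $V(F')$ is $V$. For an orientation $o'$ of $V\sqcup\{R'\}$, the sum $o'\otimes\gamma(F,V)\in\mathrm{Bess}(I)$ is defined by identifying the inner vertices of each such $F'$, and their half-edges, with those of $F$ in $V$; the local orientations are those of $F$. **Proposition.** There is exactly one morphism of operads $\Delta:\mathrm{Bess}\to\mathrm{Bess}\otimes\mathrm{Bess}$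 with $\Delta(E_{i,j})=E_{i,j}\otimes E_{i,j}$ and $\Delta(\Omega_{i,j})=E_{i,j}\otimes\Omega_{i,j}+\Omega_{i,j}\otimes E_{i,j}$. For every inner-oriented forest $o\otimes F$ on $I$, $$\Delta(o\otimes F)=\sum_{V(F)=V'\sqcup V''}\bigl(o'\otimes\gamma(F,V')\bigr)\otimes\bigl(o''\otimes\gamma(F,V'')\bigr),$$ where the local orientations are unchanged and, for each splitting, $o'$ and $o''$ are orientations of $V'\sqcup\{R'\}$ and $V''\sqcup\{R''\}$ such that $o'\wedge r\wedge o''=o$ modulo $R'\wedge r\wedge R''=R$ (this determines $o'\otimes o''$). -/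

import Mathlib

open scoped Classical TensorProduct

universe u

noncomputable section

namespace Bessel

/-! ## Forests of leaf-labelled rooted binary trees -/

section Clusters

variable {I : Type u}

/-- In a forest on `I`, a leaf or an inner vertex is recorded by the set of leaves above it
(its ancestor leaves): a leaf `i` by `{i}`, an inner vertex by a member of `V`.
The edge leaving a node towards the root is named after that node. -/
def IsNode (V : Finset (Set I)) (A : Set I) : Prop := A ∈ V ∨ ∃ i, A = {i}

/-- `A` and `B` are the two nodes directly above `v`. -/
def IsSplit (V : Finset (Set I)) (v A B : Set I) : Prop :=
  IsNode V A ∧ IsNode V B ∧ Disjoint A B ∧ A ∪ B = v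

end Clusters

/-- A forest on `I`: a set of rooted binary (non planar) trees whose leaves are bijectively
labelled by `I`, given by its inner vertices. -/
@[ext]
structure Forest (I : Type u) where
  verts : Finset (Set I)
  nonempty : ∀ v ∈ verts, v.Nonempty
  laminar : ∀ v ∈ verts, ∀ w ∈ verts, v ⊆ w ∨ w ⊆ v ∨ Disjoint v w
  binary : ∀ v ∈ verts, ∃ A B, IsSplit verts v A B

namespace Forest

variable {I : Type u}

/-- A tree of the forest, given by its set of leaves, i.e. by the node next to its root. -/
def IsTree (F : Forest I) (T : Set I) : Prop :=
  IsNode F.verts T ∧ ∀ N, IsNode F.verts N → T ⊆ N → N = T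

/-- The forest without inner vertex. -/
def discrete (I : Type u) : Forest I where
  verts := ∅
  nonempty := by simp
  laminar := by simp
  binary := by simp

theorem node_nonempty (F : Forest I) {A : Set I} (h : IsNode F.verts A) : A.Nonempty := by
  rcases h with h | ⟨i, rfl⟩
  · exact F.nonempty A h
  · exact Set.singleton_nonempty i

theorem node_laminar (F : Forest I) {A B : Set I} (hA : IsNode F.verts A)
    (hB : IsNode F.verts B) : A ⊆ B ∨ B ⊆ A ∨ Disjoint A B := by
  rcases hA with hA | ⟨i, rfl⟩
  · rcases hB with hB | ⟨j, rfl⟩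
    · exact F.laminar A hA B hB
    · by_cases h : j ∈ A
      · exact Or.inr (Or.inl (by simpa using h))
      · exact Or.inr (Or.inr (by simpa using h))
  · by_cases h : i ∈ B
    · exact Or.inl (by simpa using h)
    · exact Or.inr (Or.inr (by simpa using h))

theorem split_symm {V : Finset (Set I)} {v A B : Set I} (h : IsSplit V v A B) :
    IsSplit V v B A :=
  ⟨h.2.1, h.1, h.2.2.1.symm, by rw [Set.union_comm]; exact h.2.2.2⟩

/-- A node strictly inside an inner vertex lies above one of its two branches. -/
theorem node_sub_branch (F : Forest I) {v A B N : Set I} (h : IsSplit F.verts v A B)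
    (hN : IsNode F.verts N) (hNv : N ⊆ v) (hne : N ≠ v) : N ⊆ A ∨ N ⊆ B := by
  obtain ⟨hA, hB, hd, hu⟩ := h
  obtain ⟨x, hx⟩ := F.node_nonempty hA
  obtain ⟨y, hy⟩ := F.node_nonempty hB
  obtain ⟨z, hz⟩ := F.node_nonempty hN
  rw [Set.disjoint_left] at hd
  rcases F.node_laminar hN hA with h1 | h1 | h1
  · exact Or.inl h1
  · rcases F.node_laminar hN hB with h2 | h2 | h2
    · exact Or.inr h2
    · exact absurd (Set.Subset.antisymm hNv (hu ▸ Set.union_subset h1 h2)) hne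
    · left
      intro t ht
      have := hNv ht
      rw [← hu] at this
      rcases this with h | h
      · exact h
      · exact absurd h (Set.disjoint_left.1 h2 ht)
  · right
    intro t ht
    have := hNv ht
    rw [← hu] at this
    rcases this with h | h
    · exact absurd h (Set.disjoint_left.1 h1 ht)
    · exact h

theorem split_unique (F : Forest I) {v A B C D : Set I} (h : IsSplit F.verts v A B)
    (h' : IsSplit F.verts v C D) : (C = A ∧ D = B) ∨ (C = B ∧ D = A) := by
  have key : ∀ {A B C D : Set I}, IsSplit F.verts v A B → IsSplit F.verts v C D → C ⊆ A →
      C = A ∧ D = B := by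
    intro A B C D h h' hCA
    obtain ⟨hA, hB, hd, hu⟩ := h
    obtain ⟨hC, hD, hd', hu'⟩ := h'
    rw [Set.disjoint_left] at hd hd'
    obtain ⟨y, hy⟩ := F.node_nonempty hB
    have hBD : B ⊆ D := by
      intro t ht
      have : t ∈ C ∪ D := by rw [hu', ← hu]; exact Or.inr ht
      rcases this with h | h
      · exact absurd ht (hd (hCA h))
      · exact h
    have hDne : D ≠ v := by
      rintro rfl
      obtain ⟨x, hx⟩ := F.node_nonempty hC
      exact hd' hx (hu' ▸ Or.inl hx)
    rcases F.node_sub_branch ⟨hA, hB, Set.disjoint_left.2 hd, hu⟩ hD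
      (hu' ▸ Set.subset_union_right) hDne with h1 | h1
    · exact absurd hy (hd (h1 (hBD hy)))
    · have hDB : D = B := Set.Subset.antisymm h1 hBD
      refine ⟨Set.Subset.antisymm hCA ?_, hDB⟩
      intro t ht
      have : t ∈ C ∪ D := by rw [hu', ← hu]; exact Or.inl ht
      rcases this with h | h
      · exact h
      · rw [hDB] at h; exact absurd h (hd ht)
  have hCne : C ≠ v := by
    rintro rfl
    obtain ⟨x, hx⟩ := F.node_nonempty h'.2.1
    exact Set.disjoint_left.1 h'.2.2.1 (h'.2.2.2 ▸ Or.inr hx) hx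
  rcases F.node_sub_branch h h'.1 (h'.2.2.2 ▸ Set.subset_union_left) hCne with h1 | h1
  · exact Or.inl (key h h' h1)
  · exact Or.inr (key (split_symm h) h' h1)

instance [Finite I] : Finite (Forest I) :=
  Finite.of_injective (fun F : Forest I => F.verts) fun _ _ h => Forest.ext h

end Forest

/-! ## Orientations -/

/-- An exterior product, written as a word `x₁ ∧ x₂ ∧ ⋯`, of all the elements of the set
`V ⊔ {R}`; the letter `none` is the auxiliary element `R`.  Every orientation of `V ⊔ {R}` is
`±` such a word. -/
@[ext]
structure GlobalOrientation {I : Type u} (V : Finset (Set I)) where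
  word : List (Option (Set I))
  nodup : word.Nodup
  mem_iff : ∀ x, x ∈ word ↔ x = none ∨ ∃ v ∈ V, x = some v

/-- `h` is a half-edge at the inner vertex `v`: the outgoing one is `none`, the incoming one
that comes from the node `A` is `some A`. -/
def IsHalfEdge {I : Type u} (V : Finset (Set I)) (v : Set I) (h : Option (Set I)) : Prop :=
  h = none ∨ ∃ A B, IsSplit V v A B ∧ h = some A

/-- An inner-oriented forest `o ⊗ ⨂ o_v ⊗ F`: a forest, a global orientation, and at each
inner vertex a local orientation, i.e. an exterior product of the three half-edges there. -/
@[ext]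
structure InnerForest (I : Type u) where
  forest : Forest I
  glob : GlobalOrientation forest.verts
  loc : Set I → List (Option (Set I))
  loc_nodup : ∀ v ∈ forest.verts, (loc v).Nodup
  loc_mem : ∀ v ∈ forest.verts, ∀ h, h ∈ loc v ↔ IsHalfEdge forest.verts v h
  /-- no data outside the inner vertices -/
  loc_off : ∀ v, v ∉ forest.verts → loc v = []

/-- Exchange of two neighbouring factors in an exterior product. -/
def AdjSwap {α : Type*} (l l' : List α) : Prop :=
  ∃ a x y b, l = a ++ x :: y :: b ∧ l' = a ++ y :: x :: b

/-- `x` and `y` differ by the exchange of two neighbouring factors in the global orientation or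
in one local orientation. -/
def Flip {I : Type u} (x y : InnerForest I) : Prop :=
  x.forest = y.forest ∧
    ((AdjSwap x.glob.word y.glob.word ∧ x.loc = y.loc) ∨
      (x.glob.word = y.glob.word ∧ ∃ v, AdjSwap (x.loc v) (y.loc v) ∧
        ∀ w, w ≠ v → x.loc w = y.loc w))

/-- The relations `x = -y` between inner-oriented forests that define exterior products. -/
def flipRel (I : Type u) : Submodule ℚ (InnerForest I →₀ ℚ) :=
  Submodule.span ℚ {z | ∃ x y, Flip x y ∧ z = Finsupp.single x 1 + Finsupp.single y 1}

/-- The space `Bess(I)`: it is spanned by the inner-oriented forests on `I`, and has a basis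
indexed by forests once an orientation of each forest has been chosen. -/
abbrev Bess (I : Type u) : Type u := (InnerForest I →₀ ℚ) ⧸ flipRel I

/-- The element `o ⊗ F` of `Bess(I)`. -/
def Bess.of {I : Type u} (x : InnerForest I) : Bess I :=
  (flipRel I).mkQ (Finsupp.single x 1)

theorem flipRel_le_ker {I : Type u} {M : Type*} [AddCommGroup M] [Module ℚ M]
    (f : InnerForest I → M) (hf : ∀ x y, Flip x y → f x + f y = 0) :
    flipRel I ≤ LinearMap.ker (Finsupp.linearCombination ℚ f) := by
  rw [flipRel, Submodule.span_le]
  rintro _ ⟨x, y, h, rfl⟩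
  simp [hf x y h]

/-- Linear maps out of `Bess(I)`. -/
def Bess.lift {I : Type u} {M : Type*} [AddCommGroup M] [Module ℚ M] (f : InnerForest I → M)
    (hf : ∀ x y, Flip x y → f x + f y = 0) : Bess I →ₗ[ℚ] M :=
  (flipRel I).liftQ (Finsupp.linearCombination ℚ f) (flipRel_le_ker f hf)

@[simp]
theorem Bess.lift_of {I : Type u} {M : Type*} [AddCommGroup M] [Module ℚ M]
    (f : InnerForest I → M) (hf : ∀ x y, Flip x y → f x + f y = 0) (x : InnerForest I) :
    Bess.lift f hf (Bess.of x) = f x := by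
  rw [Bess.lift, Bess.of, Submodule.mkQ_apply, Submodule.liftQ_apply]
  simp

theorem Bess.of_flip {I : Type u} {x y : InnerForest I} (h : Flip x y) :
    Bess.of x + Bess.of y = 0 := by
  rw [Bess.of, Bess.of, ← map_add, Submodule.mkQ_apply, Submodule.Quotient.mk_eq_zero]
  exact Submodule.subset_span ⟨x, y, h, rfl⟩

theorem AdjSwap.map {α β : Type*} (f : α → β) {l l' : List α} (h : AdjSwap l l') :
    AdjSwap (l.map f) (l'.map f) := by
  obtain ⟨a, x, y, b, rfl, rfl⟩ := h
  exact ⟨a.map f, f x, f y, b.map f, by simp, by simp⟩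

/-- The projection of `Bess(I)` on its part of odd degree; the degree of an inner-oriented
forest is the number of its inner vertices. -/
def Bess.oddPart (I : Type u) : Bess I →ₗ[ℚ] Bess I :=
  Bess.lift (fun x => if Odd x.forest.verts.card then Bess.of x else 0) <| by
    intro x y h
    simp only [h.1]
    split_ifs
    · exact Bess.of_flip h
    · simp

/-! ## Transport of local orientations -/

section Push

variable {I K : Type u}

/-- If the vertices `v ∈ S` are renamed `φ v`, and the incoming half-edge `A` at `v` is
renamed `η v A`, the local orientations `l` become `pushLoc φ η S l`. -/
def pushLoc (φ : Set I → Set K) (η : Set I → Set I → Set K) (S : Finset (Set I))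
    (l : Set I → List (Option (Set I))) (w : Set K) : List (Option (Set K)) :=
  if h : ∃ v ∈ S, φ v = w then (l h.choose).map (Option.map (η h.choose)) else []

variable {φ : Set I → Set K} {η : Set I → Set I → Set K} {S : Finset (Set I)}
  {l : Set I → List (Option (Set I))}

theorem pushLoc_apply (hφ : Set.InjOn φ (S : Set (Set I))) {v : Set I} (hv : v ∈ S) :
    pushLoc φ η S l (φ v) = (l v).map (Option.map (η v)) := by
  have h : ∃ v' ∈ S, φ v' = φ v := ⟨v, hv, rfl⟩
  have h2 : h.choose = v := hφ h.choose_spec.1 hv h.choose_spec.2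
  rw [pushLoc, dif_pos h, h2]

theorem pushLoc_off {w : Set K} (h : ∀ v ∈ S, φ v ≠ w) : pushLoc φ η S l w = [] := by
  rw [pushLoc, dif_neg]
  rintro ⟨v, hv, h'⟩
  exact h v hv h'

/-- Renaming sends the three half-edges at `v` to the three half-edges at `φ v`. -/
theorem pushLoc_valid (F : Forest I) (G : Forest K) {v : Set I} (hv : v ∈ F.verts) {w : Set K}
    {e : Set I → Set K} (hs : ∀ A B, IsSplit F.verts v A B → IsSplit G.verts w (e A) (e B))
    {L : List (Option (Set I))} (hn : L.Nodup) (hm : ∀ h, h ∈ L ↔ IsHalfEdge F.verts v h) :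
    (L.map (Option.map e)).Nodup ∧
      ∀ h, h ∈ L.map (Option.map e) ↔ IsHalfEdge G.verts w h := by
  obtain ⟨A, B, hAB⟩ := F.binary v hv
  have hAB' := hs A B hAB
  have hne : e A ≠ e B := by
    intro h
    obtain ⟨x, hx⟩ := G.node_nonempty hAB'.1
    exact Set.disjoint_left.1 hAB'.2.2.1 hx (h ▸ hx)
  have hch : ∀ h, IsHalfEdge F.verts v h → h = none ∨ h = some A ∨ h = some B := by
    rintro h (rfl | ⟨C, D, hCD, rfl⟩)
    · simp
    · rcases F.split_unique hAB hCD with ⟨rfl, -⟩ | ⟨rfl, -⟩ <;> simp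
  constructor
  · refine List.Nodup.map_on ?_ hn
    intro x hx y hy hxy
    rcases hch x ((hm x).1 hx) with rfl | rfl | rfl <;>
      rcases hch y ((hm y).1 hy) with rfl | rfl | rfl <;>
      simp_all [eq_comm]
  · intro h
    rw [List.mem_map]
    constructor
    · rintro ⟨x, hx, rfl⟩
      rcases (hm x).1 hx with rfl | ⟨C, D, hCD, rfl⟩
      · exact Or.inl rfl
      · exact Or.inr ⟨_, _, hs _ _ hCD, rfl⟩
    · rintro (rfl | ⟨C, D, hCD, rfl⟩)
      · exact ⟨none, (hm none).2 (Or.inl rfl), rfl⟩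
      · rcases G.split_unique hAB' hCD with ⟨rfl, -⟩ | ⟨rfl, -⟩
        · exact ⟨some A, (hm _).2 (Or.inr ⟨A, B, hAB, rfl⟩), rfl⟩
        · exact ⟨some B, (hm _).2 (Or.inr ⟨B, A, Forest.split_symm hAB, rfl⟩), rfl⟩

theorem pushLoc_flip (hφ : Set.InjOn φ (S : Set (Set I)))
    {l l' : Set I → List (Option (Set I))} {v : Set I} (hv : v ∈ S)
    (h : AdjSwap (l v) (l' v)) (h' : ∀ w, w ≠ v → l w = l' w) :
    AdjSwap (pushLoc φ η S l (φ v)) (pushLoc φ η S l' (φ v)) ∧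
      ∀ w, w ≠ φ v → pushLoc φ η S l w = pushLoc φ η S l' w := by
  constructor
  · rw [pushLoc_apply hφ hv, pushLoc_apply hφ hv]
    exact h.map _
  · intro w hw
    by_cases hx : ∃ u ∈ S, φ u = w
    · obtain ⟨u, hu, rfl⟩ := hx
      rw [pushLoc_apply hφ hu, pushLoc_apply hφ hu, h']
      rintro rfl
      exact hw rfl
    · push Not at hx
      rw [pushLoc_off hx, pushLoc_off hx]

end Push

/-- In a pair of flipped local orientations the vertex concerned is a vertex of the forest. -/
theorem flip_vertex_mem {I : Type u} (x : InnerForest I) {v : Set I} {L : List (Option (Set I))}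
    (h : AdjSwap (x.loc v) L) : v ∈ x.forest.verts := by
  by_contra hv
  obtain ⟨a, s, t, b, h1, -⟩ := h
  rw [x.loc_off v hv] at h1
  simp at h1

/-- Renaming of the letters of a global orientation. -/
def GlobalOrientation.map {I K : Type u} {V : Finset (Set I)} {W : Finset (Set K)}
    (o : GlobalOrientation V) (φ : Set I → Set K) (hφ : Set.InjOn φ (V : Set (Set I)))
    (hW : W = V.image φ) : GlobalOrientation W where
  word := o.word.map (Option.map φ)
  nodup := by
    refine List.Nodup.map_on ?_ o.nodup
    intro x hx y hy hxy
    rcases (o.mem_iff x).1 hx with rfl | ⟨v, hv, rfl⟩ <;>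
      rcases (o.mem_iff y).1 hy with rfl | ⟨w, hw, rfl⟩
    · rfl
    · simp at hxy
    · simp at hxy
    · simp only [Option.map_some, Option.some.injEq] at hxy ⊢
      exact hφ hv hw hxy
  mem_iff := by
    intro x
    rw [List.mem_map]
    constructor
    · rintro ⟨y, hy, rfl⟩
      rcases (o.mem_iff y).1 hy with rfl | ⟨v, hv, rfl⟩
      · exact Or.inl rfl
      · exact Or.inr ⟨φ v, by rw [hW]; exact Finset.mem_image_of_mem _ hv, rfl⟩
    · rintro (rfl | ⟨w, hw, rfl⟩)
      · exact ⟨none, (o.mem_iff _).2 (Or.inl rfl), rfl⟩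
      · rw [hW, Finset.mem_image] at hw
        obtain ⟨v, hv, rfl⟩ := hw
        exact ⟨some v, (o.mem_iff _).2 (Or.inr ⟨v, hv, rfl⟩), rfl⟩

/-! ## Relabelling of the leaves -/

section Relabel

variable {I K : Type u} (e : I ≃ K)

theorem node_relabel {V : Finset (Set I)} {A : Set I} (h : IsNode V A) :
    IsNode (V.image fun v => e '' v) (e '' A) := by
  rcases h with h | ⟨i, rfl⟩
  · exact Or.inl (Finset.mem_image_of_mem _ h)
  · exact Or.inr ⟨e i, by simp⟩

theorem split_relabel {V : Finset (Set I)} {v A B : Set I} (h : IsSplit V v A B) :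
    IsSplit (V.image fun v => e '' v) (e '' v) (e '' A) (e '' B) :=
  ⟨node_relabel e h.1, node_relabel e h.2.1, (Set.disjoint_image_iff e.injective).2 h.2.2.1,
    by rw [← Set.image_union, h.2.2.2]⟩

/-- Action of a bijection on forests. -/
def Forest.relabel (F : Forest I) : Forest K where
  verts := F.verts.image fun v => e '' v
  nonempty := by
    intro w hw
    obtain ⟨v, hv, rfl⟩ := Finset.mem_image.1 hw
    exact (F.nonempty v hv).image e
  laminar := by
    intro w hw w' hw'
    obtain ⟨v, hv, rfl⟩ := Finset.mem_image.1 hw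
    obtain ⟨v', hv', rfl⟩ := Finset.mem_image.1 hw'
    rw [Set.image_subset_image_iff e.injective, Set.image_subset_image_iff e.injective,
      Set.disjoint_image_iff e.injective]
    exact F.laminar v hv v' hv'
  binary := by
    intro w hw
    obtain ⟨v, hv, rfl⟩ := Finset.mem_image.1 hw
    obtain ⟨A, B, h⟩ := F.binary v hv
    exact ⟨e '' A, e '' B, split_relabel e h⟩

/-- Action of a bijection on inner-oriented forests. -/
def InnerForest.relabel (x : InnerForest I) : InnerForest K where
  forest := x.forest.relabel e
  glob := x.glob.map (fun v => e '' v) e.injective.image_injective.injOn rfl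
  loc := pushLoc (fun v => e '' v) (fun _ A => e '' A) x.forest.verts x.loc
  loc_nodup := by
    intro w hw
    obtain ⟨v, hv, rfl⟩ := Finset.mem_image.1 hw
    rw [pushLoc_apply (φ := fun v => e '' v) e.injective.image_injective.injOn hv]
    exact (pushLoc_valid x.forest (x.forest.relabel e) hv (fun A B h => split_relabel e h)
      (x.loc_nodup v hv) (x.loc_mem v hv)).1
  loc_mem := by
    intro w hw
    obtain ⟨v, hv, rfl⟩ := Finset.mem_image.1 hw
    rw [pushLoc_apply (φ := fun v => e '' v) e.injective.image_injective.injOn hv]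
    exact (pushLoc_valid x.forest (x.forest.relabel e) hv (fun A B h => split_relabel e h)
      (x.loc_nodup v hv) (x.loc_mem v hv)).2
  loc_off := by
    intro w hw
    refine pushLoc_off fun v hv h => hw ?_
    rw [← h]
    exact Finset.mem_image_of_mem _ hv

theorem InnerForest.relabel_flip {x y : InnerForest I} (h : Flip x y) :
    Flip (x.relabel e) (y.relabel e) := by
  obtain ⟨hF, h⟩ := h
  refine ⟨by simp only [InnerForest.relabel, hF], ?_⟩
  rcases h with ⟨h1, h2⟩ | ⟨h1, v, h2, h3⟩
  · exact Or.inl ⟨h1.map _, by simp only [InnerForest.relabel, hF, h2]⟩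
  · refine Or.inr ⟨by simp only [InnerForest.relabel, GlobalOrientation.map, h1], e '' v, ?_⟩
    have := pushLoc_flip (φ := fun v => e '' v) (η := fun _ A => e '' A)
      e.injective.image_injective.injOn (flip_vertex_mem x h2) h2 h3
    simp only [InnerForest.relabel, ← hF]
    exact this

/-- Functoriality of `Bess` on bijections. -/
def Bess.relabel : Bess I →ₗ[ℚ] Bess K :=
  Bess.lift (fun x => Bess.of (x.relabel e)) fun _ _ h =>
    Bess.of_flip (InnerForest.relabel_flip e h)

end Relabel

/-! ## Composition

For a forest `F` on `I ⊔ {⋆}` and a forest `F₂` on `J`, the composition `F ∘_⋆ F₂` plugs `F₂`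
into the leaf `⋆`.  By the Leibniz rule
`Ω_{i,⋆} ∘_⋆ E_{j,k} = E_{j,⋆} ∘_⋆ Ω_{i,k} + E_{k,⋆} ∘_⋆ Ω_{i,j}`, each inner vertex on the
path from `⋆` to the root is attached to one of the trees of `F₂`, and all choices are summed.
The leaf `⋆` is `none` and `I ⊔ J` is `I ⊕ J`. -/

section Graft

variable {I J : Type u}

/-- The inner vertices on the path from the leaf `⋆` to the root. -/
abbrev PathVert (F : Forest (Option I)) : Type u := {v : Set (Option I) // v ∈ F.verts ∧ none ∈ v}

/-- The trees of a forest. -/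
abbrev Tree (F : Forest J) : Type u := {T : Set J // F.IsTree T}

instance (F : Forest (Option I)) : Finite (PathVert F) :=
  Finite.of_injective (fun v : PathVert F => (⟨v.1, v.2.1⟩ : F.verts))
    fun a b h => Subtype.ext (by simpa using h)

instance (F : Forest (Option I)) : Fintype (PathVert F) := Fintype.ofFinite _

instance [Finite J] (F : Forest J) : Fintype (Tree F) := Fintype.ofFinite _

/-- The map that collapses `J` to `⋆`. -/
def collapse : I ⊕ J → Option I := Sum.elim some fun _ => none

/-- The branch above `v` that does not contain the leaf `⋆`. -/
def side (F : Forest (Option I)) (v : Set (Option I)) : Set (Option I) :=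
  {x | ∃ A B, IsSplit F.verts v A B ∧ none ∈ A ∧ x ∈ B}

variable (F : Forest (Option I)) (F₂ : Forest J)

/-- The vertex of the composed forest that comes from `v`, when the vertices on the path of `⋆`
are attached to trees of `F₂` by `s`: above it are the leaves of the tree `s v` and the side
branches of the vertices of the path up to `v` that are attached to the same tree. -/
def grow (s : PathVert F → Tree F₂) (v : PathVert F) : Set (I ⊕ J) :=
  Sum.inr '' (s v).1 ∪ {x | ∃ u : PathVert F, u.1 ⊆ v.1 ∧ s u = s v ∧ collapse x ∈ side F u.1}

/-- The vertex of the composed forest that comes from the vertex `v` of `F`. -/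
def graftVert (s : PathVert F → Tree F₂) (v : Set (Option I)) : Set (I ⊕ J) :=
  if h : v ∈ F.verts ∧ none ∈ v then grow F F₂ s ⟨v, h⟩ else collapse ⁻¹' v

/-- The branch of the composed forest that comes from the branch `A` at the vertex `v`. -/
def graftBranch (s : PathVert F → Tree F₂) (v A : Set (Option I)) : Set (I ⊕ J) :=
  graftVert F F₂ s v ∩ collapse ⁻¹' A

variable {F F₂}

theorem side_eq {v A B : Set (Option I)} (h : IsSplit F.verts v A B) (hA : none ∈ A) :
    side F v = B := by
  ext x
  constructor
  · rintro ⟨A', B', h', hA', hx⟩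
    rcases F.split_unique h h' with ⟨rfl, rfl⟩ | ⟨rfl, rfl⟩
    · exact hx
    · exact absurd hA' (Set.disjoint_left.1 h.2.2.1 hA)
  · intro hx
    exact ⟨A, B, h, hA, hx⟩

theorem path_split (v : PathVert F) :
    ∃ A, IsSplit F.verts v.1 A (side F v.1) ∧ none ∈ A := by
  obtain ⟨A, B, h⟩ := F.binary v.1 v.2.1
  have hn : none ∈ A ∪ B := h.2.2.2 ▸ v.2.2
  rcases hn with hn | hn
  · exact ⟨A, by rw [side_eq h hn]; exact h, hn⟩
  · exact ⟨B, by rw [side_eq (Forest.split_symm h) hn]; exact Forest.split_symm h, hn⟩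

theorem none_notMem_side (v : PathVert F) : none ∉ side F v.1 := by
  obtain ⟨A, h, hA⟩ := path_split v
  exact Set.disjoint_left.1 h.2.2.1 hA

theorem side_subset (v : PathVert F) : side F v.1 ⊆ v.1 := by
  obtain ⟨A, h, hA⟩ := path_split v
  intro x hx
  rw [← h.2.2.2]
  exact Or.inr hx

theorem side_nonempty (v : PathVert F) : ∃ i, some i ∈ side F v.1 := by
  obtain ⟨A, h, hA⟩ := path_split v
  obtain ⟨x, hx⟩ := F.node_nonempty h.2.1
  rcases x with _ | i
  · exact absurd hx (none_notMem_side v)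
  · exact ⟨i, hx⟩

theorem path_total (u v : PathVert F) : u.1 ⊆ v.1 ∨ v.1 ⊆ u.1 := by
  rcases F.laminar u.1 u.2.1 v.1 v.2.1 with h | h | h
  · exact Or.inl h
  · exact Or.inr h
  · exact absurd v.2.2 (Set.disjoint_left.1 h u.2.2)

theorem path_sub_branch {u v : PathVert F} (h : u.1 ⊆ v.1) (hne : u ≠ v)
    {A B : Set (Option I)} (hs : IsSplit F.verts v.1 A B) (hA : none ∈ A) : u.1 ⊆ A := by
  rcases F.node_sub_branch hs (Or.inl u.2.1) h (fun h => hne (Subtype.ext h)) with h | h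
  · exact h
  · exact absurd (h u.2.2) (Set.disjoint_left.1 hs.2.2.1 hA)

theorem side_disjoint {u v : PathVert F} (hne : u ≠ v) :
    Disjoint (side F u.1) (side F v.1) := by
  have key : ∀ {u v : PathVert F}, u ≠ v → u.1 ⊆ v.1 →
      Disjoint (side F u.1) (side F v.1) := by
    intro u v hne h
    obtain ⟨A, hs, hA⟩ := path_split v
    exact hs.2.2.1.mono_left ((side_subset u).trans (path_sub_branch h hne hs hA))
  rcases path_total u v with h | h
  · exact key hne h
  · exact (key hne.symm h).symm

theorem sub_side_of_mem {x : Set (Option I)} (hx : x ∈ F.verts) (hn : none ∉ x)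
    (u : PathVert F) {a : Option I} (ha : a ∈ x) (hau : a ∈ side F u.1) : x ⊆ side F u.1 := by
  obtain ⟨A, hs, hA⟩ := path_split u
  have hxu : x ⊆ u.1 := by
    rcases F.laminar x hx u.1 u.2.1 with h | h | h
    · exact h
    · exact absurd (h u.2.2) hn
    · exact absurd (side_subset u hau) (Set.disjoint_left.1 h ha)
  rcases F.node_sub_branch hs (Or.inl hx) hxu (fun h => hn (h ▸ u.2.2)) with h | h
  · exact absurd hau (Set.disjoint_left.1 hs.2.2.1 (h ha))
  · exact h

theorem tree_disjoint {T T' : Tree F₂} (hne : T ≠ T') : Disjoint T.1 T'.1 := by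
  rcases F₂.node_laminar T.2.1 T'.2.1 with h | h | h
  · exact absurd (Subtype.ext (T.2.2 _ T'.2.1 h)).symm hne
  · exact absurd (Subtype.ext (T'.2.2 _ T.2.1 h)) hne
  · exact h

theorem inr_mem_grow (s : PathVert F → Tree F₂) (v : PathVert F) (j : J) :
    Sum.inr j ∈ grow F F₂ s v ↔ j ∈ (s v).1 := by
  constructor
  · rintro (⟨k, hk, h⟩ | ⟨u, -, -, h⟩)
    · cases h; exact hk
    · exact absurd h (none_notMem_side u)
  · intro h
    exact Or.inl ⟨j, h, rfl⟩

theorem inl_mem_grow (s : PathVert F → Tree F₂) (v : PathVert F) (i : I) :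
    Sum.inl i ∈ grow F F₂ s v ↔
      ∃ u : PathVert F, u.1 ⊆ v.1 ∧ s u = s v ∧ some i ∈ side F u.1 := by
  constructor
  · rintro (⟨k, hk, h⟩ | h)
    · cases h
    · exact h
  · intro h
    exact Or.inr h

theorem graftVert_path (s : PathVert F → Tree F₂) (v : PathVert F) :
    graftVert F F₂ s v.1 = grow F F₂ s v := dif_pos v.2

theorem graftVert_of_notMem (s : PathVert F → Tree F₂) {v : Set (Option I)} (hn : none ∉ v) :
    graftVert F F₂ s v = collapse ⁻¹' v := dif_neg fun h => hn h.2

theorem graftVert_subset (s : PathVert F → Tree F₂) (v : Set (Option I)) :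
    graftVert F F₂ s v ⊆ collapse ⁻¹' v := by
  by_cases h : v ∈ F.verts ∧ none ∈ v
  · rw [graftVert, dif_pos h]
    rintro (i | j) hx
    · obtain ⟨u, hu, -, hi⟩ := (inl_mem_grow s _ i).1 hx
      exact hu (side_subset u hi)
    · exact h.2
  · rw [graftVert, dif_neg h]

variable (F F₂) in
/-- The inner vertices of the composed forest. -/
def graftVerts (s : PathVert F → Tree F₂) : Finset (Set (I ⊕ J)) :=
  F.verts.image (graftVert F F₂ s) ∪ F₂.verts.image fun u => Sum.inr '' u

theorem graft_node_left (s : PathVert F → Tree F₂) {A : Set (Option I)}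
    (h : IsNode F.verts A) (hn : none ∉ A) : IsNode (graftVerts F F₂ s) (collapse ⁻¹' A) := by
  rcases h with h | ⟨x, rfl⟩
  · left
    rw [← graftVert_of_notMem s hn]
    exact Finset.mem_union_left _ (Finset.mem_image_of_mem _ h)
  · right
    rcases x with _ | i
    · exact absurd rfl hn
    · refine ⟨Sum.inl i, ?_⟩
      ext (k | k) <;> simp [collapse]

theorem graft_node_right (s : PathVert F → Tree F₂) {A : Set J} (h : IsNode F₂.verts A) :
    IsNode (graftVerts F F₂ s) (Sum.inr '' A) := by
  rcases h with h | ⟨j, rfl⟩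
  · exact Or.inl (Finset.mem_union_right _ (Finset.mem_image_of_mem _ h))
  · exact Or.inr ⟨Sum.inr j, by simp⟩

theorem graft_split_right (s : PathVert F → Tree F₂) {u A B : Set J}
    (h : IsSplit F₂.verts u A B) :
    IsSplit (graftVerts F F₂ s) (Sum.inr '' u) (Sum.inr '' A) (Sum.inr '' B) :=
  ⟨graft_node_right s h.1, graft_node_right s h.2.1,
    (Set.disjoint_image_iff Sum.inr_injective).2 h.2.2.1,
    by rw [← Set.image_union, h.2.2.2]⟩

theorem graft_node_path (s : PathVert F → Tree F₂) (v : PathVert F) {A B : Set (Option I)}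
    (h : IsSplit F.verts v.1 A B) (hA : none ∈ A) :
    IsNode (graftVerts F F₂ s) (graftBranch F F₂ s v.1 A) := by
  have hB : side F v.1 = B := side_eq h hA
  rw [graftBranch, graftVert_path]
  by_cases hP : ∃ u : PathVert F, u.1 ⊆ v.1 ∧ u ≠ v ∧ s u = s v
  · obtain ⟨u, ⟨hu1, hu2, hu3⟩, hmax⟩ := Set.Finite.exists_maximalFor
      (fun u : PathVert F => u.1) {u : PathVert F | u.1 ⊆ v.1 ∧ u ≠ v ∧ s u = s v}
      (Set.toFinite _) hP
    have huA := path_sub_branch hu1 hu2 h hA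
    have : grow F F₂ s v ∩ collapse ⁻¹' A = grow F F₂ s u := by
      ext (i | j)
      · rw [Set.mem_inter_iff, inl_mem_grow, inl_mem_grow]
        constructor
        · rintro ⟨⟨w, hw1, hw2, hw3⟩, hi⟩
          have hwv : w ≠ v := by
            rintro rfl
            rw [hB] at hw3
            exact Set.disjoint_left.1 h.2.2.1 hi hw3
          refine ⟨w, ?_, hw2.trans hu3.symm, hw3⟩
          rcases path_total w u with h' | h'
          · exact h'
          · exact hmax ⟨hw1, hwv, hw2⟩ h'
        · rintro ⟨w, hw1, hw2, hw3⟩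
          exact ⟨⟨w, hw1.trans hu1, hw2.trans hu3, hw3⟩, huA (hw1 (side_subset w hw3))⟩
      · rw [Set.mem_inter_iff, inr_mem_grow, inr_mem_grow, hu3]
        exact ⟨fun h => h.1, fun h => ⟨h, hA⟩⟩
    rw [this, ← graftVert_path]
    exact Or.inl (Finset.mem_union_left _ (Finset.mem_image_of_mem _ u.2.1))
  · have : grow F F₂ s v ∩ collapse ⁻¹' A = Sum.inr '' (s v).1 := by
      ext (i | j)
      · rw [Set.mem_inter_iff, inl_mem_grow]
        constructor
        · rintro ⟨⟨w, hw1, hw2, hw3⟩, hi⟩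
          by_cases hwv : w = v
          · subst hwv
            rw [hB] at hw3
            exact absurd hw3 (Set.disjoint_left.1 h.2.2.1 hi)
          · exact absurd ⟨w, hw1, hwv, hw2⟩ hP
        · rintro ⟨_, _, h⟩
          cases h
      · rw [Set.mem_inter_iff, inr_mem_grow]
        constructor
        · rintro ⟨h1, -⟩
          exact ⟨j, h1, rfl⟩
        · rintro ⟨k, hk, h'⟩
          cases h'
          exact ⟨hk, hA⟩
    rw [this]
    exact graft_node_right s (s v).2.1

theorem graft_split_left (s : PathVert F → Tree F₂) {v A B : Set (Option I)}
    (hv : v ∈ F.verts) (h : IsSplit F.verts v A B) :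
    IsSplit (graftVerts F F₂ s) (graftVert F F₂ s v) (graftBranch F F₂ s v A)
      (graftBranch F F₂ s v B) := by
  have key : ∀ {A B : Set (Option I)}, IsSplit F.verts v A B →
      IsNode (graftVerts F F₂ s) (graftBranch F F₂ s v A) := by
    intro A B h
    by_cases hA : none ∈ A
    · exact graft_node_path s ⟨v, hv, h.2.2.2 ▸ Or.inl hA⟩ h hA
    · have hAv : A ⊆ v := h.2.2.2 ▸ Set.subset_union_left
      have : graftBranch F F₂ s v A = collapse ⁻¹' A := by
        refine Set.inter_eq_right.2 ?_
        by_cases hn : none ∈ v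
        · have hB : none ∈ B := by
            rw [← h.2.2.2] at hn
            exact hn.resolve_left hA
          have hs : side F v = A := side_eq (Forest.split_symm h) hB
          rw [graftVert, dif_pos ⟨hv, hn⟩]
          intro x hx
          exact Or.inr ⟨⟨v, hv, hn⟩, subset_rfl, rfl, by rw [hs]; exact hx⟩
        · rw [graftVert_of_notMem s hn]
          exact Set.preimage_mono hAv
      rw [this]
      exact graft_node_left s h.1 hA
  refine ⟨key h, key (Forest.split_symm h), ?_, ?_⟩
  · exact (h.2.2.1.preimage collapse).mono Set.inter_subset_right Set.inter_subset_right
  · rw [graftBranch, graftBranch, ← Set.inter_union_distrib_left, ← Set.preimage_union,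
      h.2.2.2]
    exact Set.inter_eq_left.2 (graftVert_subset s v)

theorem graft_inl_mem (s : PathVert F → Tree F₂) {v : Set (Option I)} (hv : v ∈ F.verts) :
    ∃ i, Sum.inl i ∈ graftVert F F₂ s v := by
  by_cases hn : none ∈ v
  · obtain ⟨i, hi⟩ := side_nonempty (⟨v, hv, hn⟩ : PathVert F)
    refine ⟨i, ?_⟩
    rw [graftVert, dif_pos ⟨hv, hn⟩, inl_mem_grow]
    exact ⟨⟨v, hv, hn⟩, subset_rfl, rfl, hi⟩
  · rw [graftVert_of_notMem s hn]
    obtain ⟨x, hx⟩ := F.nonempty v hv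
    rcases x with _ | i
    · exact absurd hx hn
    · exact ⟨i, hx⟩

theorem grow_laminar (s : PathVert F → Tree F₂) (v w : PathVert F) :
    grow F F₂ s v ⊆ grow F F₂ s w ∨ grow F F₂ s w ⊆ grow F F₂ s v ∨
      Disjoint (grow F F₂ s v) (grow F F₂ s w) := by
  by_cases hs : s v = s w
  · have key : ∀ {v w : PathVert F}, s v = s w → v.1 ⊆ w.1 →
        grow F F₂ s v ⊆ grow F F₂ s w := by
      intro v w hs h
      rintro (i | j) hx
      · rw [inl_mem_grow] at hx ⊢
        obtain ⟨u, h1, h2, h3⟩ := hx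
        exact ⟨u, h1.trans h, h2.trans hs, h3⟩
      · rw [inr_mem_grow] at hx ⊢
        rwa [← hs]
    rcases path_total v w with h | h
    · exact Or.inl (key hs h)
    · exact Or.inr (Or.inl (key hs.symm h))
  · refine Or.inr (Or.inr (Set.disjoint_left.2 ?_))
    rintro (i | j) hx hy
    · rw [inl_mem_grow] at hx hy
      obtain ⟨u, -, h2, h3⟩ := hx
      obtain ⟨u', -, h2', h3'⟩ := hy
      have hne : u ≠ u' := by
        rintro rfl
        exact hs (h2.symm.trans h2')
      exact Set.disjoint_left.1 (side_disjoint hne) h3 h3'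
    · rw [inr_mem_grow] at hx hy
      exact Set.disjoint_left.1 (tree_disjoint hs) hx hy

theorem grow_laminar_left (s : PathVert F → Tree F₂) (v : PathVert F) {x : Set (Option I)}
    (hx : x ∈ F.verts) (hn : none ∉ x) :
    collapse ⁻¹' x ⊆ grow F F₂ s v ∨ Disjoint (collapse ⁻¹' x) (grow F F₂ s v) := by
  by_cases h : Disjoint (collapse ⁻¹' x) (grow F F₂ s v)
  · exact Or.inr h
  · left
    rw [Set.not_disjoint_iff] at h
    obtain ⟨i | j, hi, hg⟩ := h
    · rw [inl_mem_grow] at hg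
      obtain ⟨u, h1, h2, h3⟩ := hg
      have hsub := sub_side_of_mem hx hn u hi h3
      intro y hy
      exact Or.inr ⟨u, h1, h2, hsub hy⟩
    · exact absurd hi hn

theorem grow_laminar_right (s : PathVert F → Tree F₂) (v : PathVert F) {u : Set J}
    (hu : u ∈ F₂.verts) :
    Sum.inr '' u ⊆ grow F F₂ s v ∨ Disjoint (Sum.inr '' u) (grow F F₂ s v) := by
  rcases F₂.node_laminar (Or.inl hu) (s v).2.1 with h | h | h
  · left
    rintro _ ⟨j, hj, rfl⟩
    exact (inr_mem_grow s v j).2 (h hj)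
  · left
    rw [(s v).2.2 u (Or.inl hu) h]
    exact Set.subset_union_left
  · right
    rw [Set.disjoint_left]
    rintro _ ⟨j, hj, rfl⟩ hg
    exact Set.disjoint_left.1 h hj ((inr_mem_grow s v j).1 hg)

variable (F F₂) in
/-- The term of the composition `F ∘_⋆ F₂` given by the choice `s`. -/
def graft (s : PathVert F → Tree F₂) : Forest (I ⊕ J) where
  verts := graftVerts F F₂ s
  nonempty := by
    intro w hw
    rcases Finset.mem_union.1 hw with hw | hw
    · obtain ⟨v, hv, rfl⟩ := Finset.mem_image.1 hw
      obtain ⟨i, hi⟩ := graft_inl_mem s hv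
      exact ⟨_, hi⟩
    · obtain ⟨u, hu, rfl⟩ := Finset.mem_image.1 hw
      exact (F₂.nonempty u hu).image _
  laminar := by
    have left : ∀ v ∈ F.verts, ∀ w ∈ F.verts,
        graftVert F F₂ s v ⊆ graftVert F F₂ s w ∨ graftVert F F₂ s w ⊆ graftVert F F₂ s v ∨
          Disjoint (graftVert F F₂ s v) (graftVert F F₂ s w) := by
      intro v hv w hw
      by_cases h1 : none ∈ v <;> by_cases h2 : none ∈ w
      · have := grow_laminar s ⟨v, hv, h1⟩ ⟨w, hw, h2⟩
        rwa [← graftVert_path, ← graftVert_path] at this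
      · have := grow_laminar_left s ⟨v, hv, h1⟩ hw h2
        rw [← graftVert_path, ← graftVert_of_notMem s h2, disjoint_comm] at this
        exact Or.inr this
      · have := grow_laminar_left s ⟨w, hw, h2⟩ hv h1
        rw [← graftVert_path, ← graftVert_of_notMem s h1] at this
        tauto
      · rw [graftVert_of_notMem s h1, graftVert_of_notMem s h2]
        rcases F.laminar v hv w hw with h | h | h
        · exact Or.inl (Set.preimage_mono h)
        · exact Or.inr (Or.inl (Set.preimage_mono h))
        · exact Or.inr (Or.inr (h.preimage _))
    have mixed : ∀ v ∈ F.verts, ∀ u ∈ F₂.verts,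
        Sum.inr '' u ⊆ graftVert F F₂ s v ∨ Disjoint (Sum.inr '' u) (graftVert F F₂ s v) := by
      intro v hv u hu
      by_cases h1 : none ∈ v
      · have := grow_laminar_right s ⟨v, hv, h1⟩ hu
        rwa [← graftVert_path] at this
      · right
        rw [graftVert_of_notMem s h1, Set.disjoint_left]
        rintro _ ⟨j, hj, rfl⟩ h
        exact h1 h
    intro a ha b hb
    rcases Finset.mem_union.1 ha with ha | ha <;> rcases Finset.mem_union.1 hb with hb | hb <;>
      obtain ⟨v, hv, rfl⟩ := Finset.mem_image.1 ha <;>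
      obtain ⟨w, hw, rfl⟩ := Finset.mem_image.1 hb
    · exact left v hv w hw
    · have := mixed v hv w hw
      rw [disjoint_comm] at this
      exact Or.inr this
    · have := mixed w hw v hv
      tauto
    · rw [Set.image_subset_image_iff Sum.inr_injective,
        Set.image_subset_image_iff Sum.inr_injective, Set.disjoint_image_iff Sum.inr_injective]
      exact F₂.laminar v hv w hw
  binary := by
    intro w hw
    rcases Finset.mem_union.1 hw with hw | hw
    · obtain ⟨v, hv, rfl⟩ := Finset.mem_image.1 hw
      obtain ⟨A, B, h⟩ := F.binary v hv
      exact ⟨_, _, graft_split_left s hv h⟩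
    · obtain ⟨u, hu, rfl⟩ := Finset.mem_image.1 hw
      obtain ⟨A, B, h⟩ := F₂.binary u hu
      exact ⟨_, _, graft_split_right s h⟩

theorem graftVert_injOn (s : PathVert F → Tree F₂) :
    Set.InjOn (graftVert F F₂ s) (F.verts : Set (Set (Option I))) := by
  have key : ∀ v w : PathVert F, v.1 ⊆ w.1 → grow F F₂ s v = grow F F₂ s w → v = w := by
    intro v w hvw h
    by_contra hne
    obtain ⟨i, hi⟩ := side_nonempty w
    have : Sum.inl i ∈ grow F F₂ s v := by
      rw [h, inl_mem_grow]
      exact ⟨w, subset_rfl, rfl, hi⟩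
    obtain ⟨u, h1, -, h3⟩ := (inl_mem_grow s v i).1 this
    have huw : u ≠ w := by
      rintro rfl
      exact hne (Subtype.ext (Set.Subset.antisymm hvw h1))
    exact Set.disjoint_left.1 (side_disjoint huw) h3 hi
  have mixed : ∀ (v : PathVert F) (w : Set (Option I)), none ∉ w →
      grow F F₂ s v ≠ collapse ⁻¹' w := by
    intro v w hw h
    obtain ⟨j, hj⟩ := F₂.node_nonempty (s v).2.1
    have : Sum.inr j ∈ grow F F₂ s v := (inr_mem_grow s v j).2 hj
    rw [h] at this
    exact hw this
  intro v hv w hw h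
  by_cases h1 : none ∈ v <;> by_cases h2 : none ∈ w
  · have h' : grow F F₂ s ⟨v, hv, h1⟩ = grow F F₂ s ⟨w, hw, h2⟩ := by
      rwa [← graftVert_path, ← graftVert_path]
    rcases path_total (⟨v, hv, h1⟩ : PathVert F) ⟨w, hw, h2⟩ with h3 | h3
    · exact congrArg Subtype.val (key _ _ h3 h')
    · exact (congrArg Subtype.val (key _ _ h3 h'.symm)).symm
  · rw [graftVert_of_notMem s h2] at h
    exact absurd ((graftVert_path s ⟨v, hv, h1⟩).symm.trans h) (mixed _ w h2)
  · rw [graftVert_of_notMem s h1] at h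
    exact absurd ((graftVert_path s ⟨w, hw, h2⟩).symm.trans h.symm) (mixed _ v h1)
  · rw [graftVert_of_notMem s h1, graftVert_of_notMem s h2] at h
    ext (_ | i)
    · exact ⟨fun h => absurd h h1, fun h => absurd h h2⟩
    · exact Set.ext_iff.1 h (Sum.inl i)

theorem graftVert_ne (s : PathVert F → Tree F₂) {v : Set (Option I)} (hv : v ∈ F.verts)
    (u : Set J) : graftVert F F₂ s v ≠ Sum.inr '' u := by
  intro h
  obtain ⟨i, hi⟩ := graft_inl_mem s hv
  rw [h] at hi
  obtain ⟨_, _, h'⟩ := hi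
  cases h'

/-- The number of factors before `R`. -/
def beforeR {α : Type*} (l : List (Option α)) : ℕ := (l.takeWhile Option.isSome).length

/-- The word with the factor `R` removed. -/
def eraseR {α : Type*} (l : List (Option α)) : List (Option α) := l.filter Option.isSome

/-- The global orientation `o₁ ∧ r ∧ o₂` modulo `R₁ ∧ r ∧ R₂ = R`, up to the sign
`(-1) ^ k` where `k` is the number of factors of `o₂` before `R₂`. -/
def graftGlob (s : PathVert F → Tree F₂) (o₁ : GlobalOrientation F.verts)
    (o₂ : GlobalOrientation F₂.verts) : GlobalOrientation (graft F F₂ s).verts where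
  word := o₁.word.map (Option.map (graftVert F F₂ s)) ++
    (eraseR o₂.word).map (Option.map fun u => Sum.inr '' u)
  nodup := by
    refine List.Nodup.append
      (o₁.map (graftVert F F₂ s) (graftVert_injOn s) rfl).nodup
      ((o₂.map (fun u => Sum.inr '' u) Sum.inr_injective.image_injective.injOn rfl).nodup.sublist
        (List.filter_sublist.map _)) ?_
    intro x hx hy
    rw [List.mem_map] at hx hy
    obtain ⟨a, ha, rfl⟩ := hx
    obtain ⟨b, hb, hab⟩ := hy
    rw [eraseR, List.mem_filter] at hb
    rcases (o₂.mem_iff b).1 hb.1 with rfl | ⟨u, hu, rfl⟩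
    · simp at hb
    · rcases (o₁.mem_iff a).1 ha with rfl | ⟨v, hv, rfl⟩
      · simp at hab
      · simp only [Option.map_some, Option.some.injEq] at hab
        exact graftVert_ne s hv u hab.symm
  mem_iff := by
    intro x
    rw [List.mem_append, List.mem_map, List.mem_map]
    constructor
    · rintro (⟨a, ha, rfl⟩ | ⟨b, hb, rfl⟩)
      · rcases (o₁.mem_iff a).1 ha with rfl | ⟨v, hv, rfl⟩
        · exact Or.inl rfl
        · exact Or.inr ⟨_, Finset.mem_union_left _ (Finset.mem_image_of_mem _ hv), rfl⟩
      · rcases (o₂.mem_iff b).1 (List.mem_filter.1 hb).1 with rfl | ⟨u, hu, rfl⟩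
        · exact Or.inl rfl
        · exact Or.inr ⟨_, Finset.mem_union_right _ (Finset.mem_image_of_mem _ hu), rfl⟩
    · rintro (rfl | ⟨w, hw, rfl⟩)
      · exact Or.inl ⟨none, (o₁.mem_iff _).2 (Or.inl rfl), rfl⟩
      · rcases Finset.mem_union.1 hw with hw | hw
        · obtain ⟨v, hv, rfl⟩ := Finset.mem_image.1 hw
          exact Or.inl ⟨some v, (o₁.mem_iff _).2 (Or.inr ⟨v, hv, rfl⟩), rfl⟩
        · obtain ⟨u, hu, rfl⟩ := Finset.mem_image.1 hw
          refine Or.inr ⟨some u, ?_, rfl⟩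
          rw [eraseR, List.mem_filter]
          exact ⟨(o₂.mem_iff _).2 (Or.inr ⟨u, hu, rfl⟩), rfl⟩

/-- The local orientations of the composed forest are those of the two forests; for each vertex
one of the two words below is empty. -/
def graftLoc (s : PathVert F → Tree F₂) (l₁ : Set (Option I) → List (Option (Set (Option I))))
    (l₂ : Set J → List (Option (Set J))) (w : Set (I ⊕ J)) : List (Option (Set (I ⊕ J))) :=
  pushLoc (graftVert F F₂ s) (graftBranch F F₂ s) F.verts l₁ w ++
    pushLoc (fun u => Sum.inr '' u) (fun _ A => Sum.inr '' A) F₂.verts l₂ w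

theorem graftLoc_left (s : PathVert F → Tree F₂)
    (l₁ : Set (Option I) → List (Option (Set (Option I))))
    (l₂ : Set J → List (Option (Set J))) {v : Set (Option I)} (hv : v ∈ F.verts) :
    graftLoc s l₁ l₂ (graftVert F F₂ s v) =
      (l₁ v).map (Option.map (graftBranch F F₂ s v)) := by
  rw [graftLoc, pushLoc_apply (graftVert_injOn s) hv,
    pushLoc_off fun u _ h => graftVert_ne s hv u h.symm, List.append_nil]

theorem graftLoc_right (s : PathVert F → Tree F₂)
    (l₁ : Set (Option I) → List (Option (Set (Option I))))
    (l₂ : Set J → List (Option (Set J))) {u : Set J} (hu : u ∈ F₂.verts) :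
    graftLoc (F := F) (F₂ := F₂) s l₁ l₂ (Sum.inr '' u) =
      (l₂ u).map (Option.map fun A => Sum.inr '' A) := by
  rw [graftLoc, pushLoc_off fun v hv h => graftVert_ne s hv u h,
    pushLoc_apply (φ := fun u : Set J => (Sum.inr '' u : Set (I ⊕ J)))
      Sum.inr_injective.image_injective.injOn hu, List.nil_append]

/-- The term of the composition of two inner-oriented forests given by the choice `s`
(up to the sign of `graftGlob`). -/
def graftInner (x : InnerForest (Option I)) (y : InnerForest J)
    (s : PathVert x.forest → Tree y.forest) : InnerForest (I ⊕ J) where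
  forest := graft x.forest y.forest s
  glob := graftGlob s x.glob y.glob
  loc := graftLoc s x.loc y.loc
  loc_nodup := by
    intro w hw
    rcases Finset.mem_union.1 hw with hw | hw
    · obtain ⟨v, hv, rfl⟩ := Finset.mem_image.1 hw
      rw [graftLoc_left s _ _ hv]
      exact (pushLoc_valid x.forest (graft x.forest y.forest s) hv
        (fun A B h => graft_split_left s hv h) (x.loc_nodup v hv) (x.loc_mem v hv)).1
    · obtain ⟨u, hu, rfl⟩ := Finset.mem_image.1 hw
      rw [graftLoc_right s _ _ hu]
      exact (pushLoc_valid y.forest (graft x.forest y.forest s) hu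
        (fun A B h => graft_split_right s h) (y.loc_nodup u hu) (y.loc_mem u hu)).1
  loc_mem := by
    intro w hw
    rcases Finset.mem_union.1 hw with hw | hw
    · obtain ⟨v, hv, rfl⟩ := Finset.mem_image.1 hw
      rw [graftLoc_left s _ _ hv]
      exact (pushLoc_valid x.forest (graft x.forest y.forest s) hv
        (fun A B h => graft_split_left s hv h) (x.loc_nodup v hv) (x.loc_mem v hv)).2
    · obtain ⟨u, hu, rfl⟩ := Finset.mem_image.1 hw
      rw [graftLoc_right s _ _ hu]
      exact (pushLoc_valid y.forest (graft x.forest y.forest s) hu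
        (fun A B h => graft_split_right s h) (y.loc_nodup u hu) (y.loc_mem u hu)).2
  loc_off := by
    intro w hw
    rw [graftLoc, pushLoc_off, pushLoc_off, List.append_nil]
    · intro u hu h
      exact hw (Finset.mem_union_right _ (h ▸ Finset.mem_image_of_mem _ hu))
    · intro v hv h
      exact hw (Finset.mem_union_left _ (h ▸ Finset.mem_image_of_mem _ hv))

end Graft

section Comp

theorem swap_erase {α : Type*} {l l' : List (Option α)} (h : AdjSwap l l') (hn : l.Nodup) :
    ((-1 : ℚ) ^ beforeR l = -(-1) ^ beforeR l' ∧ eraseR l = eraseR l') ∨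
      (beforeR l = beforeR l' ∧ AdjSwap (eraseR l) (eraseR l')) := by
  obtain ⟨a, x, y, b, rfl, rfl⟩ := h
  rw [List.nodup_append] at hn
  have h1 : ∀ c c' : List (Option α), none ∈ a → beforeR (a ++ c) = beforeR (a ++ c') := by
    intro c c' ha
    unfold beforeR
    rw [List.takeWhile_append, List.takeWhile_append, if_neg, if_neg] <;>
    · intro hl
      have := (List.takeWhile_prefix (p := Option.isSome) (l := a)).eq_of_length hl
      have := List.takeWhile_eq_self_iff.1 this none ha
      simp at this
  have h2 : ∀ c : List (Option α), none ∉ a → beforeR (a ++ c) = a.length + beforeR c := by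
    intro c ha
    unfold beforeR
    rw [List.takeWhile_append_of_pos, List.length_append]
    rintro (_ | z) hz
    · exact absurd hz ha
    · rfl
  rcases x with _ | x <;> rcases y with _ | y
  · simp at hn
  · left
    have ha : none ∉ a := fun ha => hn.2.2 none ha none (by simp) rfl
    rw [h2 _ ha, h2 _ ha]
    simp [beforeR, eraseR, pow_add]
  · left
    have ha : none ∉ a := fun ha => hn.2.2 none ha none (by simp) rfl
    rw [h2 _ ha, h2 _ ha]
    simp [beforeR, eraseR, pow_add]
  · right
    refine ⟨?_, eraseR a, some x, some y, eraseR b, by simp [eraseR], by simp [eraseR]⟩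
    by_cases ha : none ∈ a
    · exact h1 _ _ ha
    · rw [h2 _ ha, h2 _ ha]
      simp [beforeR]

variable {I J : Type u}

theorem graftInner_flip_left {x x' : InnerForest (Option I)} (h : Flip x x')
    (y : InnerForest J) [Finite J] :
    (∑ s : PathVert x.forest → Tree y.forest, Bess.of (graftInner x y s)) +
      ∑ s : PathVert x'.forest → Tree y.forest, Bess.of (graftInner x' y s) = 0 := by
  obtain ⟨F, g, l, h1, h2, h3⟩ := x
  obtain ⟨F', g', l', h1', h2', h3'⟩ := x'
  have h0 := @flip_vertex_mem _ ⟨F, g, l, h1, h2, h3⟩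
  obtain ⟨hF, h⟩ := h
  simp only at hF h h0 ⊢
  subst hF
  rw [← Finset.sum_add_distrib]
  refine Finset.sum_eq_zero fun s _ => Bess.of_flip ⟨rfl, ?_⟩
  rcases h with ⟨ha, rfl⟩ | ⟨ha, v, hb, hc⟩
  · left
    obtain ⟨a, p, q, b, e1, e2⟩ := ha.map (Option.map (graftVert F y.forest s))
    refine ⟨⟨a, p, q, b ++ (eraseR y.glob.word).map (Option.map fun u => Sum.inr '' u),
      ?_, ?_⟩, rfl⟩
    · simp only [graftInner, graftGlob, e1]; simp
    · simp only [graftInner, graftGlob, e2]; simp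
  · right
    refine ⟨by simp only [graftInner, graftGlob, ha], graftVert F y.forest s v, ?_⟩
    have hv : v ∈ F.verts := h0 hb
    constructor
    · simp only [graftInner]
      rw [graftLoc_left s _ _ hv, graftLoc_left s _ _ hv]
      exact hb.map _
    · intro w hw
      simp only [graftInner, graftLoc]
      rw [(pushLoc_flip (η := graftBranch F y.forest s) (graftVert_injOn s) hv hb hc).2 w hw]

theorem graftInner_flip_right [Finite J] (x : InnerForest (Option I)) {y y' : InnerForest J}
    (h : Flip y y') :
    (-1 : ℚ) ^ beforeR y.glob.word •
        (∑ s : PathVert x.forest → Tree y.forest, Bess.of (graftInner x y s)) +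
      (-1 : ℚ) ^ beforeR y'.glob.word •
        ∑ s : PathVert x.forest → Tree y'.forest, Bess.of (graftInner x y' s) = 0 := by
  obtain ⟨F, g, l, h1, h2, h3⟩ := y
  obtain ⟨F', g', l', h1', h2', h3'⟩ := y'
  have h0 := @flip_vertex_mem _ ⟨F, g, l, h1, h2, h3⟩
  obtain ⟨hF, h⟩ := h
  simp only at hF h h0 ⊢
  subst hF
  have inj : Set.InjOn (fun u : Set J => (Sum.inr '' u : Set (I ⊕ J))) (F.verts : Set (Set J)) :=
    Sum.inr_injective.image_injective.injOn
  rw [Finset.smul_sum, Finset.smul_sum, ← Finset.sum_add_distrib]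
  refine Finset.sum_eq_zero fun s _ => ?_
  rcases h with ⟨ha, rfl⟩ | ⟨ha, v, hb, hc⟩
  · rcases swap_erase ha g.nodup with ⟨e1, e2⟩ | ⟨e1, e2⟩
    · have : graftInner x ⟨F, g, l, h1, h2, h3⟩ s = graftInner x ⟨F, g', l, h1', h2', h3'⟩ s := by
        simp only [graftInner, graftGlob, e2]
      rw [e1, this, neg_smul, neg_add_cancel]
    · rw [e1, ← smul_add, Bess.of_flip, smul_zero]
      refine ⟨rfl, Or.inl ⟨?_, rfl⟩⟩
      obtain ⟨a, p, q, b, e3, e4⟩ :=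
        e2.map (Option.map fun u : Set J => (Sum.inr '' u : Set (I ⊕ J)))
      refine ⟨x.glob.word.map (Option.map (graftVert x.forest F s)) ++ a, p, q, b, ?_, ?_⟩
      · simp only [graftInner, graftGlob, e3]; simp
      · simp only [graftInner, graftGlob, e4]; simp
  · rw [ha, ← smul_add, Bess.of_flip, smul_zero]
    refine ⟨rfl, Or.inr ⟨by simp only [graftInner, graftGlob, ha], Sum.inr '' v, ?_⟩⟩
    have hv : v ∈ F.verts := h0 hb
    constructor
    · simp only [graftInner]
      rw [graftLoc_right s _ _ hv, graftLoc_right s _ _ hv]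
      exact hb.map _
    · intro w hw
      simp only [graftInner, graftLoc]
      rw [(pushLoc_flip (η := fun _ A => Sum.inr '' A) inj hv hb hc).2 w hw]

/-- The partial composition `x ∘_⋆ y` of the operad `Bess`.  On inner-oriented forests it is
the sum over all choices `s` of `(o₁ ∧ r ∧ o₂ modulo R₁ ∧ r ∧ R₂ = R) ⊗ graft F₁ F₂ s`, the
local orientations being unchanged. -/
def Bess.comp (I J : Type u) [Finite J] : Bess (Option I) →ₗ[ℚ] Bess J →ₗ[ℚ] Bess (I ⊕ J) :=
  Bess.lift (fun x => Bess.lift (fun y => (-1 : ℚ) ^ beforeR y.glob.word •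
      ∑ s : PathVert x.forest → Tree y.forest, Bess.of (graftInner x y s))
      fun _ _ h => graftInner_flip_right x h) <| by
    intro x x' h
    refine Submodule.linearMap_qext _ (Finsupp.lhom_ext' fun y => LinearMap.ext_ring ?_)
    simp only [LinearMap.comp_apply, LinearMap.add_apply, LinearMap.zero_apply,
      Finsupp.lsingle_apply]
    rw [← Bess.of, Bess.lift_of, Bess.lift_of, ← smul_add, graftInner_flip_left h y, smul_zero]

/-- The partial composition of the operad `Bess ⊗ Bess`:
`(x ⊗ x') ∘_⋆ (y ⊗ y') = (-1) ^ (deg x' * deg y) (x ∘_⋆ y) ⊗ (x' ∘_⋆ y')`. -/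
def tensorComp (I J : Type u) [Finite J] (X : Bess (Option I) ⊗[ℚ] Bess (Option I))
    (Y : Bess J ⊗[ℚ] Bess J) : Bess (I ⊕ J) ⊗[ℚ] Bess (I ⊕ J) :=
  TensorProduct.map₂ (Bess.comp I J) (Bess.comp I J) X Y -
    (2 : ℚ) • TensorProduct.map₂ (Bess.comp I J) (Bess.comp I J)
      (TensorProduct.map LinearMap.id (Bess.oddPart (Option I)) X)
      (TensorProduct.map (Bess.oddPart J) LinearMap.id Y)

end Comp

/-! ## Generators and coproduct -/

section Generators

/-- The inner-oriented forest `R ⊗ F` where `F` has no inner vertex. -/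
def discreteInner (I : Type u) : InnerForest I where
  forest := Forest.discrete I
  glob := ⟨[none], by simp, by simp [Forest.discrete]⟩
  loc := fun _ => []
  loc_nodup := by simp
  loc_mem := by simp [Forest.discrete]
  loc_off := by simp

/-- The element `R ⊗ F` where `F` has no inner vertex.  It is the unit of the operad if `I` has
one element, and the generator `E_{i,j}` if `I = {i, j}` has two elements. -/
def Bess.discrete (I : Type u) : Bess I := Bess.of (discreteInner I)

variable {I : Type u}

/-- The tree with one inner vertex on `I = {i, j}`. -/
def cherry (i j : I) (hij : i ≠ j) : Forest I where
  verts := {{i, j}}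
  nonempty := by simp
  laminar := by simp
  binary := by
    intro v hv
    rw [Finset.mem_singleton] at hv
    subst hv
    exact ⟨{i}, {j}, Or.inr ⟨i, rfl⟩, Or.inr ⟨j, rfl⟩, by simpa using hij,
      Set.singleton_union⟩

theorem cherry_split (i j : I) (hij : i ≠ j) :
    IsSplit (cherry i j hij).verts {i, j} {i} {j} :=
  ⟨Or.inr ⟨i, rfl⟩, Or.inr ⟨j, rfl⟩, by simpa using hij, Set.singleton_union⟩

/-- The inner-oriented tree with one inner vertex `v` on `{i, j}`, with global orientation
`R ∧ v` and local orientation `root ∧ i ∧ j`. -/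
def cherryInner (i j : I) (hij : i ≠ j) : InnerForest I where
  forest := cherry i j hij
  glob := ⟨[none, some {i, j}], by simp, by simp [cherry]⟩
  loc := fun v => if v = {i, j} then [none, some {i}, some {j}] else []
  loc_nodup := by
    intro v hv
    rw [if_pos (Finset.mem_singleton.1 hv)]
    simpa using hij
  loc_mem := by
    intro v hv h
    rw [Finset.mem_singleton.1 hv, if_pos rfl]
    constructor
    · intro hh
      simp only [List.mem_cons, List.not_mem_nil, or_false] at hh
      rcases hh with rfl | rfl | rfl
      · exact Or.inl rfl
      · exact Or.inr ⟨_, _, cherry_split i j hij, rfl⟩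
      · exact Or.inr ⟨_, _, Forest.split_symm (cherry_split i j hij), rfl⟩
    · rintro (rfl | ⟨A, B, hs, rfl⟩)
      · simp
      · rcases (cherry i j hij).split_unique (cherry_split i j hij) hs with ⟨rfl, -⟩ | ⟨rfl, -⟩ <;>
          simp
  loc_off := by
    intro v hv
    exact if_neg fun h => hv (Finset.mem_singleton.2 h)

/-- The generator `Ω_{i,j}`. -/
def Bess.omega (i j : I) (hij : i ≠ j) : Bess I := Bess.of (cherryInner i j hij)

/-- `Δ` is a morphism of operads from `Bess` to `Bess ⊗ Bess` with
`Δ E_{i,j} = E_{i,j} ⊗ E_{i,j}` and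
`Δ Ω_{i,j} = E_{i,j} ⊗ Ω_{i,j} + Ω_{i,j} ⊗ E_{i,j}`. -/
structure IsCoproduct
    (Δ : ∀ (I : Type u) [Finite I] [Nonempty I], Bess I →ₗ[ℚ] Bess I ⊗[ℚ] Bess I) : Prop where
  relabel : ∀ (I K : Type u) [Finite I] [Nonempty I] [Finite K] [Nonempty K] (e : I ≃ K)
    (x : Bess I), Δ K (Bess.relabel e x) =
      TensorProduct.map (Bess.relabel e) (Bess.relabel e) (Δ I x)
  unit : ∀ (I : Type u) [Finite I] [Nonempty I], Nat.card I = 1 →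
    Δ I (Bess.discrete I) = Bess.discrete I ⊗ₜ Bess.discrete I
  comp : ∀ (I J : Type u) [Finite I] [Finite J] [Nonempty J] (x : Bess (Option I)) (y : Bess J),
    Δ (I ⊕ J) (Bess.comp I J x y) = tensorComp I J (Δ (Option I) x) (Δ J y)
  gen_E : ∀ (I : Type u) [Finite I] [Nonempty I], Nat.card I = 2 →
    Δ I (Bess.discrete I) = Bess.discrete I ⊗ₜ Bess.discrete I
  gen_omega : ∀ (I : Type u) [Finite I] [Nonempty I], Nat.card I = 2 → ∀ (i j : I) (hij : i ≠ j),
    Δ I (Bess.omega i j hij) =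
      Bess.discrete I ⊗ₜ Bess.omega i j hij + Bess.omega i j hij ⊗ₜ Bess.discrete I

end Generators

/-! ## The poset of forests and the sums `γ(F, V)` -/

section Gamma

variable {I : Type u}

/-- A map of forests `F' → F` which is increasing towards the root, the identity on leaves,
and maps inner vertices to inner vertices injectively, the two incoming half-edges at a vertex
going to the two distinct incoming half-edges at its image.  It is given by the images of the
inner vertices.  The leaf `i` lies above `v` if and only if `i ∈ v`, and `v` lies (weakly) above
`w` if and only if `v ⊆ w`. -/
@[ext]
structure Forest.Hom (F' F : Forest I) where
  toFun : F'.verts → F.verts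
  injective : Function.Injective toFun
  increasing : ∀ v w : F'.verts, (v : Set I) ⊆ w → (toFun v : Set I) ⊆ toFun w
  leaves : ∀ (v : F'.verts) (i : I), i ∈ (v : Set I) → i ∈ (toFun v : Set I)
  branches : ∀ (v : F'.verts) (A' B' : Set I), IsSplit F'.verts v A' B' →
    ∃ A B, IsSplit F.verts (toFun v) A B ∧ A' ⊆ A ∧ B' ⊆ B

/-- The order on forests. -/
instance : LE (Forest I) := ⟨fun F' F => Nonempty (Forest.Hom F' F)⟩

variable {F : Forest I}

/-- The image of `v` is the vertex of `F` where the leaves above `v` meet. -/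
theorem Forest.Hom.least {F' : Forest I} (f : Forest.Hom F' F) (v : F'.verts) {w : Set I}
    (hw : w ∈ F.verts) (h : (v : Set I) ⊆ w) : (f.toFun v : Set I) ⊆ w := by
  obtain ⟨A', B', hs'⟩ := F'.binary v v.2
  obtain ⟨A, B, hs, hA, hB⟩ := f.branches v A' B' hs'
  obtain ⟨a, ha⟩ := F'.node_nonempty hs'.1
  obtain ⟨b, hb⟩ := F'.node_nonempty hs'.2.1
  have hav : a ∈ w := h (hs'.2.2.2 ▸ Or.inl ha)
  have hbv : b ∈ w := h (hs'.2.2.2 ▸ Or.inr hb)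
  rcases F.laminar _ (f.toFun v).2 w hw with h1 | h1 | h1
  · exact h1
  · by_cases he : w = (f.toFun v : Set I)
    · exact he.symm.subset
    · rcases F.node_sub_branch hs (Or.inl hw) h1 he with h2 | h2
      · exact absurd (hB hb) (Set.disjoint_left.1 hs.2.2.1 (h2 hbv))
      · exact absurd (h2 hav) (Set.disjoint_left.1 hs.2.2.1 (hA ha))
  · exact absurd hav (Set.disjoint_left.1 h1 (hs.2.2.2 ▸ Or.inl (hA ha)))

/-- There is at most one such map between two given forests. -/
instance (F' : Forest I) : Subsingleton (Forest.Hom F' F) :=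
  ⟨fun f g => Forest.Hom.ext <| funext fun v => Subtype.ext <| Set.Subset.antisymm
    (f.least v (g.toFun v).2 fun i => g.leaves v i)
    (g.least v (f.toFun v).2 fun i => f.leaves v i)⟩

/-- The set `γ(F, V)` of forests `F' ≤ F` whose inner vertices are identified with the elements
of `V`. -/
structure Gamma (F : Forest I) (V : Finset (Set I)) where
  forest : Forest I
  hom : Forest.Hom forest F
  range : ∀ v, v ∈ V ↔ ∃ w, (hom.toFun w : Set I) = v

theorem Gamma.forest_injective (V : Finset (Set I)) :
    Function.Injective (Gamma.forest : Gamma F V → Forest I) := by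
  rintro ⟨F₁, f, _⟩ ⟨F₂, g, _⟩ h
  simp only at h
  subst h
  congr
  exact Subsingleton.elim _ _

instance [Finite I] (V : Finset (Set I)) : Fintype (Gamma F V) :=
  have : Finite (Gamma F V) := Finite.of_injective _ (Gamma.forest_injective V)
  Fintype.ofFinite _

/-- The inner vertex of `F' ∈ γ(F, V)` identified with `v ∈ V`. -/
def Gamma.vert {V : Finset (Set I)} (p : Gamma F V) (v : Set I) : Set I :=
  if h : ∃ w, (p.hom.toFun w : Set I) = v then (h.choose : Set I) else ∅

variable {V : Finset (Set I)} (p : Gamma F V)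

theorem Gamma.vert_hom (w : p.forest.verts) : p.vert (p.hom.toFun w) = w := by
  have h : ∃ w', (p.hom.toFun w' : Set I) = p.hom.toFun w := ⟨w, rfl⟩
  rw [Gamma.vert, dif_pos h]
  exact congrArg Subtype.val (p.hom.injective (Subtype.ext h.choose_spec))

theorem Gamma.subset (p : Gamma F V) : V ⊆ F.verts := by
  intro v hv
  obtain ⟨w, rfl⟩ := (p.range v).1 hv
  exact (p.hom.toFun w).2

theorem Gamma.vert_injOn : Set.InjOn p.vert (V : Set (Set I)) := by
  intro v hv v' hv' h
  obtain ⟨w, rfl⟩ := (p.range v).1 hv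
  obtain ⟨w', rfl⟩ := (p.range v').1 hv'
  rw [p.vert_hom, p.vert_hom] at h
  rw [Subtype.ext h]

theorem Gamma.verts_eq : p.forest.verts = V.image p.vert := by
  ext w
  rw [Finset.mem_image]
  constructor
  · intro hw
    exact ⟨_, (p.range _).2 ⟨⟨w, hw⟩, rfl⟩, p.vert_hom ⟨w, hw⟩⟩
  · rintro ⟨v, hv, rfl⟩
    obtain ⟨w, rfl⟩ := (p.range v).1 hv
    rw [p.vert_hom]
    exact w.2

theorem Gamma.split {v A B : Set I} (hv : v ∈ V) (h : IsSplit F.verts v A B) :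
    IsSplit p.forest.verts (p.vert v) (A ∩ p.vert v) (B ∩ p.vert v) := by
  obtain ⟨w, rfl⟩ := (p.range v).1 hv
  rw [p.vert_hom]
  have key : ∀ {A B A' B' : Set I}, Disjoint A B → A' ∪ B' = (w : Set I) → A' ⊆ A → B' ⊆ B →
      A ∩ (w : Set I) = A' := by
    intro A B A' B' hd hu hA hB
    rw [← hu]
    ext x
    constructor
    · rintro ⟨h1, h2 | h2⟩
      · exact h2
      · exact absurd (hB h2) (Set.disjoint_left.1 hd h1)
    · intro h
      exact ⟨hA h, Or.inl h⟩
  obtain ⟨A', B', hs'⟩ := p.forest.binary w w.2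
  obtain ⟨A₀, B₀, hs, hA, hB⟩ := p.hom.branches w A' B' hs'
  have e1 : A₀ ∩ (w : Set I) = A' := key hs.2.2.1 hs'.2.2.2 hA hB
  have e2 : B₀ ∩ (w : Set I) = B' :=
    key hs.2.2.1.symm (by rw [Set.union_comm]; exact hs'.2.2.2) hB hA
  rcases F.split_unique hs h with ⟨rfl, rfl⟩ | ⟨rfl, rfl⟩
  · rw [e1, e2]
    exact hs'
  · rw [e1, e2]
    exact Forest.split_symm hs'

end Gamma

section Formula

variable {I : Type u}

/-- The inner-oriented forest `o' ⊗ F'` for `F' ∈ γ(F, V)`, where `o'` is an orientation of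
`V ⊔ {R'}` and the local orientations are those of `x = o ⊗ F`: the vertex `v ∈ V` becomes a
vertex of `F'`, and the half-edge of `F` at `v` coming from the branch `A` becomes the half-edge
of `F'` coming from the branch that is contained in `A`. -/
def gammaInner (x : InnerForest I) {V : Finset (Set I)} (o' : GlobalOrientation V)
    (p : Gamma x.forest V) : InnerForest I where
  forest := p.forest
  glob := o'.map p.vert p.vert_injOn p.verts_eq
  loc := pushLoc p.vert (fun v A => A ∩ p.vert v) V x.loc
  loc_nodup := by
    intro w hw
    rw [p.verts_eq] at hw
    obtain ⟨v, hv, rfl⟩ := Finset.mem_image.1 hw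
    rw [pushLoc_apply p.vert_injOn hv]
    exact (pushLoc_valid x.forest p.forest (p.subset hv) (fun A B h => p.split hv h)
      (x.loc_nodup v (p.subset hv)) (x.loc_mem v (p.subset hv))).1
  loc_mem := by
    intro w hw
    rw [p.verts_eq] at hw
    obtain ⟨v, hv, rfl⟩ := Finset.mem_image.1 hw
    rw [pushLoc_apply p.vert_injOn hv]
    exact (pushLoc_valid x.forest p.forest (p.subset hv) (fun A B h => p.split hv h)
      (x.loc_nodup v (p.subset hv)) (x.loc_mem v (p.subset hv))).2
  loc_off := by
    intro w hw
    refine pushLoc_off fun v hv h => hw ?_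
    rw [p.verts_eq, ← h]
    exact Finset.mem_image_of_mem _ hv

/-- The element `o' ⊗ γ(F, V)` of `Bess(I)`. -/
def gammaSum [Finite I] (x : InnerForest I) {V : Finset (Set I)} (o' : GlobalOrientation V) :
    Bess I :=
  ∑ p : Gamma x.forest V, Bess.of (gammaInner x o' p)

/-- The exterior product of the letters of a word. -/
def wedge {α : Type u} (l : List α) : ExteriorAlgebra ℚ (α →₀ ℚ) :=
  (l.map fun a => ExteriorAlgebra.ι ℚ (Finsupp.single a (1 : ℚ))).prod

/-- The auxiliary letters `R'`, `r`, `R''` next to the inner vertices. -/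
inductive Letter (I : Type u) : Type u
  | vert (v : Set I)
  | R'
  | r
  | R''

/-- `o' ∧ r ∧ o'' = o` modulo `R' ∧ r ∧ R'' = R`. -/
def Compatible {V V' V'' : Finset (Set I)} (o' : GlobalOrientation V')
    (o'' : GlobalOrientation V'') (o : GlobalOrientation V) : Prop :=
  wedge (o'.word.map (fun a => a.elim Letter.R' Letter.vert) ++ [Letter.r] ++
      o''.word.map (fun a => a.elim Letter.R'' Letter.vert)) =
    wedge (o.word.flatMap fun a =>
      a.elim [Letter.R', Letter.r, Letter.R''] fun v => [Letter.vert v])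

end Formula

end Bessel

end

noncomputable section

namespace Bessel

/-! ## Signs of words -/

section Signs

variable {α : Type u}

/-! Uniqueness: every forest is built from the generators. Contracting an inner vertex whose two
branches are leaves exhibits a forest, up to sign, as a smaller forest composed with `Ω`
(`exists_comp_omega`); the inserted forest is a single tree, so the composition has only one term. A
forest without inner vertex arises in the same way from `E`, or is the unit. Induction on the number
of leaves concludes (`IsCoproduct.unique`).

Existence: the formula defines a map `coproduct`, and the point is its compatibility with
composition. Instead of comparing sums over splittings with sums over attachments, the proof uses
the operators `Bess.joins A B` of degree one, which join in all ways a tree inside `A` with a tree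
inside `B` at a new root vertex, placed first in the global orientation. They generate `Bess(I)`
from the discrete forest (`Bess.join_induction`), and three facts describe them.

The coproduct turns a join `J` into the derivation `J ⊗ 1 + (-1)^deg ⊗ J` (`coproduct_join`): the
new vertex belongs to one of the two parts of the splitting, where it becomes a sum of joins
(`gammaSum_join_insert`), and the other factor does not see it (`gammaSum_join`). The sign is that
of moving the vertex past `o' ∧ r`.

Composition on the right commutes with joins (`Bess.comp_joins`): attaching the new vertex to a tree
of `F₂` amounts to choosing the tree that is joined to the other branch (`graft_join_bijective`).
Composition of the discrete forest with `y` commutes with the joins of `y`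
(`Bess.discrete_comp_joins`).

Hence both sides of `Δ(x ∘ y) = Δ x ∘ Δ y` behave in the same way under joins, and the claim reduces
to discrete forests (`coproduct_comp`). The operators are needed for unions of trees `A` and `B`,
because the terms of a coproduct or a composition may have more trees than the original forest; each
of their trees lies over one original node, so the pairs of trees can be regrouped
(`Bess.joins_eq_sum`). -/

theorem AdjSwap.perm {α : Type*} {l l' : List α} (h : AdjSwap l l') : l.Perm l' := by
  obtain ⟨a, x, y, b, rfl, rfl⟩ := h
  exact (List.Perm.swap y x b).append_left a

theorem AdjSwap.append_left {α : Type*} (c : List α) {l l' : List α} (h : AdjSwap l l') :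
    AdjSwap (c ++ l) (c ++ l') := by
  obtain ⟨a, x, y, b, rfl, rfl⟩ := h
  exact ⟨c ++ a, x, y, b, by simp, by simp⟩

theorem AdjSwap.append_right {α : Type*} (c : List α) {l l' : List α} (h : AdjSwap l l') :
    AdjSwap (l ++ c) (l' ++ c) := by
  obtain ⟨a, x, y, b, rfl, rfl⟩ := h
  exact ⟨a, x, y, b ++ c, by simp, by simp⟩

/-- Every permutation of a word has a sign by which all functions that are antisymmetric in the
letters change. -/
theorem exists_sign {l₁ l₂ : List α} (h : l₁.Perm l₂) :
    ∃ ε : ℚ, (ε = 1 ∨ ε = -1) ∧ ∀ {M : Type u} [AddCommGroup M] [Module ℚ M] (φ : List α → M),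
      (∀ l l', AdjSwap l l' → φ l = -φ l') → φ l₁ = ε • φ l₂ := by
  induction h with
  | nil => exact ⟨1, Or.inl rfl, fun φ _ => by simp⟩
  | cons x _ ih =>
    obtain ⟨ε, hε, ih⟩ := ih
    exact ⟨ε, hε, fun φ hφ => ih (fun l => φ (x :: l))
      fun l l' hl => hφ _ _ (hl.append_left [x])⟩
  | swap x y l =>
    refine ⟨-1, Or.inr rfl, fun φ hφ => ?_⟩
    rw [neg_one_smul]
    exact hφ _ _ ⟨[], y, x, l, rfl, rfl⟩
  | trans _ _ ih₁ ih₂ =>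
    obtain ⟨ε₁, h₁, ih₁⟩ := ih₁
    obtain ⟨ε₂, h₂, ih₂⟩ := ih₂
    refine ⟨ε₁ * ε₂, ?_, fun φ hφ => by rw [ih₁ φ hφ, ih₂ φ hφ, smul_smul]⟩
    rcases h₁ with rfl | rfl <;> rcases h₂ with rfl | rfl <;> simp

theorem wedge_append (l l' : List α) : wedge (l ++ l') = wedge l * wedge l' := by
  simp [wedge]

theorem wedge_cons (a : α) (l : List α) : wedge (a :: l) = wedge [a] * wedge l :=
  wedge_append [a] l

theorem wedge_swap {l l' : List α} (h : AdjSwap l l') : wedge l = -wedge l' := by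
  obtain ⟨a, x, y, b, rfl, rfl⟩ := h
  have hxy : wedge [x, y] = -wedge [y, x] := by
    have := ExteriorAlgebra.ι_add_mul_swap (R := ℚ) (Finsupp.single x (1 : ℚ))
      (Finsupp.single y (1 : ℚ))
    simpa [wedge] using eq_neg_of_add_eq_zero_left this
  have e : ∀ x y : α, a ++ x :: y :: b = a ++ ([x, y] ++ b) := fun x y => rfl
  rw [e, e, wedge_append, wedge_append, wedge_append, wedge_append, hxy]
  simp

/-- The determinant of the coordinates at the letters of `l` is an alternating form with value one
on these letters. Because the product does not vanish, the sign relating two orientations is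
determined by their wedges. -/
theorem wedge_ne_zero {l : List α} (h : l.Nodup) : wedge l ≠ 0 := by
  let p : (α →₀ ℚ) →ₗ[ℚ] (Fin l.length → ℚ) := LinearMap.pi fun i => Finsupp.lapply (l.get i)
  let d : (α →₀ ℚ) [⋀^Fin l.length]→ₗ[ℚ] ℚ := Matrix.detRowAlternating.compLinearMap p
  have hw : wedge l = ExteriorAlgebra.ιMulti ℚ l.length
      fun i => Finsupp.single (l.get i) (1 : ℚ) := by
    rw [ExteriorAlgebra.ιMulti_apply, wedge]
    congr 1
    conv_lhs => rw [← List.ofFn_get l, List.map_ofFn]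
    rfl
  intro h0
  -- A linear map on the whole exterior algebra needs an alternating form in each degree; outside
  -- degree `l.length` it is taken to be zero.
  have h1 := ExteriorAlgebra.liftAlternating_apply_ιMulti
    (fun n => if hn : n = l.length then hn ▸ d else 0)
    (fun i => Finsupp.single (l.get i) (1 : ℚ))
  rw [← hw, h0, map_zero] at h1
  simp only [↓reduceDIte] at h1
  have h2 : d (fun i => Finsupp.single (l.get i) (1 : ℚ)) = 1 := by
    change Matrix.det (fun i => p (Finsupp.single (l.get i) (1 : ℚ))) = 1
    have : (fun i => p (Finsupp.single (l.get i) (1 : ℚ))) = (1 : Matrix _ _ ℚ) := by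
      ext i j
      simp [p, Matrix.one_apply, Finsupp.single_apply, h.getElem_inj_iff, Fin.ext_iff]
    rw [this, Matrix.det_one]
  rw [h2] at h1
  exact zero_ne_one h1

theorem smul_wedge_injective {l : List α} (h : l.Nodup) {a b : ℚ}
    (hab : a • wedge l = b • wedge l) : a = b :=
  smul_left_injective ℚ (wedge_ne_zero h) hab

end Signs

/-! ## Independence of the orientation up to sign -/

section Mk

variable {I : Type u}

/-- The word `w` runs through the elements of `V ⊔ {R}`. -/
def IsWord (V : Finset (Set I)) (w : List (Option (Set I))) : Prop :=
  w.Nodup ∧ ∀ x, x ∈ w ↔ x = none ∨ ∃ v ∈ V, x = some v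

theorem GlobalOrientation.isWord {V : Finset (Set I)} (o : GlobalOrientation V) :
    IsWord V o.word := ⟨o.nodup, o.mem_iff⟩

theorem IsWord.perm {V : Finset (Set I)} {w w' : List (Option (Set I))} (h : IsWord V w)
    (h' : IsWord V w') : w.Perm w' :=
  (List.perm_ext_iff_of_nodup h.1 h'.1).2 fun x => by rw [h.2, h'.2]

theorem IsWord.of_perm {V : Finset (Set I)} {w w' : List (Option (Set I))} (h : IsWord V w)
    (hp : w.Perm w') : IsWord V w' :=
  ⟨hp.nodup_iff.1 h.1, fun x => by rw [← h.2, hp.mem_iff]⟩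

theorem isWord_toList (V : Finset (Set I)) : IsWord V (none :: V.toList.map some) := by
  refine ⟨?_, fun x => by simp [eq_comm]⟩
  rw [List.nodup_cons]
  exact ⟨by simp, V.nodup_toList.map (Option.some_injective _)⟩

/-- An orientation of `V ⊔ {R}`. -/
def GlobalOrientation.std (V : Finset (Set I)) : GlobalOrientation V :=
  ⟨none :: V.toList.map some, (isWord_toList V).1, (isWord_toList V).2⟩

/-- The words `l v` are local orientations for the forest `F`. -/
def IsLoc (F : Forest I) (l : Set I → List (Option (Set I))) : Prop :=
  (∀ v ∈ F.verts, (l v).Nodup) ∧ (∀ v ∈ F.verts, ∀ h, h ∈ l v ↔ IsHalfEdge F.verts v h) ∧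
    ∀ v, v ∉ F.verts → l v = []

/-- The element `w ⊗ F` with local orientations `l`; zero if these are not orientations. -/
def Bess.mk (F : Forest I) (w : List (Option (Set I))) (l : Set I → List (Option (Set I))) :
    Bess I :=
  if h : IsWord F.verts w ∧ IsLoc F l then
    Bess.of ⟨F, ⟨w, h.1.1, h.1.2⟩, l, h.2.1, h.2.2.1, h.2.2.2⟩ else 0

theorem InnerForest.isLoc (x : InnerForest I) : IsLoc x.forest x.loc :=
  ⟨x.loc_nodup, x.loc_mem, x.loc_off⟩

theorem Bess.of_eq_mk (x : InnerForest I) : Bess.of x = Bess.mk x.forest x.glob.word x.loc := by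
  rw [Bess.mk, dif_pos ⟨x.glob.isWord, x.isLoc⟩]

theorem Bess.of_congr {x y : InnerForest I} (h₁ : x.forest = y.forest)
    (h₂ : x.glob.word = y.glob.word) (h₃ : x.loc = y.loc) : Bess.of x = Bess.of y := by
  rw [Bess.of_eq_mk, Bess.of_eq_mk, h₂, h₃, h₁]

/-- A swap preserves the property of being an orientation, so outside orientations both sides are
zero. This makes `Bess.mk` antisymmetric on all words, the form to which `exists_sign` applies. -/
theorem Bess.mk_swap (F : Forest I) {w w' : List (Option (Set I))} (h : AdjSwap w w')
    (l : Set I → List (Option (Set I))) : Bess.mk F w l = -Bess.mk F w' l := by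
  by_cases hl : IsWord F.verts w ∧ IsLoc F l
  · have hl' : IsWord F.verts w' ∧ IsLoc F l := ⟨hl.1.of_perm h.perm, hl.2⟩
    rw [Bess.mk, Bess.mk, dif_pos hl, dif_pos hl', eq_neg_iff_add_eq_zero]
    exact Bess.of_flip ⟨rfl, Or.inl ⟨h, rfl⟩⟩
  · have hl' : ¬ (IsWord F.verts w' ∧ IsLoc F l) := fun h' =>
      hl ⟨h'.1.of_perm h.perm.symm, h'.2⟩
    rw [Bess.mk, Bess.mk, dif_neg hl, dif_neg hl', neg_zero]

theorem isLoc_update {F : Forest I} {l : Set I → List (Option (Set I))} (h : IsLoc F l)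
    {v : Set I} (hv : v ∈ F.verts) {L : List (Option (Set I))} (hL : (l v).Perm L) :
    IsLoc F (Function.update l v L) := by
  refine ⟨fun w hw => ?_, fun w hw e => ?_, fun w hw => ?_⟩
  · by_cases hwv : w = v
    · subst hwv
      simpa using hL.nodup_iff.1 (h.1 w hw)
    · simpa [hwv] using h.1 w hw
  · by_cases hwv : w = v
    · subst hwv
      simpa [← hL.mem_iff] using h.2.1 w hw e
    · simpa [hwv] using h.2.1 w hw e
  · have hwv : w ≠ v := by rintro rfl; exact hw hv
    simpa [hwv] using h.2.2 w hw

theorem Bess.mk_update_swap (F : Forest I) (w : List (Option (Set I)))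
    (l : Set I → List (Option (Set I))) (v : Set I) (hv : v ∈ F.verts)
    {L L' : List (Option (Set I))} (h : AdjSwap L L') :
    Bess.mk F w (Function.update l v L) = -Bess.mk F w (Function.update l v L') := by
  have key : ∀ {L L' : List (Option (Set I))}, L.Perm L' →
      IsLoc F (Function.update l v L) → IsLoc F (Function.update l v L') := by
    intro L L' hp hL
    have := isLoc_update hL hv (L := L') (by simpa using hp)
    rwa [Function.update_idem] at this
  by_cases hl : IsWord F.verts w ∧ IsLoc F (Function.update l v L)
  · have hl' : IsWord F.verts w ∧ IsLoc F (Function.update l v L') :=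
      ⟨hl.1, key h.perm hl.2⟩
    rw [Bess.mk, Bess.mk, dif_pos hl, dif_pos hl', eq_neg_iff_add_eq_zero]
    refine Bess.of_flip ⟨rfl, Or.inr ⟨rfl, v, by simpa using h, fun u hu => ?_⟩⟩
    simp [hu]
  · have hl' : ¬ (IsWord F.verts w ∧ IsLoc F (Function.update l v L')) := fun h' =>
      hl ⟨h'.1, key h.perm.symm h'.2⟩
    rw [Bess.mk, Bess.mk, dif_neg hl, dif_neg hl', neg_zero]

/-- Inner-oriented forests on the same forest are equal up to sign. -/
theorem Bess.of_eq_smul_of {x y : InnerForest I} (h : x.forest = y.forest) :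
    ∃ ε : ℚ, (ε = 1 ∨ ε = -1) ∧ Bess.of x = ε • Bess.of y := by
  -- The local orientations are replaced one vertex at a time; `S` is the set of vertices already
  -- treated.
  have hloc : ∀ S : Finset (Set I), S ⊆ x.forest.verts → ∃ ε : ℚ, (ε = 1 ∨ ε = -1) ∧
      Bess.of x = ε • Bess.mk x.forest x.glob.word (fun v => if v ∈ S then y.loc v else x.loc v)
        := by
    intro S
    induction S using Finset.induction_on with
    | empty => exact fun _ => ⟨1, Or.inl rfl, by simp [Bess.of_eq_mk]⟩
    | insert v S hv ih =>
      intro hS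
      obtain ⟨ε, hε, e⟩ := ih ((Finset.subset_insert v S).trans hS)
      have hvx : v ∈ x.forest.verts := hS (Finset.mem_insert_self v S)
      have hp : (x.loc v).Perm (y.loc v) :=
        (List.perm_ext_iff_of_nodup (x.loc_nodup v hvx) (y.loc_nodup v (h ▸ hvx))).2 fun a => by
          rw [x.loc_mem v hvx, y.loc_mem v (h ▸ hvx), h]
      obtain ⟨ε', hε', e'⟩ := exists_sign hp
      have := e' (fun L => Bess.mk x.forest x.glob.word
        (Function.update (fun v => if v ∈ S then y.loc v else x.loc v) v L))
        (fun L L' hL => Bess.mk_update_swap _ _ _ v hvx hL)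
      have e₁ : Function.update (fun v => if v ∈ S then y.loc v else x.loc v) v (x.loc v) =
          fun v => if v ∈ S then y.loc v else x.loc v := by
        conv_rhs => rw [← Function.update_eq_self v (fun v => if v ∈ S then y.loc v else x.loc v)]
        simp [hv]
      have e₂ : Function.update (fun v => if v ∈ S then y.loc v else x.loc v) v (y.loc v) =
          fun w => if w ∈ insert v S then y.loc w else x.loc w := by
        funext w
        by_cases hw : w = v
        · subst hw; simp
        · simp [hw]
      simp only [e₁, e₂] at this
      refine ⟨ε * ε', ?_, by rw [e, this, smul_smul]⟩
      rcases hε with rfl | rfl <;> rcases hε' with rfl | rfl <;> simp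
  obtain ⟨ε, hε, e⟩ := hloc x.forest.verts subset_rfl
  -- Away from the inner vertices both local orientations are the empty word.
  have hl : (fun v => if v ∈ x.forest.verts then y.loc v else x.loc v) = y.loc := by
    funext v
    split_ifs with hv
    · rfl
    · rw [x.loc_off v hv, y.loc_off v (h ▸ hv)]
  rw [hl] at e
  have hp : x.glob.word.Perm y.glob.word := x.glob.isWord.perm (by rw [h]; exact y.glob.isWord)
  obtain ⟨ε', hε', e'⟩ := exists_sign hp
  have := e' (fun w => Bess.mk x.forest w y.loc) fun _ _ hw => Bess.mk_swap _ hw _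
  refine ⟨ε * ε', ?_, by rw [e, this, smul_smul, Bess.of_eq_mk y, h]⟩
  rcases hε with rfl | rfl <;> rcases hε' with rfl | rfl <;> simp

/-- Some inner orientation of a given forest. -/
theorem Forest.exists_inner (F : Forest I) : ∃ x : InnerForest I, x.forest = F := by
  choose A B h using F.binary
  refine ⟨⟨F, GlobalOrientation.std F.verts,
    fun v => if hv : v ∈ F.verts then [none, some (A v hv), some (B v hv)] else [], ?_, ?_, ?_⟩,
    rfl⟩
  · intro v hv
    have hne : A v hv ≠ B v hv := by
      intro he
      obtain ⟨a, ha⟩ := F.node_nonempty (h v hv).1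
      exact Set.disjoint_left.1 (h v hv).2.2.1 ha (he ▸ ha)
    simpa [hv] using hne
  · intro v hv e
    rw [dif_pos hv]
    simp only [List.mem_cons, List.not_mem_nil, or_false]
    constructor
    · rintro (rfl | rfl | rfl)
      · exact Or.inl rfl
      · exact Or.inr ⟨_, _, h v hv, rfl⟩
      · exact Or.inr ⟨_, _, Forest.split_symm (h v hv), rfl⟩
    · rintro (rfl | ⟨C, D, hs, rfl⟩)
      · exact Or.inl rfl
      · rcases F.split_unique (h v hv) hs with ⟨rfl, -⟩ | ⟨rfl, -⟩ <;> simp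
  · intro v hv
    simp [hv]

@[elab_as_elim]
theorem Bess.induction {P : Bess I → Prop} (of : ∀ x, P (Bess.of x))
    (add : ∀ x y, P x → P y → P (x + y)) (smul : ∀ (c : ℚ) x, P x → P (c • x)) (z : Bess I) :
    P z := by
  obtain ⟨f, rfl⟩ := (flipRel I).mkQ_surjective z
  induction f using Finsupp.induction_linear with
  | zero =>
    have := smul 0 _ (of (discreteInner I))
    rwa [zero_smul, ← map_zero (flipRel I).mkQ] at this
  | add f g hf hg => rw [map_add]; exact add _ _ hf hg
  | single x c =>
    have := smul c _ (of x)
    rwa [Bess.of, ← map_smul, Finsupp.smul_single, smul_eq_mul, mul_one] at this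

theorem Bess.hom_ext {M : Type*} [AddCommGroup M] [Module ℚ M] {f g : Bess I →ₗ[ℚ] M}
    (h : ∀ x, f (Bess.of x) = g (Bess.of x)) : f = g := by
  refine LinearMap.ext fun z => ?_
  induction z using Bess.induction with
  | of x => exact h x
  | add x y hx hy => rw [map_add, map_add, hx, hy]
  | smul c x hx => rw [map_smul, map_smul, hx]

end Mk

/-! ## Joining two trees of a forest -/

section Join

variable {I : Type u}

theorem Forest.IsTree.nonempty {F : Forest I} {T : Set I} (h : F.IsTree T) : T.Nonempty :=
  F.node_nonempty h.1

theorem Forest.IsTree.eq_of_mem {F : Forest I} {T T' : Set I} (h : F.IsTree T)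
    (h' : F.IsTree T') {a : I} (ha : a ∈ T) (ha' : a ∈ T') : T = T' := by
  by_contra hne
  exact Set.disjoint_left.1 (tree_disjoint (T := ⟨T, h⟩) (T' := ⟨T', h'⟩)
    fun e => hne (congrArg Subtype.val e)) ha ha'

theorem Forest.IsTree.node_subset_or_disjoint {F : Forest I} {T N : Set I} (h : F.IsTree T)
    (hN : IsNode F.verts N) : N ⊆ T ∨ Disjoint N T := by
  rcases F.node_laminar hN h.1 with h1 | h1 | h1
  · exact Or.inl h1
  · exact Or.inl (h.2 N hN h1).subset
  · exact Or.inr h1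

/-- Every node lies in a tree. -/
theorem Forest.exists_tree (F : Forest I) {N : Set I} (hN : IsNode F.verts N) :
    ∃ T, F.IsTree T ∧ N ⊆ T := by
  by_cases h : ∃ v ∈ F.verts, N ⊆ v
  · obtain ⟨v, hv, hmax⟩ := Finset.exists_maximal (s := F.verts.filter (N ⊆ ·))
      (by obtain ⟨v, hv, h⟩ := h; exact ⟨v, Finset.mem_filter.2 ⟨hv, h⟩⟩)
    rw [Finset.mem_filter] at hv
    refine ⟨v, ⟨Or.inl hv.1, ?_⟩, hv.2⟩
    rintro M (hM | ⟨i, rfl⟩) hvM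
    · exact (hvM.antisymm (hmax (Finset.mem_filter.2 ⟨hM, hv.2.trans hvM⟩) hvM)).symm
    · exact ((Set.Nonempty.subset_singleton_iff (F.nonempty v hv.1)).1 hvM).symm
  · push Not at h
    refine ⟨N, ⟨hN, ?_⟩, subset_rfl⟩
    rintro M (hM | ⟨i, rfl⟩) hNM
    · exact absurd hNM (h M hM)
    · exact ((Set.Nonempty.subset_singleton_iff (F.node_nonempty hN)).1 hNM).symm

/-- `T` and `T'` are two different trees of `F`. -/
structure IsJoin (F : Forest I) (T T' : Set I) : Prop where
  left : F.IsTree T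
  right : F.IsTree T'
  ne : T ≠ T'

theorem IsJoin.symm {F : Forest I} {T T' : Set I} (h : IsJoin F T T') : IsJoin F T' T :=
  ⟨h.right, h.left, h.ne.symm⟩

theorem IsJoin.disjoint {F : Forest I} {T T' : Set I} (h : IsJoin F T T') : Disjoint T T' :=
  Set.disjoint_left.2 fun _ ha ha' => h.ne (h.left.eq_of_mem h.right ha ha')

theorem IsJoin.not_node {F : Forest I} {T T' : Set I} (h : IsJoin F T T') :
    ¬ IsNode F.verts (T ∪ T') := fun hN => by
  have h1 := h.left.2 _ hN Set.subset_union_left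
  have h2 := h.right.2 _ hN Set.subset_union_right
  exact h.ne (h1.symm.trans h2)

theorem IsJoin.notMem {F : Forest I} {T T' : Set I} (h : IsJoin F T T') : T ∪ T' ∉ F.verts :=
  fun hN => h.not_node (Or.inl hN)

theorem IsNode.mono {V W : Finset (Set I)} (h : V ⊆ W) {A : Set I} (hA : IsNode V A) :
    IsNode W A := hA.imp (fun hA => h hA) id

theorem IsSplit.mono {V W : Finset (Set I)} (h : V ⊆ W) {v A B : Set I} (hA : IsSplit V v A B) :
    IsSplit W v A B := ⟨hA.1.mono h, hA.2.1.mono h, hA.2.2⟩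

/-- The forest obtained by joining the trees `T` and `T'` at a new vertex. -/
def Forest.join (F : Forest I) {T T' : Set I} (h : IsJoin F T T') : Forest I where
  verts := insert (T ∪ T') F.verts
  nonempty := by
    intro v hv
    rcases Finset.mem_insert.1 hv with rfl | hv
    · exact h.left.nonempty.mono Set.subset_union_left
    · exact F.nonempty v hv
  laminar := by
    -- An old vertex lies inside a given tree or is disjoint from it.
    have key : ∀ v ∈ F.verts, v ⊆ T ∪ T' ∨ Disjoint v (T ∪ T') := by
      intro v hv
      rcases h.left.node_subset_or_disjoint (Or.inl hv) with h1 | h1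
      · exact Or.inl (h1.trans Set.subset_union_left)
      · rcases h.right.node_subset_or_disjoint (Or.inl hv) with h2 | h2
        · exact Or.inl (h2.trans Set.subset_union_right)
        · exact Or.inr (Set.disjoint_union_right.2 ⟨h1, h2⟩)
    intro v hv w hw
    rcases Finset.mem_insert.1 hv with rfl | hv <;> rcases Finset.mem_insert.1 hw with rfl | hw
    · exact Or.inl subset_rfl
    · rcases key w hw with h | h
      · exact Or.inr (Or.inl h)
      · exact Or.inr (Or.inr h.symm)
    · rcases key v hv with h | h
      · exact Or.inl h
      · exact Or.inr (Or.inr h)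
    · exact F.laminar v hv w hw
  binary := by
    intro v hv
    rcases Finset.mem_insert.1 hv with rfl | hv
    · exact ⟨T, T', h.left.1.mono (Finset.subset_insert _ _),
        h.right.1.mono (Finset.subset_insert _ _), h.disjoint, rfl⟩
    · obtain ⟨A, B, hs⟩ := F.binary v hv
      exact ⟨A, B, hs.mono (Finset.subset_insert _ _)⟩

variable {F : Forest I} {T T' : Set I}

theorem Forest.verts_subset_join (h : IsJoin F T T') : F.verts ⊆ (F.join h).verts :=
  Finset.subset_insert _ _

theorem Forest.mem_join (h : IsJoin F T T') : T ∪ T' ∈ (F.join h).verts :=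
  Finset.mem_insert_self _ _

theorem join_split (h : IsJoin F T T') : IsSplit (F.join h).verts (T ∪ T') T T' :=
  ⟨h.left.1.mono (Finset.subset_insert _ _),
    h.right.1.mono (Finset.subset_insert _ _), h.disjoint, rfl⟩

/-- An old vertex keeps its old split, and a vertex has only one split up to order. -/
theorem join_split_iff (h : IsJoin F T T') {v A B : Set I} (hv : v ∈ F.verts) :
    IsSplit (F.join h).verts v A B ↔ IsSplit F.verts v A B := by
  refine ⟨fun hs => ?_, fun hs => hs.mono (F.verts_subset_join h)⟩
  obtain ⟨C, D, hs'⟩ := F.binary v hv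
  rcases (F.join h).split_unique (hs'.mono (F.verts_subset_join h)) hs with ⟨rfl, rfl⟩ | ⟨rfl, rfl⟩
  · exact hs'
  · exact Forest.split_symm hs'

/-- The inner-oriented forest obtained by joining the trees `T` and `T'` at a new vertex `v`, with
global orientation `v ∧ o` and local orientation `root ∧ T ∧ T'` at `v`. -/
def InnerForest.join (x : InnerForest I) {T T' : Set I} (h : IsJoin x.forest T T') :
    InnerForest I where
  forest := x.forest.join h
  glob := ⟨some (T ∪ T') :: x.glob.word, by
    refine List.nodup_cons.2 ⟨fun hm => ?_, x.glob.nodup⟩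
    rcases (x.glob.mem_iff _).1 hm with h1 | ⟨v, hv, h1⟩
    · simp at h1
    · rw [Option.some.injEq] at h1
      exact h.notMem (h1 ▸ hv), by
    intro a
    simp only [Forest.join, List.mem_cons, x.glob.mem_iff, Finset.mem_insert,
      exists_eq_or_imp]
    tauto⟩
  loc := Function.update x.loc (T ∪ T') [none, some T, some T']
  loc_nodup := by
    intro v hv
    rcases Finset.mem_insert.1 hv with rfl | hv
    · simpa using h.ne
    · have hne : v ≠ T ∪ T' := by rintro rfl; exact h.notMem hv
      simpa [hne] using x.loc_nodup v hv
  loc_mem := by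
    intro v hv e
    rcases Finset.mem_insert.1 hv with rfl | hv
    · simp only [Function.update_self, List.mem_cons, List.not_mem_nil, or_false]
      constructor
      · rintro (rfl | rfl | rfl)
        · exact Or.inl rfl
        · exact Or.inr ⟨_, _, join_split h, rfl⟩
        · exact Or.inr ⟨_, _, Forest.split_symm (join_split h), rfl⟩
      · rintro (rfl | ⟨C, D, hs, rfl⟩)
        · exact Or.inl rfl
        · rcases (x.forest.join h).split_unique (join_split h) hs with ⟨rfl, -⟩ | ⟨rfl, -⟩ <;> simp
    · have hne : v ≠ T ∪ T' := by rintro rfl; exact h.notMem hv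
      rw [Function.update_of_ne hne, x.loc_mem v hv, IsHalfEdge, IsHalfEdge]
      simp only [join_split_iff h hv]
  loc_off := by
    intro v hv
    have hne : v ≠ T ∪ T' := by rintro rfl; exact hv (x.forest.mem_join h)
    rw [Function.update_of_ne hne, x.loc_off v fun hv' => hv (x.forest.verts_subset_join h hv')]

/-- Exchanging the trees only exchanges two factors of `root ∧ T ∧ T'`. -/
theorem Bess.of_join_symm (x : InnerForest I) {T T' : Set I} (h : IsJoin x.forest T T') :
    Bess.of (x.join h.symm) = -Bess.of (x.join h) := by
  have e : x.forest.join h.symm = x.forest.join h := Forest.ext (by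
    simp only [Forest.join, Set.union_comm])
  rw [Bess.of_eq_mk, Bess.of_eq_mk (x.join h)]
  simp only [InnerForest.join, e, Set.union_comm T' T]
  exact Bess.mk_update_swap _ _ _ _ (x.forest.mem_join h) ⟨[none], _, _, [], rfl, rfl⟩

theorem card_join (h : IsJoin F T T') : (F.join h).verts.card = F.verts.card + 1 :=
  Finset.card_insert_of_notMem h.notMem

/-- The set `A` is a union of trees of `F`. -/
def Saturated (F : Forest I) (A : Set I) : Prop := ∀ v ∈ F.verts, v ⊆ A ∨ Disjoint v A

theorem Saturated.node {A N : Set I} (h : Saturated F A) (hN : IsNode F.verts N) :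
    N ⊆ A ∨ Disjoint N A := by
  rcases hN with hN | ⟨i, rfl⟩
  · exact h N hN
  · by_cases hi : i ∈ A
    · exact Or.inl (by simpa using hi)
    · exact Or.inr (by simpa using hi)

theorem Forest.IsTree.saturated (h : F.IsTree T) : Saturated F T :=
  fun _ hv => h.node_subset_or_disjoint (Or.inl hv)

/-- A forest is the join of the two branches at the root vertex of a tree, inside a smaller
forest. -/
theorem Forest.exists_join_eq_of_maximal (F : Forest I) {v A B : Set I} (hv : v ∈ F.verts)
    (hmax : ∀ w ∈ F.verts, v ⊆ w → w ⊆ v) (hs : IsSplit F.verts v A B) :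
    ∃ (F' : Forest I) (h : IsJoin F' A B), F'.join h = F := by
  obtain ⟨a, ha⟩ := F.node_nonempty hs.1
  obtain ⟨b, hb⟩ := F.node_nonempty hs.2.1
  have hab : a ≠ b := by rintro rfl; exact Set.disjoint_left.1 hs.2.2.1 ha hb
  have hav : a ∈ v := hs.2.2.2 ▸ Or.inl ha
  have hbv : b ∈ v := hs.2.2.2 ▸ Or.inr hb
  have hnode : ∀ {N : Set I}, IsNode F.verts N → N ≠ v → IsNode (F.verts.erase v) N := by
    rintro N (hN | hN) hne
    · exact Or.inl (Finset.mem_erase.2 ⟨hne, hN⟩)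
    · exact Or.inr hN
  -- No remaining node contains `v`: a vertex by maximality, a leaf because `v` has the two leaves
  -- `a` and `b`. So the branches of `v` become trees once `v` is removed.
  have hnode' : ∀ {N : Set I}, IsNode (F.verts.erase v) N → IsNode F.verts N ∧ ¬ v ⊆ N := by
    rintro N (hN | ⟨i, rfl⟩)
    · rw [Finset.mem_erase] at hN
      exact ⟨Or.inl hN.2, fun h => hN.1 (Set.Subset.antisymm (hmax N hN.2 h) h)⟩
    · refine ⟨Or.inr ⟨i, rfl⟩, fun h => hab ?_⟩
      have h1 := h hav
      have h2 := h hbv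
      simp only [Set.mem_singleton_iff] at h1 h2
      rw [h1, h2]
  let F' : Forest I :=
    { verts := F.verts.erase v
      nonempty := fun w hw => F.nonempty w (Finset.mem_of_mem_erase hw)
      laminar := fun w hw w' hw' =>
        F.laminar w (Finset.mem_of_mem_erase hw) w' (Finset.mem_of_mem_erase hw')
      binary := by
        intro w hw
        obtain ⟨C, D, h⟩ := F.binary w (Finset.mem_of_mem_erase hw)
        have hwv := (hnode' (Or.inl hw)).2
        refine ⟨C, D, hnode h.1 ?_, hnode h.2.1 ?_, h.2.2⟩
        · rintro rfl
          exact hwv (h.2.2.2 ▸ Set.subset_union_left)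
        · rintro rfl
          exact hwv (h.2.2.2 ▸ Set.subset_union_right) }
  have tree : ∀ {A B : Set I}, IsSplit F.verts v A B → F'.IsTree A := by
    intro A B hs
    obtain ⟨a, ha⟩ := F.node_nonempty hs.1
    obtain ⟨b, hb⟩ := F.node_nonempty hs.2.1
    have hav : a ∈ v := hs.2.2.2 ▸ Or.inl ha
    have hAv : A ≠ v := by
      rintro rfl
      exact Set.disjoint_left.1 hs.2.2.1 (hs.2.2.2 ▸ Or.inr hb) hb
    refine ⟨hnode hs.1 hAv, fun N hN hAN => ?_⟩
    obtain ⟨hN', hvN⟩ := hnode' hN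
    rcases F.node_laminar hN' (Or.inl hv) with h | h | h
    · rcases F.node_sub_branch hs hN' h (fun e => hvN e.symm.subset) with h1 | h1
      · exact h1.antisymm hAN
      · exact absurd (h1 (hAN ha)) (Set.disjoint_left.1 hs.2.2.1 ha)
    · exact absurd h hvN
    · exact absurd hav (Set.disjoint_left.1 h (hAN ha))
  have hne : A ≠ B := by
    rintro rfl
    exact Set.disjoint_left.1 hs.2.2.1 ha ha
  refine ⟨F', ⟨tree hs, tree (Forest.split_symm hs), hne⟩, Forest.ext ?_⟩
  simp only [Forest.join, F', hs.2.2.2]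
  exact Finset.insert_erase hv

/-- A forest with an inner vertex is the join of two trees of a smaller forest. -/
theorem Forest.exists_join_eq (F : Forest I) (hF : F.verts.Nonempty) :
    ∃ (F' : Forest I) (A B : Set I) (h : IsJoin F' A B), F'.join h = F := by
  obtain ⟨v, hv, hmax⟩ := Finset.exists_maximal hF
  obtain ⟨A, B, hs⟩ := F.binary v hv
  obtain ⟨F', h⟩ := F.exists_join_eq_of_maximal hv (fun w hw h => hmax hw h) hs
  exact ⟨F', A, B, h⟩

theorem Forest.eq_discrete {F : Forest I} (h : F.verts = ∅) : F = Forest.discrete I :=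
  Forest.ext h

/-- Pairs of different trees of `F`, the first contained in `A` and the second in `B`. -/
abbrev JoinPair (F : Forest I) (A B : Set I) : Type u :=
  {P : Set I × Set I // IsJoin F P.1 P.2 ∧ P.1 ⊆ A ∧ P.2 ⊆ B}

instance [Finite I] (F : Forest I) (A B : Set I) : Fintype (JoinPair F A B) := Fintype.ofFinite _

variable [Finite I]

/-- The operator that joins in all possible ways a tree contained in `A` with a tree contained in
`B`. -/
def Bess.joins (A B : Set I) : Bess I →ₗ[ℚ] Bess I :=
  Bess.lift (fun x => ∑ P : JoinPair x.forest A B, Bess.of (x.join P.2.1)) <| by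
    rintro ⟨F, g, l, h1, h2, h3⟩ ⟨F', g', l', h1', h2', h3'⟩ h
    have h0 := @flip_vertex_mem _ ⟨F, g, l, h1, h2, h3⟩
    obtain ⟨hF, h⟩ := h
    simp only at hF h h0 ⊢
    subst hF
    rw [← Finset.sum_add_distrib]
    refine Finset.sum_eq_zero fun P _ => Bess.of_flip ⟨rfl, ?_⟩
    rcases h with ⟨ha, rfl⟩ | ⟨ha, v, hb, hc⟩
    · exact Or.inl ⟨ha.append_left [_], rfl⟩
    · refine Or.inr ⟨by simp only [InnerForest.join, ha], v, ?_, ?_⟩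
      · have hne : v ≠ P.1.1 ∪ P.1.2 := by
          rintro rfl
          exact P.2.1.notMem (h0 hb)
        simpa [InnerForest.join, hne] using hb
      · intro w hw
        by_cases hne : w = P.1.1 ∪ P.1.2
        · subst hne; simp [InnerForest.join]
        · simpa [InnerForest.join, hne] using hc w hw

theorem Bess.joins_of (A B : Set I) (x : InnerForest I) :
    Bess.joins A B (Bess.of x) = ∑ P : JoinPair x.forest A B, Bess.of (x.join P.2.1) :=
  Bess.lift_of _ _ _

/-- A tree contained in a tree is equal to it, so the sum has a single term. -/
theorem Bess.joins_of_isJoin (x : InnerForest I) (h : IsJoin x.forest T T') :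
    Bess.joins T T' (Bess.of x) = Bess.of (x.join h) := by
  rw [Bess.joins_of]
  have key : ∀ P : JoinPair x.forest T T', P = ⟨(T, T'), h, subset_rfl, subset_rfl⟩ := by
    rintro ⟨⟨S, S'⟩, h', hS, hS'⟩
    have e1 : T = S := h'.left.2 _ h.left.1 hS
    have e2 : T' = S' := h'.right.2 _ h.right.1 hS'
    subst e1 e2
    rfl
  rw [Fintype.sum_eq_single ⟨(T, T'), h, subset_rfl, subset_rfl⟩ fun P hP => absurd (key P) hP]

theorem Bess.joins_symm (A B : Set I) (z : Bess I) :
    Bess.joins B A z = -Bess.joins A B z := by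
  suffices Bess.joins B A = -Bess.joins A B by rw [this, LinearMap.neg_apply]
  refine Bess.hom_ext fun x => ?_
  rw [LinearMap.neg_apply, Bess.joins_of, Bess.joins_of, ← Finset.sum_neg_distrib]
  refine Fintype.sum_bijective
    (fun P : JoinPair x.forest B A =>
      (⟨(P.1.2, P.1.1), P.2.1.symm, P.2.2.2, P.2.2.1⟩ : JoinPair x.forest A B)) ⟨?_, ?_⟩ _ _ ?_
  · rintro ⟨⟨S, S'⟩, h⟩ ⟨⟨T, T'⟩, h'⟩ e
    simp only [Subtype.mk.injEq, Prod.mk.injEq] at e ⊢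
    exact ⟨e.2, e.1⟩
  · rintro ⟨⟨S, S'⟩, h⟩
    exact ⟨⟨(S', S), h.1.symm, h.2.2, h.2.1⟩, rfl⟩
  · intro P
    exact Bess.of_join_symm x P.2.1.symm

/-- If the nodes of a forest on `K` lie over nodes of a forest `F` on `I`, then the join operator
over a pair of unions of trees of `F` is the sum over the pairs of trees of `F`. -/
theorem Bess.joins_eq_sum {K : Type u} [Finite K] (c : K → I) (F : Forest I) {A B : Set I}
    (hA : Saturated F A) (hB : Saturated F B) (hAB : Disjoint A B) (z : InnerForest K)
    (hz : ∀ w, IsNode z.forest.verts w → ∃ N, IsNode F.verts N ∧ w ⊆ c ⁻¹' N) :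
    Bess.joins (c ⁻¹' A) (c ⁻¹' B) (Bess.of z) =
      ∑ P : JoinPair F A B, Bess.joins (c ⁻¹' P.1.1) (c ⁻¹' P.1.2) (Bess.of z) := by
  simp only [Bess.joins_of]
  rw [← Fintype.sum_sigma']
  symm
  -- A tree of `z` lies over a node, hence over a tree of `F`; saturation forces the latter into
  -- `A`.
  have key : ∀ {A t}, Saturated F A → z.forest.IsTree t → t ⊆ c ⁻¹' A →
      ∃ T, F.IsTree T ∧ T ⊆ A ∧ t ⊆ c ⁻¹' T := by
    intro A t hA ht htA
    obtain ⟨N, hN, htN⟩ := hz t ht.1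
    obtain ⟨T, hT, hNT⟩ := F.exists_tree hN
    have htT : t ⊆ c ⁻¹' T := htN.trans (Set.preimage_mono hNT)
    refine ⟨T, hT, ?_, htT⟩
    obtain ⟨a, ha⟩ := ht.nonempty
    exact (hA.node hT.1).resolve_right fun hd => Set.disjoint_left.1 hd (htT ha) (htA ha)
  refine Fintype.sum_bijective
    (fun Q : (Σ P : JoinPair F A B, JoinPair z.forest (c ⁻¹' P.1.1) (c ⁻¹' P.1.2)) =>
      (⟨Q.2.1, Q.2.2.1, Q.2.2.2.1.trans (Set.preimage_mono Q.1.2.2.1),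
        Q.2.2.2.2.trans (Set.preimage_mono Q.1.2.2.2)⟩ : JoinPair z.forest (c ⁻¹' A) (c ⁻¹' B)))
    ⟨?_, ?_⟩ _ _ fun _ => rfl
  · rintro ⟨⟨⟨T, T'⟩, h, hT, hT'⟩, ⟨⟨t, t'⟩, k, kt, kt'⟩⟩
      ⟨⟨⟨S, S'⟩, h₂, hS, hS'⟩, ⟨⟨s, s'⟩, k₂, ks, ks'⟩⟩ e
    simp only [Subtype.mk.injEq, Prod.mk.injEq] at e
    obtain ⟨rfl, rfl⟩ := e
    obtain ⟨a, ha⟩ := k.left.nonempty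
    obtain ⟨b, hb⟩ := k.right.nonempty
    have e1 : T = S := h.left.eq_of_mem h₂.left (kt ha) (ks ha)
    have e2 : T' = S' := h.right.eq_of_mem h₂.right (kt' hb) (ks' hb)
    subst e1 e2
    rfl
  · rintro ⟨⟨t, t'⟩, k, kt, kt'⟩
    obtain ⟨T, hT, hTA, htT⟩ := key hA k.left kt
    obtain ⟨T', hT', hTB, htT'⟩ := key hB k.right kt'
    have hne : T ≠ T' := by
      rintro rfl
      obtain ⟨a, ha⟩ := hT.nonempty
      exact Set.disjoint_left.1 hAB (hTA ha) (hTB ha)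
    exact ⟨⟨⟨(T, T'), ⟨hT, hT', hne⟩, hTA, hTB⟩, ⟨(t, t'), k, htT, htT'⟩⟩, rfl⟩

/-- The space `Bess(I)` is generated by the forest without inner vertex under the join
operators. -/
theorem Bess.join_induction {P : Bess I → Prop} (discrete : P (Bess.discrete I))
    (add : ∀ x y, P x → P y → P (x + y)) (smul : ∀ (c : ℚ) x, P x → P (c • x))
    (join : ∀ (x : InnerForest I) (A B : Set I), IsJoin x.forest A B → P (Bess.of x) →
      P (Bess.joins A B (Bess.of x))) (z : Bess I) : P z := by
  induction z using Bess.induction with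
  | add x y hx hy => exact add x y hx hy
  | smul c x hx => exact smul c x hx
  | of x =>
    induction hn : x.forest.verts.card generalizing x with
    | zero =>
      obtain ⟨ε, -, e⟩ := Bess.of_eq_smul_of (x := x) (y := discreteInner I)
        (Forest.eq_discrete (Finset.card_eq_zero.1 hn))
      rw [e]
      exact smul _ _ discrete
    | succ n ih =>
      obtain ⟨F', A, B, h, hF⟩ := x.forest.exists_join_eq
        (Finset.card_pos.1 (by omega))
      obtain ⟨y, rfl⟩ := F'.exists_inner
      have hy : y.forest.verts.card = n := by
        have := card_join h
        rw [hF] at this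
        omega
      obtain ⟨ε, -, e⟩ := Bess.of_eq_smul_of (x := x) (y := y.join h) hF.symm
      rw [e, ← Bess.joins_of_isJoin]
      exact smul _ _ (join y A B h (ih y hy))

end Join

/-! ## Joins and relabelling -/

section RelabelJoin

variable {I K : Type u} (e : I ≃ K)

theorem exists_image_eq (N : Set K) : ∃ M : Set I, e '' M = N :=
  ⟨e ⁻¹' N, Set.image_preimage_eq N e.surjective⟩

theorem isNode_relabel_iff {F : Forest I} {A : Set I} :
    IsNode (F.relabel e).verts (e '' A) ↔ IsNode F.verts A := by
  refine ⟨?_, fun h => node_relabel e h⟩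
  rintro (h | ⟨k, hk⟩)
  · obtain ⟨v, hv, h⟩ := Finset.mem_image.1 h
    exact Or.inl (e.injective.image_injective h ▸ hv)
  · refine Or.inr ⟨e.symm k, e.injective.image_injective ?_⟩
    simpa using hk

theorem isTree_relabel_iff {F : Forest I} {A : Set I} :
    (F.relabel e).IsTree (e '' A) ↔ F.IsTree A := by
  rw [Forest.IsTree, Forest.IsTree, isNode_relabel_iff]
  refine and_congr_right fun _ => ⟨fun h N hN hA => ?_, fun h N hN hA => ?_⟩
  · exact e.injective.image_injective
      (h _ ((isNode_relabel_iff e).2 hN) (Set.image_mono hA))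
  · obtain ⟨M, rfl⟩ := exists_image_eq e N
    rw [h M ((isNode_relabel_iff e).1 hN) ((Set.image_subset_image_iff e.injective).1 hA)]

theorem isJoin_relabel_iff {F : Forest I} {A B : Set I} :
    IsJoin (F.relabel e) (e '' A) (e '' B) ↔ IsJoin F A B := by
  constructor
  · rintro ⟨h1, h2, h3⟩
    exact ⟨(isTree_relabel_iff e).1 h1, (isTree_relabel_iff e).1 h2, fun h => h3 (h ▸ rfl)⟩
  · rintro ⟨h1, h2, h3⟩
    exact ⟨(isTree_relabel_iff e).2 h1, (isTree_relabel_iff e).2 h2,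
      fun h => h3 (e.injective.image_injective h)⟩

theorem Bess.relabel_of (x : InnerForest I) :
    Bess.relabel e (Bess.of x) = Bess.of (x.relabel e) := Bess.lift_of _ _ _

theorem Bess.of_relabel_join (x : InnerForest I) {T T' : Set I} (h : IsJoin x.forest T T') :
    Bess.of ((x.join h).relabel e) =
      Bess.of ((x.relabel e).join ((isJoin_relabel_iff e).2 h)) := by
  have inj : Function.Injective fun v : Set I => e '' v := e.injective.image_injective
  refine Bess.of_congr (Forest.ext ?_) ?_ ?_
  · simp [InnerForest.relabel, InnerForest.join, Forest.join, Forest.relabel, Finset.image_insert,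
      Set.image_union]
  · simp [InnerForest.relabel, InnerForest.join, GlobalOrientation.map, Set.image_union]
  · funext w
    obtain ⟨v, rfl⟩ := exists_image_eq e w
    simp only [InnerForest.relabel, InnerForest.join]
    by_cases hv : v = T ∪ T'
    · subst hv
      rw [pushLoc_apply (φ := fun v => e '' v) inj.injOn (x.forest.mem_join h), Set.image_union]
      simp
    · rw [Function.update_of_ne fun he => hv (inj (he.trans (Set.image_union _ _ _).symm))]
      by_cases hF : v ∈ x.forest.verts
      · rw [pushLoc_apply (φ := fun v => e '' v) inj.injOn (x.forest.verts_subset_join h hF),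
          pushLoc_apply (φ := fun v => e '' v) inj.injOn hF, Function.update_of_ne hv]
      · rw [pushLoc_off, pushLoc_off]
        · intro u hu he
          exact hF (inj he ▸ hu)
        · intro u hu he
          rw [inj he] at hu
          exact (Finset.mem_insert.1 hu).elim hv hF

theorem Bess.relabel_joins [Finite I] [Finite K] (A B : Set I) (z : Bess I) :
    Bess.relabel e (Bess.joins A B z) = Bess.joins (e '' A) (e '' B) (Bess.relabel e z) := by
  suffices Bess.relabel e ∘ₗ Bess.joins A B = Bess.joins (e '' A) (e '' B) ∘ₗ Bess.relabel e from
    LinearMap.congr_fun this z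
  refine Bess.hom_ext fun x => ?_
  rw [LinearMap.comp_apply, LinearMap.comp_apply, Bess.relabel_of, Bess.joins_of, Bess.joins_of,
    map_sum]
  refine Fintype.sum_bijective
    (fun P : JoinPair x.forest A B =>
      (⟨(e '' P.1.1, e '' P.1.2), (isJoin_relabel_iff e).2 P.2.1, Set.image_mono P.2.2.1,
        Set.image_mono P.2.2.2⟩ : JoinPair (x.relabel e).forest (e '' A) (e '' B)))
    ⟨?_, ?_⟩ _ _ fun P => ?_
  · rintro ⟨⟨S, S'⟩, h⟩ ⟨⟨T, T'⟩, h'⟩ he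
    simp only [Subtype.mk.injEq, Prod.mk.injEq] at he ⊢
    exact ⟨e.injective.image_injective he.1, e.injective.image_injective he.2⟩
  · rintro ⟨⟨S, S'⟩, h, hS, hS'⟩
    obtain ⟨T, rfl⟩ := exists_image_eq e S
    obtain ⟨T', rfl⟩ := exists_image_eq e S'
    exact ⟨⟨(T, T'), (isJoin_relabel_iff e).1 h, (Set.image_subset_image_iff e.injective).1 hS,
      (Set.image_subset_image_iff e.injective).1 hS'⟩, rfl⟩
  · rw [Bess.relabel_of, Bess.of_relabel_join]

end RelabelJoin

/-! ## The coproduct given by the formula -/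

section Letters

variable {I : Type u}

/-- The word `w' ∧ r ∧ w''`. -/
def splitLetters (w' w'' : List (Option (Set I))) : List (Letter I) :=
  w'.map (fun a => a.elim Letter.R' Letter.vert) ++ [Letter.r] ++
    w''.map (fun a => a.elim Letter.R'' Letter.vert)

/-- The word `w` in which `R` is replaced by `R' ∧ r ∧ R''`. -/
def fullLetters (w : List (Option (Set I))) : List (Letter I) :=
  w.flatMap fun a => a.elim [Letter.R', Letter.r, Letter.R''] fun v => [Letter.vert v]

theorem splitLetters_swap_left {l l' : List (Option (Set I))} (h : AdjSwap l l')
    (w : List (Option (Set I))) : AdjSwap (splitLetters l w) (splitLetters l' w) :=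
  ((h.map _).append_right _).append_right _

theorem splitLetters_swap_right {l l' : List (Option (Set I))} (h : AdjSwap l l')
    (w : List (Option (Set I))) : AdjSwap (splitLetters w l) (splitLetters w l') :=
  (h.map _).append_left _

/-- The block `R' ∧ r ∧ R''` has an odd number of letters, so a vertex moves past it with the same
sign as past `R`. -/
theorem wedge_fullLetters_swap {l l' : List (Option (Set I))} (h : AdjSwap l l')
    (hn : l.Nodup) : wedge (fullLetters l) = -wedge (fullLetters l') := by
  obtain ⟨a, x, y, b, rfl, rfl⟩ := h
  have key : ∀ (v : Set I), wedge [Letter.vert v, Letter.R', Letter.r, Letter.R''] =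
      -wedge [Letter.R', Letter.r, Letter.R'', Letter.vert v] := by
    intro v
    have s₁ : AdjSwap [Letter.vert v, Letter.R', Letter.r, Letter.R'']
        [Letter.R', Letter.vert v, Letter.r, Letter.R''] := ⟨[], _, _, _, rfl, rfl⟩
    have s₂ : AdjSwap [Letter.R', Letter.vert v, Letter.r, Letter.R'']
        [Letter.R', Letter.r, Letter.vert v, Letter.R''] := ⟨[_], _, _, _, rfl, rfl⟩
    have s₃ : AdjSwap [Letter.R', Letter.r, Letter.vert v, Letter.R'']
        [Letter.R', Letter.r, Letter.R'', Letter.vert v] := ⟨[_, _], _, _, _, rfl, rfl⟩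
    rw [wedge_swap s₁, wedge_swap s₂, wedge_swap s₃, neg_neg]
  have e : ∀ x y : Option (Set I), fullLetters (a ++ x :: y :: b) =
      fullLetters a ++ (fullLetters [x, y] ++ fullLetters b) := by
    intro x y
    simp [fullLetters]
  have hxy : wedge (fullLetters [x, y]) = -wedge (fullLetters [y, x]) := by
    rcases x with _ | v <;> rcases y with _ | w
    · exact absurd hn (by simp [List.nodup_append])
    · exact (neg_eq_iff_eq_neg.2 (key w)).symm
    · exact key v
    · exact wedge_swap ⟨[], _, _, [], rfl, rfl⟩
  rw [e, e, wedge_append, wedge_append, wedge_append, wedge_append, hxy]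
  simp

theorem nodup_fullLetters {V : Finset (Set I)} {w : List (Option (Set I))} (h : IsWord V w) :
    (fullLetters w).Nodup := by
  rw [fullLetters, List.nodup_flatMap]
  refine ⟨fun a _ => by rcases a with _ | a <;> simp, h.1.imp fun {a b} hab => ?_⟩
  rcases a with _ | a <;> rcases b with _ | b <;> simp_all [List.disjoint_left]

/-- Both words list without repetition the elements of `V` and the three auxiliary letters. Hence
every splitting has a sign. -/
theorem splitLetters_perm {V V' : Finset (Set I)} (hV : V' ⊆ V) {w w' w'' : List (Option (Set I))}
    (h : IsWord V w) (h' : IsWord V' w') (h'' : IsWord (V \ V') w'') :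
    (splitLetters w' w'').Perm (fullLetters w) := by
  refine (List.perm_ext_iff_of_nodup ?_ (nodup_fullLetters h)).2 fun a => ?_
  · rw [splitLetters, List.append_assoc]
    refine List.Nodup.append (h'.1.map ?_) (List.Nodup.append (by simp) (h''.1.map ?_) ?_) ?_
    · rintro (_ | a) (_ | b) hab <;> simp_all
    · rintro (_ | a) (_ | b) hab <;> simp_all
    · rintro a ha hb
      obtain ⟨(_ | b), -, rfl⟩ := List.mem_map.1 hb <;> simp at ha
    · rintro a ha hb
      obtain ⟨(_ | b), hb', rfl⟩ := List.mem_map.1 ha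
      · rcases List.mem_append.1 hb with hb | hb
        · simp at hb
        · obtain ⟨(_ | c), -, e⟩ := List.mem_map.1 hb <;> simp at e
      · rcases List.mem_append.1 hb with hb | hb
        · simp at hb
        · obtain ⟨(_ | c), hc, e⟩ := List.mem_map.1 hb
          · simp at e
          · simp only [Option.elim_some, Letter.vert.injEq] at e
            subst e
            have h1 := (h'.2 _).1 hb'
            have h2 := (h''.2 _).1 hc
            simp at h1 h2
            exact h2.2 h1
  · simp only [splitLetters, fullLetters, List.mem_append, List.mem_map, List.mem_flatMap,
      Option.exists, Option.elim_none, Option.elim_some, h.2, h'.2, h''.2, Finset.mem_sdiff,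
      List.mem_cons, List.not_mem_nil, or_false]
    rcases a with v | _ | _ | _
    · simp
      constructor
      · rintro (h | h)
        · exact hV h
        · exact h.1
      · intro h
        tauto
    · simp
    · simp
    · simp

end Letters

/-! ### Orientation signs of `γ(F, V)` and definition of the coproduct -/

section GammaSum

variable {I : Type u}

theorem pushLoc_congr {I K : Type u} {φ φ' : Set I → Set K} {η η' : Set I → Set I → Set K}
    {S : Finset (Set I)} {l l' : Set I → List (Option (Set I))}
    (hφ : Set.InjOn φ (S : Set (Set I))) (h₁ : ∀ v ∈ S, φ v = φ' v)
    (h₂ : ∀ v ∈ S, (l v).map (Option.map (η v)) = (l' v).map (Option.map (η' v))) :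
    pushLoc φ η S l = pushLoc φ' η' S l' := by
  have hφ' : Set.InjOn φ' (S : Set (Set I)) := hφ.congr h₁
  funext w
  by_cases hx : ∃ u ∈ S, φ u = w
  · obtain ⟨u, hu, rfl⟩ := hx
    rw [pushLoc_apply hφ hu, h₁ u hu, pushLoc_apply hφ' hu, h₂ u hu]
  · push Not at hx
    rw [pushLoc_off hx, pushLoc_off fun v hv => by rw [← h₁ v hv]; exact hx v hv]

/-- The scalar `c` measures how far `o'` and `o''` are from being compatible with `o`; carrying it
along allows arbitrary orientations of the two parts. -/
theorem exists_splitSign (x : InnerForest I) {V' : Finset (Set I)} (h : V' ⊆ x.forest.verts)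
    (o' : GlobalOrientation V') (o'' : GlobalOrientation (x.forest.verts \ V')) :
    ∃ c : ℚ, wedge (splitLetters o'.word o''.word) = c • wedge (fullLetters x.glob.word) := by
  obtain ⟨c, -, hc⟩ := exists_sign (splitLetters_perm h x.glob.isWord o'.isWord o''.isWord)
  exact ⟨c, hc wedge fun _ _ => wedge_swap⟩

variable [Finite I]

/-- One sign serves for the sum over `γ(F, V)` and for every antisymmetric function of the word.
Thus a change of orientation in a tensor factor can be matched with the change in a wedge. -/
theorem gammaSum_eq_smul (x : InnerForest I) {V : Finset (Set I)} (o₁ o₂ : GlobalOrientation V) :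
    ∃ ε : ℚ, (ε = 1 ∨ ε = -1) ∧ gammaSum x o₁ = ε • gammaSum x o₂ ∧
      ∀ {M : Type u} [AddCommGroup M] [Module ℚ M] (φ : List (Option (Set I)) → M),
        (∀ l l', AdjSwap l l' → φ l = -φ l') → φ o₁.word = ε • φ o₂.word := by
  obtain ⟨ε, hε, h⟩ := exists_sign (o₁.isWord.perm o₂.isWord)
  refine ⟨ε, hε, ?_, h⟩
  -- The value zero on other words gives a function of all words, as the choice of sign requires.
  have := h (fun w => if hw : IsWord V w then gammaSum x ⟨w, hw.1, hw.2⟩ else 0) ?_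
  · simpa [o₁.isWord, o₂.isWord] using this
  · intro l l' hl
    by_cases hw : IsWord V l
    · have hw' : IsWord V l' := hw.of_perm hl.perm
      rw [dif_pos hw, dif_pos hw', eq_neg_iff_add_eq_zero, gammaSum, gammaSum,
        ← Finset.sum_add_distrib]
      exact Finset.sum_eq_zero fun p _ => Bess.of_flip ⟨rfl, Or.inl ⟨hl.map _, rfl⟩⟩
    · have hw' : ¬ IsWord V l' := fun h => hw (h.of_perm hl.perm.symm)
      rw [dif_neg hw, dif_neg hw', neg_zero]

/-- The term of the coproduct of `x` for the splitting of the vertices in `V'` and its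
complement. -/
def splitTerm (x : InnerForest I) (V' : Finset (Set I)) : Bess I ⊗[ℚ] Bess I :=
  if h : V' ⊆ x.forest.verts then
    (exists_splitSign x h (GlobalOrientation.std V') (GlobalOrientation.std _)).choose •
      gammaSum x (GlobalOrientation.std V') ⊗ₜ
        gammaSum x (GlobalOrientation.std (x.forest.verts \ V'))
  else 0

/-- The term of the coproduct for a splitting can be computed with arbitrary orientations. -/
theorem splitTerm_eq (x : InnerForest I) {V' : Finset (Set I)} (h : V' ⊆ x.forest.verts)
    (o' : GlobalOrientation V') (o'' : GlobalOrientation (x.forest.verts \ V')) {c : ℚ}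
    (hc : wedge (splitLetters o'.word o''.word) = c • wedge (fullLetters x.glob.word)) :
    splitTerm x V' = c • gammaSum x o' ⊗ₜ gammaSum x o'' := by
  rw [splitTerm, dif_pos h]
  have hd := (exists_splitSign x h (GlobalOrientation.std V') (GlobalOrientation.std _)).choose_spec
  set d := (exists_splitSign x h (GlobalOrientation.std V') (GlobalOrientation.std _)).choose
  obtain ⟨ε', h1, h2, h3⟩ := gammaSum_eq_smul x (GlobalOrientation.std V') o'
  obtain ⟨ε'', k1, k2, k3⟩ :=
    gammaSum_eq_smul x (GlobalOrientation.std (x.forest.verts \ V')) o''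
  -- Comparison of the wedges expresses `d` as the product of `ε'`, `ε''` and `c`. The two signs
  -- come out of the tensor factors a second time and cancel.
  rw [h3 (fun w => wedge (splitLetters w _)) fun _ _ hl => wedge_swap (splitLetters_swap_left hl _),
    k3 (fun w => wedge (splitLetters _ w)) fun _ _ hl => wedge_swap (splitLetters_swap_right hl _),
    hc, smul_smul, smul_smul] at hd
  have hd' := smul_wedge_injective (nodup_fullLetters x.glob.isWord) hd
  rw [h2, k2, TensorProduct.smul_tmul_smul, smul_smul, ← hd']
  congr 1
  rcases h1 with rfl | rfl <;> rcases k1 with rfl | rfl <;> ring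

/-- Neither the global orientation of `F` nor the local orientations outside `V` enter the sum. -/
theorem gammaSum_congr {F : Forest I} {g g' : GlobalOrientation F.verts}
    {l l' : Set I → List (Option (Set I))} (h₁ h₂ h₃ h₁' h₂' h₃') {V : Finset (Set I)}
    (o : GlobalOrientation V) (h : ∀ v ∈ V, l v = l' v) :
    gammaSum ⟨F, g, l, h₁, h₂, h₃⟩ o = gammaSum ⟨F, g', l', h₁', h₂', h₃'⟩ o := by
  refine Finset.sum_congr rfl fun p _ => Bess.of_congr rfl rfl ?_
  exact pushLoc_congr (η := fun v A => A ∩ p.vert v) (η' := fun v A => A ∩ p.vert v)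
    (l := l) (l' := l') p.vert_injOn (fun _ _ => rfl) fun v hv => by rw [h v hv]

theorem gammaSum_flip {F : Forest I} {g g' : GlobalOrientation F.verts}
    {l l' : Set I → List (Option (Set I))} (h₁ h₂ h₃ h₁' h₂' h₃') {V : Finset (Set I)}
    (o : GlobalOrientation V) {v : Set I} (hv : v ∈ V) (h : AdjSwap (l v) (l' v))
    (h' : ∀ w, w ≠ v → l w = l' w) :
    gammaSum ⟨F, g, l, h₁, h₂, h₃⟩ o = -gammaSum ⟨F, g', l', h₁', h₂', h₃'⟩ o := by
  rw [eq_neg_iff_add_eq_zero, gammaSum, gammaSum, ← Finset.sum_add_distrib]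
  refine Finset.sum_eq_zero fun p _ => Bess.of_flip ⟨rfl, Or.inr ⟨rfl, p.vert v, ?_⟩⟩
  exact pushLoc_flip (η := fun v A => A ∩ p.vert v) p.vert_injOn hv h h'

/-- A swap in the global orientation changes the sign of `c`. A swap at a vertex changes exactly one
tensor factor, because the vertex belongs to exactly one of the two parts. -/
theorem splitTerm_flip {x y : InnerForest I} (h : Flip x y) {V' : Finset (Set I)}
    (hV : V' ⊆ x.forest.verts) : splitTerm x V' = -splitTerm y V' := by
  obtain ⟨F, g, l, h1, h2, h3⟩ := x
  obtain ⟨F', g', l', h1', h2', h3'⟩ := y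
  have h0 := @flip_vertex_mem _ ⟨F, g, l, h1, h2, h3⟩
  obtain ⟨hF, h⟩ := h
  simp only at hF h h0 hV
  subst hF
  obtain ⟨c, hc⟩ := exists_splitSign ⟨F, g, l, h1, h2, h3⟩ hV (GlobalOrientation.std V')
    (GlobalOrientation.std _)
  rw [splitTerm_eq ⟨F, g, l, h1, h2, h3⟩ hV _ _ hc]
  rcases h with ⟨ha, rfl⟩ | ⟨ha, v, hb, hc'⟩
  · rw [splitTerm_eq ⟨F, g', l, h1', h2', h3'⟩ hV (GlobalOrientation.std V')
      (GlobalOrientation.std _) (c := -c) ?_, TensorProduct.smul_tmul', TensorProduct.smul_tmul', neg_smul,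
      TensorProduct.neg_tmul, neg_neg]
    · rfl
    · rw [hc]
      simp only
      rw [wedge_fullLetters_swap ha g.nodup, smul_neg, neg_smul]
  · rw [splitTerm_eq ⟨F, g', l', h1', h2', h3'⟩ hV (GlobalOrientation.std V')
      (GlobalOrientation.std _) (c := c) (by rw [hc]; simp only [ha])]
    by_cases hv : v ∈ V'
    · rw [gammaSum_flip h1 h2 h3 h1' h2' h3' (g' := g') _ hv hb hc',
        gammaSum_congr h1 h2 h3 h1' h2' h3' (g' := g'), TensorProduct.neg_tmul, smul_neg]
      intro w hw
      refine hc' w ?_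
      rintro rfl
      exact (Finset.mem_sdiff.1 hw).2 hv
    · rw [gammaSum_flip h1 h2 h3 h1' h2' h3' (g' := g') (GlobalOrientation.std (F.verts \ V'))
          (Finset.mem_sdiff.2 ⟨h0 hb, hv⟩) hb hc',
        gammaSum_congr h1 h2 h3 h1' h2' h3' (g' := g'), TensorProduct.tmul_neg, smul_neg]
      intro w hw
      refine hc' w ?_
      rintro rfl
      exact hv hw

variable (I) in
/-- The coproduct. -/
def coproduct : Bess I →ₗ[ℚ] Bess I ⊗[ℚ] Bess I :=
  Bess.lift (fun x => ∑ V' ∈ x.forest.verts.powerset, splitTerm x V') <| by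
    intro x y h
    rw [← h.1, ← Finset.sum_add_distrib]
    refine Finset.sum_eq_zero fun V' hV => ?_
    rw [splitTerm_flip h (Finset.mem_powerset.1 hV), neg_add_cancel]

theorem coproduct_of (x : InnerForest I) :
    coproduct I (Bess.of x) = ∑ V' ∈ x.forest.verts.powerset, splitTerm x V' :=
  Bess.lift_of _ _ _

/-- Compatibility of the orientations says precisely that `c = 1` is admissible in `splitTerm_eq`.
-/
theorem coproduct_formula (x : InnerForest I)
    (o' : ∀ V' : Finset (Set I), GlobalOrientation V')
    (o'' : ∀ V' : Finset (Set I), GlobalOrientation (x.forest.verts \ V'))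
    (h : ∀ V' ⊆ x.forest.verts, Compatible (o' V') (o'' V') x.glob) :
    coproduct I (Bess.of x) =
      ∑ V' ∈ x.forest.verts.powerset, gammaSum x (o' V') ⊗ₜ[ℚ] gammaSum x (o'' V') := by
  rw [coproduct_of]
  refine Finset.sum_congr rfl fun V' hV => ?_
  have hV := Finset.mem_powerset.1 hV
  rw [splitTerm_eq x hV (o' V') (o'' V') (c := 1), one_smul]
  rw [one_smul]
  exact h V' hV

end GammaSum

/-! ## The coproduct of a join -/

section GammaJoin

variable {I : Type u} {F : Forest I} {T T' : Set I}

theorem Gamma.vert_eq {V : Finset (Set I)} (p : Gamma F V) (w : p.forest.verts) {v : Set I}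
    (h : (p.hom.toFun w : Set I) = v) : p.vert v = w := h ▸ p.vert_hom w

theorem Gamma.exists_vert {V : Finset (Set I)} (p : Gamma F V) {v : Set I} (hv : v ∈ V) :
    ∃ w : p.forest.verts, (p.hom.toFun w : Set I) = v ∧ p.vert v = w := by
  obtain ⟨w, hw⟩ := (p.range v).1 hv
  exact ⟨w, hw, p.vert_eq w hw⟩

/-- The elements of `γ(F, V)` as elements of `γ` of a join. -/
def Gamma.toJoin (h : IsJoin F T T') {V : Finset (Set I)} (p : Gamma F V) :
    Gamma (F.join h) V where
  forest := p.forest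
  hom :=
    { toFun := fun w => ⟨p.hom.toFun w, F.verts_subset_join h (p.hom.toFun w).2⟩
      injective := fun v w e => p.hom.injective (Subtype.ext (Subtype.mk.inj e))
      increasing := p.hom.increasing
      leaves := p.hom.leaves
      branches := fun v A' B' hs => by
        obtain ⟨A, B, hs', h'⟩ := p.hom.branches v A' B' hs
        exact ⟨A, B, hs'.mono (F.verts_subset_join h), h'⟩ }
  range := p.range

/-- As `V` consists of old vertices, a map with image `V` never reaches the new one. -/
theorem Gamma.toJoin_bijective (h : IsJoin F T T') {V : Finset (Set I)} (hV : V ⊆ F.verts) :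
    Function.Bijective (Gamma.toJoin h : Gamma F V → Gamma (F.join h) V) := by
  constructor
  · intro p q e
    have e' : p.forest = q.forest := congrArg (fun r : Gamma (F.join h) V => r.forest) e
    exact Gamma.forest_injective V e'
  · intro q
    have hm : ∀ w, (q.hom.toFun w : Set I) ∈ F.verts := fun w => hV ((q.range _).2 ⟨w, rfl⟩)
    refine ⟨⟨q.forest,
      { toFun := fun w => ⟨q.hom.toFun w, hm w⟩
        injective := fun v w e => q.hom.injective (Subtype.ext (Subtype.mk.inj e))
        increasing := q.hom.increasing
        leaves := q.hom.leaves
        branches := fun v A' B' hs => by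
          obtain ⟨A, B, hs', h'⟩ := q.hom.branches v A' B' hs
          exact ⟨A, B, (join_split_iff h (hm v)).1 hs', h'⟩ }, q.range⟩, ?_⟩
    exact Gamma.forest_injective V rfl

/-- This describes the tensor factor to which the new vertex does not belong. -/
theorem gammaSum_join [Finite I] (x : InnerForest I) (h : IsJoin x.forest T T')
    {V : Finset (Set I)} (hV : V ⊆ x.forest.verts) (o : GlobalOrientation V) :
    gammaSum (x.join h) o = gammaSum x o := by
  symm
  refine Fintype.sum_bijective _ (Gamma.toJoin_bijective h hV) _ _ fun p => ?_
  have hvert : ∀ v ∈ V, p.vert v = (p.toJoin h).vert v := by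
    intro v hv
    obtain ⟨w, hw, e⟩ := p.exists_vert hv
    rw [e, (p.toJoin h).vert_eq w hw]
  refine Bess.of_congr rfl ?_ ?_
  · refine List.map_congr_left fun a ha => ?_
    rcases (o.mem_iff a).1 ha with rfl | ⟨v, hv, rfl⟩
    · rfl
    · simp only [Option.map_some, hvert v hv]
      rfl
  · refine pushLoc_congr (η := fun v A => A ∩ p.vert v)
      (η' := fun v A => A ∩ (p.toJoin h).vert v) (l := x.loc) (l' := (x.join h).loc)
      p.vert_injOn hvert fun v hv => ?_
    have hne : v ≠ T ∪ T' := by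
      rintro rfl
      exact h.notMem (hV hv)
    simp only [InnerForest.join, Function.update_of_ne hne, hvert v hv]

/-- A map of forests extends to the joins of trees contained in each other. -/
def Forest.Hom.join {F' : Forest I} {t t' : Set I} (f : Forest.Hom F' F) (h : IsJoin F T T')
    (h' : IsJoin F' t t') (ht : t ⊆ T) (ht' : t' ⊆ T') :
    Forest.Hom (F'.join h') (F.join h) where
  toFun w := if hw : w.1 ∈ F'.verts then
    ⟨f.toFun ⟨w.1, hw⟩, F.verts_subset_join h (f.toFun ⟨w.1, hw⟩).2⟩ else ⟨T ∪ T', F.mem_join h⟩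
  injective := by
    rintro ⟨v, hv⟩ ⟨w, hw⟩ e
    by_cases h1 : v ∈ F'.verts <;> by_cases h2 : w ∈ F'.verts
    · simp only [h1, h2, dif_pos, Subtype.mk.injEq] at e
      have := f.injective (Subtype.ext e)
      simpa using this
    · simp only [h1, h2, dif_pos, dif_neg, not_false_eq_true, Subtype.mk.injEq] at e
      exact absurd (e ▸ (f.toFun ⟨v, h1⟩).2) h.notMem
    · simp only [h1, h2, dif_pos, dif_neg, not_false_eq_true, Subtype.mk.injEq] at e
      exact absurd (e ▸ (f.toFun ⟨w, h2⟩).2) h.notMem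
    · have e1 := (Finset.mem_insert.1 hv).resolve_right h1
      have e2 := (Finset.mem_insert.1 hw).resolve_right h2
      exact Subtype.ext (e1.trans e2.symm)
  increasing := by
    rintro ⟨v, hv⟩ ⟨w, hw⟩ e
    simp only at e
    by_cases h1 : v ∈ F'.verts <;> by_cases h2 : w ∈ F'.verts
    · simp only [h1, h2, dif_pos]
      exact f.increasing ⟨v, h1⟩ ⟨w, h2⟩ e
    · simp only [h1, h2, dif_pos, dif_neg, not_false_eq_true]
      have e2 := (Finset.mem_insert.1 hw).resolve_right h2
      subst e2
      -- Here `v` is old and `w` is new. A leaf of `v` lies in `t` or `t'`, so the image of `v`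
      -- meets `T` or `T'` and is contained in that tree.
      obtain ⟨a, ha⟩ := F'.nonempty v h1
      have ham := f.leaves ⟨v, h1⟩ a ha
      rcases e ha with hat | hat
      · rcases h.left.node_subset_or_disjoint (Or.inl (f.toFun ⟨v, h1⟩).2) with h3 | h3
        · exact h3.trans Set.subset_union_left
        · exact absurd (ht hat) (Set.disjoint_left.1 h3 ham)
      · rcases h.right.node_subset_or_disjoint (Or.inl (f.toFun ⟨v, h1⟩).2) with h3 | h3
        · exact h3.trans Set.subset_union_right
        · exact absurd (ht' hat) (Set.disjoint_left.1 h3 ham)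
    -- An old vertex containing the new one would contain, hence be equal to, both of the trees `t`
    -- and `t'`.
    · have e1 := (Finset.mem_insert.1 hv).resolve_right h1
      subst e1
      exact absurd ((h'.left.2 w (Or.inl h2) (Set.subset_union_left.trans e)).symm.trans
        (h'.right.2 w (Or.inl h2) (Set.subset_union_right.trans e))) h'.ne
    · simp only [h1, h2, dif_neg, not_false_eq_true]
      exact subset_rfl
  leaves := by
    rintro ⟨v, hv⟩ i hi
    by_cases h1 : v ∈ F'.verts
    · simp only [h1, dif_pos]
      exact f.leaves ⟨v, h1⟩ i hi
    · simp only [h1, dif_neg, not_false_eq_true]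
      have e1 := (Finset.mem_insert.1 hv).resolve_right h1
      subst e1
      exact hi.imp (fun h => ht h) (fun h => ht' h)
  branches := by
    rintro ⟨v, hv⟩ A' B' hs
    by_cases h1 : v ∈ F'.verts
    · simp only [h1, dif_pos]
      obtain ⟨A, B, hs', hAB⟩ := f.branches ⟨v, h1⟩ A' B' ((join_split_iff h' h1).1 hs)
      exact ⟨A, B, hs'.mono (F.verts_subset_join h), hAB⟩
    · simp only [h1, dif_neg, not_false_eq_true]
      have e1 := (Finset.mem_insert.1 hv).resolve_right h1
      subst e1
      rcases (F'.join h').split_unique (join_split h') hs with ⟨rfl, rfl⟩ | ⟨rfl, rfl⟩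
      · exact ⟨T, T', join_split h, ht, ht'⟩
      · exact ⟨T', T, Forest.split_symm (join_split h), ht', ht⟩

theorem Forest.Hom.join_toFun_of_mem {F' : Forest I} {t t' : Set I} (f : Forest.Hom F' F)
    (h : IsJoin F T T') (h' : IsJoin F' t t') (ht : t ⊆ T) (ht' : t' ⊆ T') (w : F'.verts) :
    ((f.join h h' ht ht').toFun ⟨w, F'.verts_subset_join h' w.2⟩ : Set I) = f.toFun w := by
  simp [Forest.Hom.join]

theorem Forest.Hom.join_toFun_new {F' : Forest I} {t t' : Set I} (f : Forest.Hom F' F)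
    (h : IsJoin F T T') (h' : IsJoin F' t t') (ht : t ⊆ T) (ht' : t' ⊆ T') :
    ((f.join h h' ht ht').toFun ⟨t ∪ t', F'.mem_join h'⟩ : Set I) = T ∪ T' := by
  simp [h'.notMem, Forest.Hom.join]

/-- Elements of `γ(F, V)` with a pair of trees in `T` and `T'` give elements of `γ` of the join. -/
def Gamma.join (h : IsJoin F T T') {V U : Finset (Set I)} (hU : U = insert (T ∪ T') V)
    (p : Gamma F V) (P : JoinPair p.forest T T') : Gamma (F.join h) U where
  forest := p.forest.join P.2.1
  hom := p.hom.join h P.2.1 P.2.2.1 P.2.2.2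
  range := by
    intro v
    rw [hU, Finset.mem_insert, p.range]
    constructor
    · rintro (rfl | ⟨w, rfl⟩)
      · exact ⟨⟨P.1.1 ∪ P.1.2, p.forest.mem_join P.2.1⟩, p.hom.join_toFun_new h P.2.1 _ _⟩
      · exact ⟨⟨w, p.forest.verts_subset_join P.2.1 w.2⟩, p.hom.join_toFun_of_mem h P.2.1 _ _ w⟩
    · rintro ⟨⟨w, hw⟩, rfl⟩
      by_cases h1 : w ∈ p.forest.verts
      · exact Or.inr ⟨⟨w, h1⟩, (p.hom.join_toFun_of_mem h P.2.1 _ _ ⟨w, h1⟩).symm⟩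
      · have e1 := (Finset.mem_insert.1 hw).resolve_right h1
        subst e1
        exact Or.inl (p.hom.join_toFun_new h P.2.1 P.2.2.1 P.2.2.2)

theorem Gamma.join_vert_new (h : IsJoin F T T') {V U : Finset (Set I)}
    (hU : U = insert (T ∪ T') V) (p : Gamma F V) (P : JoinPair p.forest T T') :
    (p.join h hU P).vert (T ∪ T') = P.1.1 ∪ P.1.2 :=
  (p.join h hU P).vert_eq ⟨P.1.1 ∪ P.1.2, p.forest.mem_join P.2.1⟩
    (p.hom.join_toFun_new h P.2.1 P.2.2.1 P.2.2.2)

theorem Gamma.join_vert_of_mem (h : IsJoin F T T') {V U : Finset (Set I)}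
    (hU : U = insert (T ∪ T') V) (p : Gamma F V) (P : JoinPair p.forest T T') {v : Set I}
    (hv : v ∈ V) : (p.join h hU P).vert v = p.vert v := by
  obtain ⟨w, hw, e⟩ := p.exists_vert hv
  rw [e]
  exact (p.join h hU P).vert_eq ⟨w, p.forest.verts_subset_join P.2.1 w.2⟩
    ((p.hom.join_toFun_of_mem h P.2.1 P.2.2.1 P.2.2.2 w).trans hw)

/-- The joined trees can be read off from the new vertex. This gives injectivity in
`Gamma.join_bijective` and identifies the half-edges at the new vertex. -/
theorem inter_union_of_subset (h : IsJoin F T T') {t t' : Set I} (ht : t ⊆ T) (ht' : t' ⊆ T') :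
    T ∩ (t ∪ t') = t ∧ T' ∩ (t ∪ t') = t' := by
  have hd := Set.disjoint_left.1 h.disjoint
  constructor
  · ext a
    constructor
    · rintro ⟨h1, h2 | h2⟩
      · exact h2
      · exact absurd (ht' h2) (hd h1)
    · exact fun ha => ⟨ht ha, Or.inl ha⟩
  · ext a
    constructor
    · rintro ⟨h1, h2 | h2⟩
      · exact absurd h1 (hd (ht h2))
      · exact h2
    · exact fun ha => ⟨ht' ha, Or.inr ha⟩

/-- For the inverse, the vertex `m` over `T ∪ T'` is removed; its branches `T ∩ m` and `T' ∩ m` are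
the pair of trees to be joined. -/
theorem Gamma.join_bijective (h : IsJoin F T T') {V U : Finset (Set I)} (hV : V ⊆ F.verts)
    (hU : U = insert (T ∪ T') V) :
    Function.Bijective (fun Q : Σ p : Gamma F V, JoinPair p.forest T T' =>
      Q.1.join h hU Q.2) := by
  constructor
  · rintro ⟨p, P⟩ ⟨q, Q⟩ e
    simp only at e
    have e1 : P.1.1 ∪ P.1.2 = Q.1.1 ∪ Q.1.2 := by
      rw [← p.join_vert_new h hU P, e, q.join_vert_new h hU Q]
    have e2 : P.1.1 = Q.1.1 := by
      rw [← (inter_union_of_subset h P.2.2.1 P.2.2.2).1, e1,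
        (inter_union_of_subset h Q.2.2.1 Q.2.2.2).1]
    have e3 : P.1.2 = Q.1.2 := by
      rw [← (inter_union_of_subset h P.2.2.1 P.2.2.2).2, e1,
        (inter_union_of_subset h Q.2.2.1 Q.2.2.2).2]
    have e4 : p = q := by
      refine Gamma.forest_injective V (Forest.ext ?_)
      have e5 : insert (P.1.1 ∪ P.1.2) p.forest.verts = insert (Q.1.1 ∪ Q.1.2) q.forest.verts :=
        congrArg (fun r : Gamma (F.join h) U => r.forest.verts) e
      rw [← Finset.erase_insert P.2.1.notMem, e5, e1, Finset.erase_insert Q.2.1.notMem]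
    subst e4
    have e6 : P = Q := Subtype.ext (Prod.ext e2 e3)
    rw [e6]
  · intro q
    have hvU : T ∪ T' ∈ U := hU ▸ Finset.mem_insert_self _ _
    have hVF : T ∪ T' ∉ V := fun hv => h.notMem (hV hv)
    obtain ⟨m, hm, hm'⟩ := q.exists_vert hvU
    have hs := q.split hvU (join_split h)
    -- No other vertex of the join contains `T ∪ T'`. As the map is increasing and injective, the
    -- vertex over it is maximal too.
    have hmax : ∀ w ∈ q.forest.verts, q.vert (T ∪ T') ⊆ w → w ⊆ q.vert (T ∪ T') := by
      intro w hw hmw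
      have h1 : (q.hom.toFun m : Set I) ⊆ q.hom.toFun ⟨w, hw⟩ :=
        q.hom.increasing m ⟨w, hw⟩ (hm' ▸ hmw)
      rw [hm] at h1
      have h2 : (q.hom.toFun ⟨w, hw⟩ : Set I) = T ∪ T' := by
        have h3 := (q.hom.toFun ⟨w, hw⟩).2
        refine (Finset.mem_insert.1 h3).resolve_right fun h4 => ?_
        exact h.ne ((h.left.2 _ (Or.inl h4) (Set.subset_union_left.trans h1)).symm.trans
          (h.right.2 _ (Or.inl h4) (Set.subset_union_right.trans h1)))
      exact (q.vert_eq ⟨w, hw⟩ h2).symm.subset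
    obtain ⟨F', hj, hF'⟩ := q.forest.exists_join_eq_of_maximal (v := q.vert (T ∪ T'))
      (hm' ▸ m.2) hmax hs
    have hunion : T ∩ q.vert (T ∪ T') ∪ T' ∩ q.vert (T ∪ T') = q.vert (T ∪ T') := hs.2.2.2
    have hF'sub : ∀ w ∈ F'.verts, w ∈ q.forest.verts := fun w hw =>
      hF' ▸ F'.verts_subset_join hj hw
    have hmem : ∀ w (hw : w ∈ F'.verts), (q.hom.toFun ⟨w, hF'sub w hw⟩ : Set I) ∈ V := by
      intro w hw
      have h1 : (q.hom.toFun ⟨w, hF'sub w hw⟩ : Set I) ∈ U := (q.range _).2 ⟨_, rfl⟩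
      refine (Finset.mem_insert.1 (hU.subset h1)).resolve_left fun h2 => hj.notMem ?_
      rw [hunion, hm']
      have h3 := q.hom.injective (Subtype.ext (h2.trans hm.symm))
      rw [← h3]
      exact hw
    refine ⟨⟨⟨F',
      { toFun := fun w => ⟨q.hom.toFun ⟨w, hF'sub w w.2⟩, hV (hmem w w.2)⟩
        injective := fun v w e => by
          have := q.hom.injective (Subtype.ext (Subtype.mk.inj e))
          exact Subtype.ext (Subtype.mk.inj this)
        increasing := fun v w hvw => q.hom.increasing _ _ hvw
        leaves := fun v i hi => q.hom.leaves ⟨v, hF'sub v v.2⟩ i hi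
        branches := fun v A' B' hs' => by
          obtain ⟨A, B, hs'', h'⟩ := q.hom.branches ⟨v, hF'sub v v.2⟩ A' B'
            (hs'.mono fun w hw => hF'sub w hw)
          exact ⟨A, B, (join_split_iff h (hV (hmem v v.2))).1 hs'', h'⟩ }, fun v => ?_⟩,
      ⟨(T ∩ q.vert (T ∪ T'), T' ∩ q.vert (T ∪ T')), hj, Set.inter_subset_left,
        Set.inter_subset_left⟩⟩, Gamma.forest_injective U hF'⟩
    constructor
    · intro hv
      obtain ⟨w, hw⟩ := (q.range v).1 (hU ▸ Finset.mem_insert_of_mem hv)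
      have hwF : w.1 ∈ insert (T ∩ q.vert (T ∪ T') ∪ T' ∩ q.vert (T ∪ T')) F'.verts :=
        (congrArg Forest.verts hF').symm.subset w.2
      rw [Finset.mem_insert, hunion] at hwF
      refine ⟨⟨w, hwF.resolve_left fun e => hVF ?_⟩, hw⟩
      have : w = m := Subtype.ext (e.trans hm')
      rw [← hm, ← this, hw]
      exact hv
    · rintro ⟨w, rfl⟩
      exact hmem w w.2

/-- A forest in `γ(F, V)` may have several trees inside `T` and inside `T'`, and the new vertex may
join any pair of them. This is why the join operator, and not a single join, appears. -/
theorem gammaSum_join_insert [Finite I] (x : InnerForest I) (h : IsJoin x.forest T T')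
    {V U : Finset (Set I)} (hV : V ⊆ x.forest.verts) (hU : U = insert (T ∪ T') V)
    (o : GlobalOrientation V) (o₁ : GlobalOrientation U)
    (ho : o₁.word = some (T ∪ T') :: o.word) :
    gammaSum (x.join h) o₁ = Bess.joins T T' (gammaSum x o) := by
  rw [gammaSum, gammaSum, map_sum]
  simp only [Bess.joins_of]
  rw [← Fintype.sum_sigma']
  symm
  refine Fintype.sum_bijective _ (Gamma.join_bijective h hV hU) _ _ ?_
  rintro ⟨p, P⟩
  have hne : ∀ v ∈ V, v ≠ T ∪ T' := by
    rintro v hv rfl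
    exact h.notMem (hV hv)
  have hvert : ∀ v ∈ V, (p.join h hU P).vert v = p.vert v :=
    fun v hv => p.join_vert_of_mem h hU P hv
  have hnew := p.join_vert_new h hU P
  refine Bess.of_congr rfl ?_ ?_
  · simp only [InnerForest.join, gammaInner, GlobalOrientation.map, ho, List.map_cons,
      Option.map_some, hnew]
    congr 1
    refine List.map_congr_left fun a ha => ?_
    rcases (o.mem_iff a).1 ha with rfl | ⟨v, hv, rfl⟩
    · rfl
    · simp only [Option.map_some, hvert v hv]
  · funext w
    simp only [InnerForest.join, gammaInner]
    by_cases hw : w ∈ (p.join h hU P).forest.verts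
    · rw [Gamma.verts_eq, Finset.mem_image] at hw
      obtain ⟨v, hv, rfl⟩ := hw
      rw [pushLoc_apply (p.join h hU P).vert_injOn hv]
      rw [hU, Finset.mem_insert] at hv
      rcases hv with rfl | hv
      · rw [hnew]
        simp [(inter_union_of_subset h P.2.2.1 P.2.2.2).1,
          (inter_union_of_subset h P.2.2.1 P.2.2.2).2]
      · rw [hvert v hv, Function.update_of_ne (hne v hv), Function.update_of_ne,
          pushLoc_apply p.vert_injOn hv]
        intro e
        refine P.2.1.notMem ?_
        rw [← e, p.verts_eq]
        exact Finset.mem_image_of_mem _ hv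
    · have e1 : w ≠ P.1.1 ∪ P.1.2 := by
        rintro rfl
        exact hw (p.forest.mem_join P.2.1)
      rw [Function.update_of_ne e1, pushLoc_off, pushLoc_off]
      · rintro v hv rfl
        refine hw ?_
        rw [Gamma.verts_eq]
        exact Finset.mem_image_of_mem _ hv
      · rintro v hv rfl
        refine hw (p.forest.verts_subset_join P.2.1 ?_)
        rw [p.verts_eq]
        exact Finset.mem_image_of_mem _ hv

end GammaJoin

/-! ### Degrees, Koszul signs and the derivation rule -/

section Grading

variable {I : Type u}

variable (I) in
/-- The operator `(-1) ^ deg`. -/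
def Bess.sign : Bess I →ₗ[ℚ] Bess I := LinearMap.id - (2 : ℚ) • Bess.oddPart I

theorem Bess.oddPart_of (x : InnerForest I) : Bess.oddPart I (Bess.of x) =
    if Odd x.forest.verts.card then Bess.of x else 0 := Bess.lift_of _ _ _

theorem Bess.sign_of (x : InnerForest I) :
    Bess.sign I (Bess.of x) = (-1 : ℚ) ^ x.forest.verts.card • Bess.of x := by
  rw [Bess.sign, LinearMap.sub_apply, LinearMap.smul_apply, Bess.oddPart_of, LinearMap.id_apply]
  split_ifs with h
  · rw [h.neg_one_pow]
    module
  · rw [(Nat.not_odd_iff_even.1 h).neg_one_pow]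
    module

theorem Gamma.card {F : Forest I} {V : Finset (Set I)} (p : Gamma F V) :
    p.forest.verts.card = V.card := by
  rw [p.verts_eq, Finset.card_image_of_injOn p.vert_injOn]

variable [Finite I]

theorem Bess.sign_gammaSum (x : InnerForest I) {V : Finset (Set I)} (o : GlobalOrientation V) :
    Bess.sign I (gammaSum x o) = (-1 : ℚ) ^ V.card • gammaSum x o := by
  rw [gammaSum, map_sum, Finset.smul_sum]
  exact Finset.sum_congr rfl fun p _ => by rw [Bess.sign_of]; simp only [gammaInner, p.card]

/-- The action of a join operator as a derivation of degree one on `Bess ⊗ Bess`. -/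
def tensorJoins (A B : Set I) : Bess I ⊗[ℚ] Bess I →ₗ[ℚ] Bess I ⊗[ℚ] Bess I :=
  TensorProduct.map (Bess.joins A B) LinearMap.id +
    TensorProduct.map (Bess.sign I) (Bess.joins A B)

theorem tensorJoins_tmul (A B : Set I) (a b : Bess I) :
    tensorJoins A B (a ⊗ₜ b) = Bess.joins A B a ⊗ₜ b + Bess.sign I a ⊗ₜ Bess.joins A B b := rfl

/-- The orientation `v ∧ o`. -/
def GlobalOrientation.cons {V U : Finset (Set I)} (o : GlobalOrientation V) (v : Set I)
    (hv : v ∉ V) (hU : U = insert v V) : GlobalOrientation U where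
  word := some v :: o.word
  nodup := by
    refine List.nodup_cons.2 ⟨fun hm => ?_, o.nodup⟩
    rcases (o.mem_iff _).1 hm with h1 | ⟨w, hw, h1⟩
    · simp at h1
    · rw [Option.some.injEq] at h1
      exact hv (h1 ▸ hw)
  mem_iff := by
    intro a
    simp only [hU, List.mem_cons, o.mem_iff, Finset.mem_insert, exists_eq_or_imp]
    tauto

theorem wedge_move {α : Type u} (l : List α) (a : α) (l' : List α) :
    wedge (l ++ a :: l') = (-1 : ℚ) ^ l.length • wedge (a :: (l ++ l')) := by
  induction l with
  | nil => simp
  | cons b l ih =>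
    have h : AdjSwap (b :: a :: (l ++ l')) (a :: b :: (l ++ l')) := ⟨[], _, _, _, rfl, rfl⟩
    rw [List.cons_append, wedge_cons, ih, mul_smul_comm, ← wedge_cons, wedge_swap h,
      List.length_cons, pow_succ]
    simp

theorem IsWord.length {I : Type u} {V : Finset (Set I)} {w : List (Option (Set I))}
    (h : IsWord V w) : w.length = V.card + 1 := by
  rw [(h.perm (isWord_toList V)).length_eq]
  simp

/-- Each splitting of the old vertices extends in two ways, by putting the new vertex in the second
or in the first part. These give the two summands of the derivation. -/
theorem coproduct_join (x : InnerForest I) {T T' : Set I} (h : IsJoin x.forest T T') :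
    coproduct I (Bess.of (x.join h)) = tensorJoins T T' (coproduct I (Bess.of x)) := by
  have hx : (x.join h).forest.verts = insert (T ∪ T') x.forest.verts := rfl
  rw [coproduct_of, coproduct_of, hx, Finset.sum_powerset_insert h.notMem, map_sum,
    ← Finset.sum_add_distrib]
  refine Finset.sum_congr rfl fun V' hV => ?_
  rw [Finset.mem_powerset] at hV
  have hn : T ∪ T' ∉ V' := fun hv => h.notMem (hV hv)
  obtain ⟨c, hc⟩ := exists_splitSign x hV (GlobalOrientation.std V') (GlobalOrientation.std _)
  set o' := GlobalOrientation.std V'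
  set o'' := GlobalOrientation.std (x.forest.verts \ V')
  have hfull : wedge (fullLetters (x.join h).glob.word) =
      wedge [Letter.vert (T ∪ T')] * wedge (fullLetters x.glob.word) := by
    rw [← wedge_append]
    rfl
  have hU : (x.join h).forest.verts \ V' = insert (T ∪ T') (x.forest.verts \ V') := by
    rw [hx, Finset.insert_sdiff_of_notMem _ hn]
  have hn' : T ∪ T' ∉ x.forest.verts \ V' := fun hv => h.notMem (Finset.mem_sdiff.1 hv).1
  have hU' : (x.join h).forest.verts \ insert (T ∪ T') V' = x.forest.verts \ V' := by
    rw [hx, Finset.insert_sdiff_insert, Finset.sdiff_insert_of_notMem h.notMem]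
  -- The new vertex is moved to the front past the `V'.card + 1` letters of `o'`, which include
  -- `R'`, and past `r`. The two auxiliary letters cancel in the sign.
  have e₁ : splitTerm (x.join h) V' = (((-1) ^ V'.card * c : ℚ)) •
      gammaSum x o' ⊗ₜ Bess.joins T T' (gammaSum x o'') := by
    rw [splitTerm_eq (x.join h) (hV.trans (x.forest.verts_subset_join h)) o'
      (o''.cons _ hn' hU) (c := (-1) ^ V'.card * c), gammaSum_join x h hV,
      gammaSum_join_insert x h Finset.sdiff_subset hU o'' _ rfl]
    have : splitLetters o'.word (o''.cons _ hn' hU).word =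
      (o'.word.map (fun a => a.elim Letter.R' Letter.vert) ++ [Letter.r]) ++ Letter.vert (T ∪ T') ::
        o''.word.map (fun a => a.elim Letter.R'' Letter.vert) := rfl
    rw [this, wedge_move, wedge_cons]
    change _ • (_ * wedge (splitLetters o'.word o''.word)) = _
    rw [hc, hfull, mul_smul_comm, smul_smul]
    congr 2
    rw [List.length_append, List.length_map, o'.isWord.length]
    simp [pow_succ]
  -- Here the new vertex is already in front, so no sign arises.
  have e₂ : splitTerm (x.join h) (insert (T ∪ T') V') =
      c • Bess.joins T T' (gammaSum x o') ⊗ₜ gammaSum x o'' := by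
    -- The complement agrees with the old one only up to the equality `hU'`, so `o''` is transported
    -- along it.
    obtain ⟨q, hq⟩ : ∃ q : GlobalOrientation ((x.join h).forest.verts \ insert (T ∪ T') V'),
        q.word = o''.word ∧ gammaSum (x.join h) q = gammaSum x o'' := by
      rw [hU']
      exact ⟨o'', rfl, gammaSum_join x h Finset.sdiff_subset o''⟩
    rw [splitTerm_eq (x.join h) (Finset.insert_subset_insert _ hV) (o'.cons _ hn rfl) q (c := c),
      hq.2, gammaSum_join_insert x h hV rfl o' _ rfl]
    have : splitLetters (o'.cons _ hn rfl).word q.word =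
        Letter.vert (T ∪ T') :: splitLetters o'.word o''.word := by
      rw [hq.1]
      rfl
    rw [this, wedge_cons, hc, hfull, mul_smul_comm]
  rw [e₁, e₂, splitTerm_eq x hV o' o'' hc, map_smul, tensorJoins_tmul, Bess.sign_gammaSum,
    smul_add, TensorProduct.smul_tmul', TensorProduct.smul_tmul', TensorProduct.smul_tmul',
    smul_smul, add_comm, mul_comm]

end Grading

/-! ### Coproducts and joins over unions of trees -/

section Finer

variable {I : Type u}

/-- Every vertex of `G` lies above some vertex of `F`. -/
def Finer (G F : Forest I) : Prop := ∀ w ∈ G.verts, ∃ v ∈ F.verts, w ⊆ v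

theorem Finer.node {G F : Forest I} (h : Finer G F) {w : Set I} (hw : IsNode G.verts w) :
    ∃ N, IsNode F.verts N ∧ w ⊆ N := by
  rcases hw with hw | ⟨i, rfl⟩
  · obtain ⟨v, hv, hwv⟩ := h w hw
    exact ⟨v, Or.inl hv, hwv⟩
  · exact ⟨{i}, Or.inr ⟨i, rfl⟩, subset_rfl⟩

theorem Finer.saturated {G F : Forest I} (h : Finer G F) {A : Set I} (hA : Saturated F A) :
    Saturated G A := by
  intro w hw
  obtain ⟨v, hv, hwv⟩ := h w hw
  exact (hA v hv).imp (fun h => hwv.trans h) fun h => h.mono_left hwv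

theorem Gamma.finer {F : Forest I} {V : Finset (Set I)} (p : Gamma F V) : Finer p.forest F :=
  fun w hw => ⟨p.hom.toFun ⟨w, hw⟩, (p.hom.toFun ⟨w, hw⟩).2, p.hom.leaves ⟨w, hw⟩⟩

variable [Finite I]

/-- The members of `γ(F, V)` have all their vertices inside vertices of `F`. Linear identities can
therefore be tested on tensors of finer forests, for which unions of trees of `F` are still unions
of trees. -/
theorem coproduct_of_induction (x : InnerForest I) {P : Bess I ⊗[ℚ] Bess I → Prop}
    (zero : P 0) (add : ∀ X Y, P X → P Y → P (X + Y)) (smul : ∀ (c : ℚ) X, P X → P (c • X))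
    (tmul : ∀ z z' : InnerForest I, Finer z.forest x.forest → Finer z'.forest x.forest →
      P (Bess.of z ⊗ₜ Bess.of z')) : P (coproduct I (Bess.of x)) := by
  rw [coproduct_of]
  refine Finset.sum_induction _ P add zero fun V' hV => ?_
  rw [Finset.mem_powerset] at hV
  obtain ⟨c, hc⟩ := exists_splitSign x hV (GlobalOrientation.std V') (GlobalOrientation.std _)
  rw [splitTerm_eq x hV _ _ hc]
  refine smul _ _ ?_
  rw [gammaSum, gammaSum, TensorProduct.sum_tmul]
  refine Finset.sum_induction _ P add zero fun p _ => ?_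
  rw [TensorProduct.tmul_sum]
  exact Finset.sum_induction _ P add zero fun q _ => tmul _ _ p.finer q.finer

/-- The coproduct commutes with the join operators. -/
theorem coproduct_joins (x : InnerForest I) {A B : Set I} (hA : Saturated x.forest A)
    (hB : Saturated x.forest B) (hAB : Disjoint A B) :
    coproduct I (Bess.joins A B (Bess.of x)) = tensorJoins A B (coproduct I (Bess.of x)) := by
  rw [Bess.joins_of, map_sum]
  simp only [coproduct_join]
  -- The sum runs over pairs of trees of `x`, but acts on finer forests; grouping their trees by the
  -- trees of `x` turns it into one operator.
  have key : ∀ z : InnerForest I, Finer z.forest x.forest → Bess.joins A B (Bess.of z) =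
      ∑ P : JoinPair x.forest A B, Bess.joins P.1.1 P.1.2 (Bess.of z) := fun z hz =>
    Bess.joins_eq_sum id x.forest hA hB hAB z fun w hw => hz.node hw
  refine coproduct_of_induction x
    (P := fun X => ∑ P : JoinPair x.forest A B, tensorJoins P.1.1 P.1.2 X = tensorJoins A B X)
    ?_ ?_ ?_ ?_
  · simp
  · intro X Y hX hY
    simp only [map_add, Finset.sum_add_distrib, hX, hY]
  · intro c X hX
    simp only [map_smul, ← Finset.smul_sum, hX]
  · intro z z' hz hz'
    simp only [tensorJoins_tmul, Finset.sum_add_distrib, key z hz, key z' hz',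
      TensorProduct.sum_tmul, TensorProduct.tmul_sum]

end Finer

/-! ## Composition and joins -/

section GraftJoin

variable {I J : Type u}

theorem Bess.comp_of [Finite J] (x : InnerForest (Option I)) (y : InnerForest J) :
    Bess.comp I J (Bess.of x) (Bess.of y) = (-1 : ℚ) ^ beforeR y.glob.word •
      ∑ s : PathVert x.forest → Tree y.forest, Bess.of (graftInner x y s) := by
  rw [Bess.comp, Bess.lift_of, Bess.lift_of]

/-- The leaves of a vertex on the path of `⋆` are `⋆` and the leaves of the side branches. -/
theorem exists_mem_side {F : Forest (Option I)} (v : PathVert F) {i : I} (hi : some i ∈ v.1) :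
    ∃ u : PathVert F, u.1 ⊆ v.1 ∧ some i ∈ side F u.1 := by
  -- At the first vertex on the path from `⋆` that has `i` above it, the leaf `i` must come from the
  -- side branch.
  obtain ⟨u, ⟨hu, hiu⟩, hmin⟩ := Set.Finite.exists_minimalFor (fun u : PathVert F => u.1)
    {u : PathVert F | u.1 ⊆ v.1 ∧ some i ∈ u.1} (Set.toFinite _) ⟨v, subset_rfl, hi⟩
  refine ⟨u, hu, ?_⟩
  obtain ⟨A, hs, hA⟩ := path_split u
  rw [← hs.2.2.2] at hiu
  refine hiu.resolve_left fun hiA => ?_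
  have hAu : A ⊆ u.1 := hs.2.2.2 ▸ Set.subset_union_left
  rcases hs.1 with hAF | ⟨a, rfl⟩
  · have h1 : u.1 ⊆ A := hmin (j := ⟨A, hAF, hA⟩) ⟨hAu.trans hu, hiA⟩ hAu
    obtain ⟨k, hk⟩ := side_nonempty u
    exact Set.disjoint_left.1 hs.2.2.1 (h1 (side_subset u hk)) hk
  · simp only [Set.mem_singleton_iff] at hA hiA
    rw [← hA] at hiA
    cases hiA

variable {F : Forest (Option I)} {F₂ : Forest J}

/-- Vertices of `F₂` lie over the leaf `⋆`, the others over the vertex they come from. This is the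
hypothesis of `Bess.joins_eq_sum` for the map `collapse`. -/
theorem graft_node_over (s : PathVert F → Tree F₂) {w : Set (I ⊕ J)}
    (hw : IsNode (graft F F₂ s).verts w) : ∃ N, IsNode F.verts N ∧ w ⊆ collapse ⁻¹' N := by
  rcases hw with hw | ⟨a, rfl⟩
  · rcases Finset.mem_union.1 hw with hw | hw
    · obtain ⟨v, hv, rfl⟩ := Finset.mem_image.1 hw
      exact ⟨v, Or.inl hv, graftVert_subset s v⟩
    · obtain ⟨u, hu, rfl⟩ := Finset.mem_image.1 hw
      refine ⟨{none}, Or.inr ⟨none, rfl⟩, ?_⟩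
      rintro _ ⟨j, -, rfl⟩
      rfl
  · exact ⟨{collapse a}, Or.inr ⟨_, rfl⟩, by simp⟩

theorem graft_saturated (s : PathVert F → Tree F₂) {A : Set (Option I)} (hA : Saturated F A) :
    Saturated (graft F F₂ s) (collapse ⁻¹' A) := by
  intro w hw
  obtain ⟨N, hN, hwN⟩ := graft_node_over s (Or.inl hw)
  rcases hA.node hN with h | h
  · exact Or.inl (hwN.trans (Set.preimage_mono h))
  · exact Or.inr ((h.preimage collapse).mono_left hwN)

variable {T T' : Set (Option I)} (h : IsJoin F T T')

theorem IsJoin.not_meets_both {K : Type u} {F : Forest K} {T T' : Set K} (h : IsJoin F T T')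
    {N : Set K} (hN : IsNode F.verts N) {a b : K} (ha : a ∈ T) (hb : b ∈ T') (haN : a ∈ N)
    (hbN : b ∈ N) : False := by
  rcases h.left.node_subset_or_disjoint hN with h1 | h1
  · exact Set.disjoint_left.1 h.disjoint (h1 hbN) hb
  · exact Set.disjoint_left.1 h1 haN ha

/-- Restriction of a choice of trees from the path in a join. -/
def restrictPath (s : PathVert (F.join h) → Tree F₂) (u : PathVert F) : Tree F₂ :=
  s ⟨u.1, F.verts_subset_join h u.2.1, u.2.2⟩

theorem side_join {u : Set (Option I)} (hu : u ∈ F.verts) : side (F.join h) u = side F u := by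
  simp only [side, join_split_iff h hu]

/-- The new vertex is contained in no old one, so it is not among the path vertices from which an
old vertex is grown. -/
theorem graftVert_join (s : PathVert (F.join h) → Tree F₂) {u : Set (Option I)}
    (hu : u ∈ F.verts) :
    graftVert (F.join h) F₂ s u = graftVert F F₂ (restrictPath h s) u := by
  by_cases hn : none ∈ u
  · have e₁ := graftVert_path s ⟨u, F.verts_subset_join h hu, hn⟩
    have e₂ := graftVert_path (restrictPath h s) ⟨u, hu, hn⟩
    simp only at e₁ e₂
    rw [e₁, e₂]
    ext (i | j)
    · rw [inl_mem_grow, inl_mem_grow]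
      constructor
      · rintro ⟨⟨w, hw, hwn⟩, h1, h2, h3⟩
        have hwF : w ∈ F.verts := by
          refine (Finset.mem_insert.1 hw).resolve_left ?_
          rintro rfl
          obtain ⟨a, ha⟩ := h.left.nonempty
          obtain ⟨b, hb⟩ := h.right.nonempty
          exact h.not_meets_both (Or.inl hu) ha hb (h1 (Or.inl ha)) (h1 (Or.inr hb))
        exact ⟨⟨w, hwF, hwn⟩, h1, h2, by rwa [side_join h hwF] at h3⟩
      · rintro ⟨⟨w, hw, hwn⟩, h1, h2, h3⟩
        exact ⟨⟨w, F.verts_subset_join h hw, hwn⟩, h1, h2, by rwa [side_join h hw]⟩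
    · rw [inr_mem_grow, inr_mem_grow]
      rfl
  · rw [graftVert_of_notMem s hn, graftVert_of_notMem _ hn]

theorem graftBranch_join (s : PathVert (F.join h) → Tree F₂) {u : Set (Option I)}
    (hu : u ∈ F.verts) (A : Set (Option I)) :
    graftBranch (F.join h) F₂ s u A = graftBranch F F₂ (restrictPath h s) u A := by
  rw [graftBranch, graftBranch, graftVert_join h s hu]

theorem graft_join_verts (s : PathVert (F.join h) → Tree F₂) :
    (graft (F.join h) F₂ s).verts = insert (graftVert (F.join h) F₂ s (T ∪ T'))
      (graft F F₂ (restrictPath h s)).verts := by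
  have e : F.verts.image (graftVert (F.join h) F₂ s) =
      F.verts.image (graftVert F F₂ (restrictPath h s)) :=
    Finset.image_congr fun u hu => graftVert_join h s hu
  simp only [graft, graftVerts, Forest.join, Finset.image_insert, Finset.insert_union]
  rw [← e]
  rfl

theorem graft_join_split (s : PathVert (F.join h) → Tree F₂) :
    IsSplit (graft (F.join h) F₂ s).verts (graftVert (F.join h) F₂ s (T ∪ T'))
      (graftBranch (F.join h) F₂ s (T ∪ T') T) (graftBranch (F.join h) F₂ s (T ∪ T') T') :=
  graft_split_left s (F.mem_join h) (join_split h)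

theorem graft_join_not_subset (s : PathVert (F.join h) → Tree F₂) {w : Set (I ⊕ J)}
    (hw : w ∈ (graft F F₂ (restrictPath h s)).verts) :
    ¬ graftVert (F.join h) F₂ s (T ∪ T') ⊆ w := by
  intro hsub
  have hs := graft_join_split h s
  obtain ⟨a, ha⟩ := (graft (F.join h) F₂ s).node_nonempty hs.1
  obtain ⟨b, hb⟩ := (graft (F.join h) F₂ s).node_nonempty hs.2.1
  obtain ⟨N, hN, hwN⟩ := graft_node_over _ (Or.inl hw)
  exact h.not_meets_both hN ha.2 hb.2 (hwN (hsub ha.1)) (hwN (hsub hb.1))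

/-- The vertex coming from `T ∪ T'` is maximal in the composed forest; its removal leaves the
composition for the restricted choice, in which its branches are trees. -/
theorem graft_isJoin (s : PathVert (F.join h) → Tree F₂) :
    IsJoin (graft F F₂ (restrictPath h s)) (graftBranch (F.join h) F₂ s (T ∪ T') T)
      (graftBranch (F.join h) F₂ s (T ∪ T') T') := by
  have hs := graft_join_split h s
  have hv : graftVert (F.join h) F₂ s (T ∪ T') ∈ (graft (F.join h) F₂ s).verts := by
    rw [graft_join_verts]
    exact Finset.mem_insert_self _ _
  obtain ⟨F', hj, hF'⟩ := (graft (F.join h) F₂ s).exists_join_eq_of_maximal hv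
    (fun w hw hsub => by
      rw [graft_join_verts, Finset.mem_insert] at hw
      rcases hw with rfl | hw
      · exact subset_rfl
      · exact absurd hsub (graft_join_not_subset h s hw)) hs
  have e : F' = graft F F₂ (restrictPath h s) := by
    refine Forest.ext ?_
    have e₁ : insert (_ ∪ _) F'.verts = _ :=
      (congrArg Forest.verts hF').trans (graft_join_verts h s)
    rw [hs.2.2.2] at e₁
    have n₁ := hj.notMem
    rw [hs.2.2.2] at n₁
    have n₂ : graftVert (F.join h) F₂ s (T ∪ T') ∉ (graft F F₂ (restrictPath h s)).verts :=
      fun hm => graft_join_not_subset h s hm subset_rfl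
    rw [← Finset.erase_insert n₁, ← Finset.erase_insert n₂, e₁]
  exact e ▸ hj

theorem graft_join_eq (s : PathVert (F.join h) → Tree F₂) :
    graft (F.join h) F₂ s = (graft F F₂ (restrictPath h s)).join (graft_isJoin h s) := by
  refine Forest.ext ((graft_join_verts h s).trans ?_)
  exact congrArg (insert · _) (graft_join_split h s).2.2.2.symm

/-- The choices of trees for the path in a join correspond to the choices for the path in the
given forest and the pairs of trees to be joined in the composed forest. -/
theorem graft_join_bijective [Nonempty J] (hn : none ∉ T') :
    Function.Bijective (fun s : PathVert (F.join h) → Tree F₂ =>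
      (⟨restrictPath h s, ⟨(graftBranch (F.join h) F₂ s (T ∪ T') T,
        graftBranch (F.join h) F₂ s (T ∪ T') T'), graft_isJoin h s, Set.inter_subset_right,
        Set.inter_subset_right⟩⟩ : Σ s : PathVert F → Tree F₂,
          JoinPair (graft F F₂ s) (collapse ⁻¹' T) (collapse ⁻¹' T'))) := by
  constructor
  · intro s₁ s₂ e
    have e₁ : restrictPath h s₁ = restrictPath h s₂ := congrArg Sigma.fst e
    have e₂ := congrArg (fun Q : Σ s : PathVert F → Tree F₂,
          JoinPair (graft F F₂ s) (collapse ⁻¹' T) (collapse ⁻¹' T') => Q.2.1) e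
    simp only [Prod.mk.injEq] at e₂
    have e₃ : graftVert (F.join h) F₂ s₁ (T ∪ T') = graftVert (F.join h) F₂ s₂ (T ∪ T') := by
      rw [← (graft_join_split h s₁).2.2.2, ← (graft_join_split h s₂).2.2.2, e₂.1, e₂.2]
    -- At the new vertex the chosen tree is recovered as the set of leaves in `J`.
    funext ⟨u, hu, hun⟩
    rcases Finset.mem_insert.1 hu with rfl | huF
    · have g₁ := graftVert_path s₁ ⟨T ∪ T', hu, hun⟩
      have g₂ := graftVert_path s₂ ⟨T ∪ T', hu, hun⟩
      simp only at g₁ g₂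
      rw [g₁, g₂] at e₃
      refine Subtype.ext (Set.ext fun j => ?_)
      rw [← inr_mem_grow, e₃, inr_mem_grow]
    · exact congrFun e₁ ⟨u, huF, hun⟩
  · rintro ⟨s, ⟨⟨t, t'⟩, hj, ht, ht'⟩⟩
    simp only at hj ht ht'
    -- The value of the choice at the new vertex must be the tree of `F₂` from which `t` is grown.
    -- If `⋆` is not in `T`, the new vertex is off the path and any tree will do.
    have hτ : ∃ τ : Tree F₂, none ∈ T → ∃ j ∈ τ.1, Sum.inr j ∈ t := by
      by_cases hnT : none ∈ T
      · have hjt : ∃ j, Sum.inr j ∈ t := by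
          obtain ⟨i | j, ha⟩ := hj.left.nonempty
          · have hiT : some i ∈ T := ht ha
            have hTF : T ∈ F.verts := by
              refine h.left.1.resolve_right ?_
              rintro ⟨k, rfl⟩
              simp only [Set.mem_singleton_iff] at hnT hiT
              rw [← hnT] at hiT
              cases hiT
            obtain ⟨u, -, hiu⟩ := exists_mem_side (⟨T, hTF, hnT⟩ : PathVert F) hiT
            have hg : grow F F₂ s u ∈ (graft F F₂ s).verts := by
              rw [← graftVert_path]
              exact Finset.mem_union_left _ (Finset.mem_image_of_mem _ u.2.1)
            have hig : Sum.inl i ∈ grow F F₂ s u :=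
              (inl_mem_grow s u i).2 ⟨u, subset_rfl, rfl, hiu⟩
            obtain ⟨j, hj'⟩ := F₂.node_nonempty (s u).2.1
            refine ⟨j, ?_⟩
            rcases hj.left.node_subset_or_disjoint (Or.inl hg) with h1 | h1
            · exact h1 ((inr_mem_grow s u j).2 hj')
            · exact absurd ha (Set.disjoint_left.1 h1 hig)
          · exact ⟨j, ha⟩
        obtain ⟨j, hj'⟩ := hjt
        obtain ⟨τ, hτ, hjτ⟩ := F₂.exists_tree (N := {j}) (Or.inr ⟨j, rfl⟩)
        exact ⟨⟨τ, hτ⟩, fun _ => ⟨j, hjτ rfl, hj'⟩⟩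
      · obtain ⟨j⟩ := ‹Nonempty J›
        obtain ⟨τ, hτ, -⟩ := F₂.exists_tree (N := {j}) (Or.inr ⟨j, rfl⟩)
        exact ⟨⟨τ, hτ⟩, fun h' => absurd h' hnT⟩
    obtain ⟨τ, hτ⟩ := hτ
    obtain ⟨s', hr, hs'⟩ : ∃ s' : PathVert (F.join h) → Tree F₂,
        restrictPath h s' = s ∧ ∀ u, u.1 ∉ F.verts → s' u = τ := by
      refine ⟨fun u => if hu : u.1 ∈ F.verts then s ⟨u.1, hu, u.2.2⟩ else τ, ?_, ?_⟩
      · funext u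
        simp only [restrictPath, u.2.1, dif_pos]
      · intro u hu
        simp only [hu, dif_neg, not_false_eq_true]
    have hj' := graft_isJoin h s'
    rw [hr] at hj'
    -- A branch without `⋆` survives as a node of the composed forest, so at most one tree lies over
    -- it.
    have single : ∀ {S t₁ t₂ : Set _}, IsNode F.verts S → none ∉ S → (graft F F₂ s).IsTree t₁ →
        (graft F F₂ s).IsTree t₂ → t₁ ⊆ collapse ⁻¹' S → t₂ ⊆ collapse ⁻¹' S → t₁ = t₂ := by
      intro S t₁ t₂ hS hnS h₁ h₂ h₁S h₂S
      have hnode : IsNode (graft F F₂ s).verts (collapse ⁻¹' S) := graft_node_left s hS hnS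
      rw [← h₁.2 _ hnode h₁S, h₂.2 _ hnode h₂S]
    have et' : graftBranch (F.join h) F₂ s' (T ∪ T') T' = t' :=
      single h.right.1 hn hj'.right hj.right Set.inter_subset_right ht'
    have et : graftBranch (F.join h) F₂ s' (T ∪ T') T = t := by
      by_cases hnT : none ∈ T
      · obtain ⟨j, hjτ, hjt⟩ := hτ hnT
        refine hj'.left.eq_of_mem hj.left (a := Sum.inr j) ⟨?_, hnT⟩ hjt
        have g := graftVert_path s' ⟨T ∪ T', F.mem_join h, Or.inl hnT⟩
        simp only at g
        rw [g, inr_mem_grow, hs' _ h.notMem]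
        exact hjτ
      · exact single h.left.1 hnT hj'.left hj.left Set.inter_subset_right ht
    refine ⟨s', ?_⟩
    subst et et'
    subst hr
    rfl

/-- The new vertex is the first letter on both sides, since `o₁` precedes `o₂` in the composition;
no sign occurs. -/
theorem of_graftInner_join (x : InnerForest (Option I)) (h : IsJoin x.forest T T')
    (y : InnerForest J) (s : PathVert (x.forest.join h) → Tree y.forest) :
    Bess.of (graftInner (x.join h) y s) =
      Bess.of ((graftInner x y (restrictPath h s)).join (graft_isJoin h s)) := by
  have hu := (graft_join_split h s).2.2.2
  refine Bess.of_congr (graft_join_eq h s) ?_ ?_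
  · simp only [graftInner, InnerForest.join, graftGlob, List.map_cons, Option.map_some, hu,
      List.cons_append]
    congr 2
    refine List.map_congr_left fun a ha => ?_
    rcases (x.glob.mem_iff a).1 ha with rfl | ⟨v, hv, rfl⟩
    · rfl
    · simp only [Option.map_some]
      exact congrArg some (graftVert_join h s hv)
  · funext w
    have hne : ∀ w ∈ (graft x.forest y.forest (restrictPath h s)).verts,
        w ≠ graftVert (x.forest.join h) y.forest s (T ∪ T') := by
      rintro w hw rfl
      exact graft_join_not_subset h s hw subset_rfl
    simp only [InnerForest.join, hu]
    by_cases hw : w ∈ (graft (x.forest.join h) y.forest s).verts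
    · rcases Finset.mem_insert.1 ((graft_join_verts h s).subset hw) with rfl | hw
      · rw [Function.update_self]
        refine (graftLoc_left s (x.join h).loc y.loc (x.forest.mem_join h)).trans ?_
        simp [InnerForest.join]
      · rw [Function.update_of_ne (hne w hw)]
        rcases Finset.mem_union.1 hw with hw | hw
        · obtain ⟨v, hv, rfl⟩ := Finset.mem_image.1 hw
          have hvne : v ≠ T ∪ T' := by
            rintro rfl
            exact h.notMem hv
          simp only [graftInner]
          rw [graftLoc_left _ _ _ hv, ← graftVert_join h s hv]
          refine (graftLoc_left s (x.join h).loc y.loc (x.forest.verts_subset_join h hv)).trans ?_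
          simp only [InnerForest.join, Function.update_of_ne hvne]
          refine List.map_congr_left fun a _ => ?_
          congr 1
          funext A
          exact graftBranch_join h s hv A
        · obtain ⟨u, hu, rfl⟩ := Finset.mem_image.1 hw
          exact (graftLoc_right s (x.join h).loc y.loc hu).trans
            (graftLoc_right (restrictPath h s) x.loc y.loc hu).symm
    · rw [Function.update_of_ne, InnerForest.loc_off, InnerForest.loc_off]
      · intro hw'
        exact hw ((graft_join_verts h s).symm.subset (Finset.mem_insert_of_mem hw'))
      · exact hw
      · rintro rfl
        exact hw ((graft_join_verts h s).symm.subset (Finset.mem_insert_self _ _))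

variable [Finite I] [Finite J] [Nonempty J]

theorem Bess.comp_join_of_notMem (x : InnerForest (Option I)) (h : IsJoin x.forest T T')
    (hn : none ∉ T') (y : InnerForest J) :
    Bess.comp I J (Bess.of (x.join h)) (Bess.of y) =
      Bess.joins (collapse ⁻¹' T) (collapse ⁻¹' T') (Bess.comp I J (Bess.of x) (Bess.of y)) := by
  rw [Bess.comp_of, Bess.comp_of, map_smul, map_sum]
  simp only [Bess.joins_of]
  congr 1
  rw [← Fintype.sum_sigma']
  exact Fintype.sum_bijective _ (graft_join_bijective h hn) _ _ fun s => of_graftInner_join x h y s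

/-- If `⋆` lies in `T'`, the two trees are exchanged, which changes the sign of both sides. -/
theorem Bess.comp_join (x : InnerForest (Option I)) (h : IsJoin x.forest T T')
    (y : InnerForest J) :
    Bess.comp I J (Bess.of (x.join h)) (Bess.of y) =
      Bess.joins (collapse ⁻¹' T) (collapse ⁻¹' T') (Bess.comp I J (Bess.of x) (Bess.of y)) := by
  by_cases hn : none ∈ T'
  · have hn' : none ∉ T := fun h' => Set.disjoint_left.1 h.disjoint h' hn
    rw [← neg_eq_iff_eq_neg.2 (Bess.of_join_symm x h), map_neg, LinearMap.neg_apply,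
      Bess.comp_join_of_notMem x h.symm hn' y, Bess.joins_symm, neg_neg]
  · exact Bess.comp_join_of_notMem x h hn y

/-- The composition commutes with the join operators on the left. -/
theorem Bess.comp_joins (x : InnerForest (Option I)) {A B : Set (Option I)}
    (hA : Saturated x.forest A) (hB : Saturated x.forest B) (hAB : Disjoint A B) (y : Bess J) :
    Bess.comp I J (Bess.joins A B (Bess.of x)) y =
      Bess.joins (collapse ⁻¹' A) (collapse ⁻¹' B) (Bess.comp I J (Bess.of x) y) := by
  suffices Bess.comp I J (Bess.joins A B (Bess.of x)) =
      Bess.joins (collapse ⁻¹' A) (collapse ⁻¹' B) ∘ₗ Bess.comp I J (Bess.of x) from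
    LinearMap.congr_fun this y
  refine Bess.hom_ext fun y => ?_
  rw [LinearMap.comp_apply, Bess.joins_of, map_sum, LinearMap.sum_apply]
  simp only [Bess.comp_join]
  rw [Bess.comp_of]
  simp only [map_smul, map_sum]
  rw [← Finset.smul_sum, Finset.sum_comm]
  congr 1
  refine Finset.sum_congr rfl fun s _ => ?_
  exact (Bess.joins_eq_sum collapse x.forest hA hB hAB _ fun w hw => graft_node_over s hw).symm

end GraftJoin

/-! ### Composition of a discrete forest with a forest -/

section DiscreteComp

variable {I J : Type u}

instance : IsEmpty (PathVert (Forest.discrete (Option I))) :=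
  ⟨fun v => Finset.notMem_empty _ v.2.1⟩

instance : IsEmpty (PathVert (discreteInner (Option I)).forest) :=
  ⟨fun v => Finset.notMem_empty _ v.2.1⟩

variable {F₂ : Forest J} (s : PathVert (Forest.discrete (Option I)) → Tree F₂)

theorem graft_discrete_verts :
    (graft (Forest.discrete (Option I)) F₂ s).verts = F₂.verts.image fun u => Sum.inr '' u := by
  change Finset.image _ ∅ ∪ _ = _
  simp

theorem graft_discrete_node {A : Set J} :
    IsNode (graft (Forest.discrete (Option I)) F₂ s).verts (Sum.inr '' A) ↔ IsNode F₂.verts A := by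
  refine ⟨?_, fun h => graft_node_right s h⟩
  rintro (h | ⟨a, ha⟩)
  · rw [graft_discrete_verts, Finset.mem_image] at h
    obtain ⟨u, hu, e⟩ := h
    exact Or.inl (Sum.inr_injective.image_injective e ▸ hu)
  · have : a ∈ Sum.inr '' A := ha ▸ rfl
    obtain ⟨j, -, rfl⟩ := this
    exact Or.inr ⟨j, Sum.inr_injective.image_injective (by simpa using ha)⟩

theorem graft_discrete_tree {A : Set J} :
    (graft (Forest.discrete (Option I)) F₂ s).IsTree (Sum.inr '' A) ↔ F₂.IsTree A := by
  constructor
  · rintro ⟨h1, h2⟩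
    refine ⟨(graft_discrete_node s).1 h1, fun N hN hA => ?_⟩
    exact Sum.inr_injective.image_injective
      (h2 _ ((graft_discrete_node s).2 hN) (Set.image_mono hA))
  · rintro ⟨h1, h2⟩
    refine ⟨(graft_discrete_node s).2 h1, fun N hN hA => ?_⟩
    obtain ⟨a, ha⟩ := F₂.node_nonempty h1
    have haN : Sum.inr a ∈ N := hA ⟨a, ha, rfl⟩
    have hN' : ∃ M : Set J, Sum.inr '' M = N := by
      rcases hN with hN | ⟨b, rfl⟩
      · rw [graft_discrete_verts, Finset.mem_image] at hN
        obtain ⟨u, -, e⟩ := hN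
        exact ⟨u, e⟩
      · exact ⟨{a}, by simpa using haN⟩
    obtain ⟨M, rfl⟩ := hN'
    rw [h2 M ((graft_discrete_node s).1 hN)
      ((Set.image_subset_image_iff Sum.inr_injective).1 hA)]

theorem graft_discrete_isJoin {A B : Set J} :
    IsJoin (graft (Forest.discrete (Option I)) F₂ s) (Sum.inr '' A) (Sum.inr '' B) ↔
      IsJoin F₂ A B := by
  constructor
  · rintro ⟨h1, h2, h3⟩
    exact ⟨(graft_discrete_tree s).1 h1, (graft_discrete_tree s).1 h2, fun h => h3 (h ▸ rfl)⟩
  · rintro ⟨h1, h2, h3⟩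
    exact ⟨(graft_discrete_tree s).2 h1, (graft_discrete_tree s).2 h2,
      fun h => h3 (Sum.inr_injective.image_injective h)⟩

theorem graft_discrete_saturated {A : Set J} (hA : Saturated F₂ A) :
    Saturated (graft (Forest.discrete (Option I)) F₂ s) (Sum.inr '' A) := by
  intro w hw
  rw [graft_discrete_verts, Finset.mem_image] at hw
  obtain ⟨u, hu, rfl⟩ := hw
  exact (hA u hu).imp Set.image_mono fun h => (Set.disjoint_image_iff Sum.inr_injective).2 h

variable (I) in
/-- The composition of the forest without inner vertex with an inner-oriented forest. -/
abbrev addLeaves (y : InnerForest J) : InnerForest (I ⊕ J) :=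
  graftInner (discreteInner (Option I)) y fun v => isEmptyElim v

/-- The path from `⋆` has no inner vertex, so there is only the empty choice, and the leaves of `I`
are added as separate trees. -/
theorem Bess.discrete_comp_of [Finite J] (y : InnerForest J) :
    Bess.comp I J (Bess.discrete (Option I)) (Bess.of y) =
      (-1 : ℚ) ^ beforeR y.glob.word • Bess.of (addLeaves I y) := by
  rw [Bess.discrete, Bess.comp_of]
  congr 1
  exact Fintype.sum_subsingleton _ _

/-- Composition puts `R` before the vertices of `y`, whereas a join puts the new vertex before `R`:
the two orientations differ by one transposition. -/
theorem of_addLeaves_join (y : InnerForest J) {T T' : Set J} (h : IsJoin y.forest T T') :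
    Bess.of (addLeaves I (y.join h)) = -Bess.of ((addLeaves I y).join
      ((graft_discrete_isJoin (I := I) _).2 h)) := by
  have hv := graft_discrete_verts (I := I) (F₂ := (y.join h).forest) fun v => isEmptyElim v
  have hv' := graft_discrete_verts (I := I) (F₂ := y.forest) fun v => isEmptyElim v
  have hi : (Sum.inr '' (T ∪ T') : Set (I ⊕ J)) = Sum.inr '' T ∪ Sum.inr '' T' :=
    Set.image_union _ _ _
  rw [eq_neg_iff_add_eq_zero]
  refine Bess.of_flip ⟨Forest.ext ?_, Or.inl ⟨⟨[], none, some (Sum.inr '' T ∪ Sum.inr '' T'),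
    (eraseR y.glob.word).map (Option.map fun u => Sum.inr '' u), ?_, ?_⟩, ?_⟩⟩
  · refine hv.trans ?_
    simp only [InnerForest.join, Forest.join, Finset.image_insert, hi]
    congr 1
    exact hv'.symm
  · simp [addLeaves, graftInner, graftGlob, discreteInner, InnerForest.join, eraseR, hi]
  · simp [addLeaves, graftInner, graftGlob, discreteInner, InnerForest.join, eraseR]
  · funext w
    by_cases hw : w ∈ (addLeaves I (y.join h)).forest.verts
    · have hw' := hw
      simp only [addLeaves, graftInner, discreteInner] at hw'
      rw [hv, Finset.mem_image] at hw'
      obtain ⟨u, hu, rfl⟩ := hw'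
      refine (graftLoc_right _ _ (y.join h).loc hu).trans ?_
      simp only [InnerForest.join]
      rcases Finset.mem_insert.1 hu with rfl | hu
      · rw [hi]
        simp
      · have hne : u ≠ T ∪ T' := by
          rintro rfl
          exact h.notMem hu
        rw [Function.update_of_ne hne, Function.update_of_ne]
        · exact (graftLoc_right _ _ y.loc hu).symm
        · rw [← hi]
          exact fun e => hne (Sum.inr_injective.image_injective e)
    · rw [InnerForest.loc_off _ _ hw, InnerForest.loc_off]
      intro hw'
      refine hw (hv.symm.subset ?_)
      simp only [InnerForest.join, Forest.join, Finset.image_insert, hi]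
      refine (Finset.mem_insert.1 hw').elim (fun e => e ▸ Finset.mem_insert_self _ _) fun h' => ?_
      exact Finset.mem_insert_of_mem (hv'.subset h')

/-- The sign in `of_addLeaves_join` cancels against the one from `beforeR`, which grows by one when
a vertex is put in front of the word of `y`. -/
theorem Bess.discrete_comp_joins [Finite I] [Finite J] (A B : Set J) (z : Bess J) :
    Bess.comp I J (Bess.discrete (Option I)) (Bess.joins A B z) =
      Bess.joins (Sum.inr '' A) (Sum.inr '' B) (Bess.comp I J (Bess.discrete (Option I)) z) := by
  suffices Bess.comp I J (Bess.discrete (Option I)) ∘ₗ Bess.joins A B =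
      Bess.joins (Sum.inr '' A) (Sum.inr '' B) ∘ₗ Bess.comp I J (Bess.discrete (Option I)) from
    LinearMap.congr_fun this z
  refine Bess.hom_ext fun y => ?_
  rw [LinearMap.comp_apply, LinearMap.comp_apply, Bess.joins_of, map_sum,
    Bess.discrete_comp_of, map_smul, Bess.joins_of, Finset.smul_sum]
  refine Fintype.sum_bijective
    (fun P : JoinPair y.forest A B =>
      (⟨(Sum.inr '' P.1.1, Sum.inr '' P.1.2), (graft_discrete_isJoin _).2 P.2.1,
        Set.image_mono P.2.2.1, Set.image_mono P.2.2.2⟩ :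
        JoinPair (addLeaves I y).forest (Sum.inr '' A) (Sum.inr '' B)))
    ⟨?_, ?_⟩ _ _ fun P => ?_
  · rintro ⟨⟨S, S'⟩, h⟩ ⟨⟨T, T'⟩, h'⟩ he
    simp only [Subtype.mk.injEq, Prod.mk.injEq] at he ⊢
    exact ⟨Sum.inr_injective.image_injective he.1, Sum.inr_injective.image_injective he.2⟩
  · rintro ⟨⟨S, S'⟩, h, hS, hS'⟩
    obtain ⟨T, hT, rfl⟩ := Set.subset_image_iff.1 hS
    obtain ⟨T', hT', rfl⟩ := Set.subset_image_iff.1 hS'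
    exact ⟨⟨(T, T'), (graft_discrete_isJoin _).1 h, hT, hT'⟩, rfl⟩
  · rw [Bess.discrete_comp_of, of_addLeaves_join]
    have : beforeR (y.join P.2.1).glob.word = beforeR y.glob.word + 1 := by
      simp [beforeR, InnerForest.join]
    rw [this, pow_succ]
    simp

end DiscreteComp

/-! ## The coproduct is a morphism of operads -/

section Operad

variable {I J K : Type u}

theorem tensor_induction {P : Bess I ⊗[ℚ] Bess K → Prop} (add : ∀ X Y, P X → P Y → P (X + Y))
    (smul : ∀ (c : ℚ) X, P X → P (c • X))
    (tmul : ∀ (x : InnerForest I) (y : InnerForest K), P (Bess.of x ⊗ₜ Bess.of y))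
    (X : Bess I ⊗[ℚ] Bess K) : P X := by
  induction X using TensorProduct.induction_on with
  | zero =>
    have := smul 0 _ (tmul (discreteInner I) (discreteInner K))
    rwa [zero_smul] at this
  | add X Y hX hY => exact add X Y hX hY
  | tmul a b =>
    induction a using Bess.induction with
    | add a a' h h' => rw [TensorProduct.add_tmul]; exact add _ _ h h'
    | smul c a h => rw [← TensorProduct.smul_tmul']; exact smul _ _ h
    | of x =>
      induction b using Bess.induction with
      | add a a' h h' => rw [TensorProduct.tmul_add]; exact add _ _ h h'
      | smul c a h => rw [TensorProduct.tmul_smul]; exact smul _ _ h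
      | of y => exact tmul x y

theorem Gamma.forest_eq_discrete {V : Finset (Set I)} (hV : V = ∅) {F : Forest I}
    (p : Gamma F V) : p.forest = Forest.discrete I := by
  refine Forest.eq_discrete ?_
  subst hV
  rw [p.verts_eq, Finset.image_empty]

theorem discrete_isTree (i : I) : (Forest.discrete I).IsTree {i} := by
  refine ⟨Or.inr ⟨i, rfl⟩, ?_⟩
  rintro N (hN | ⟨j, rfl⟩) h
  · exact absurd hN (Finset.notMem_empty _)
  · rw [Set.singleton_subset_singleton] at h
    rw [h]

theorem discrete_isJoin {i j : I} (hij : i ≠ j) : IsJoin (Forest.discrete I) {i} {j} :=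
  ⟨discrete_isTree i, discrete_isTree j, fun h => hij (Set.singleton_injective h)⟩

theorem Bess.sign_discrete : Bess.sign I (Bess.discrete I) = Bess.discrete I := by
  rw [Bess.discrete, Bess.sign_of]
  simp [discreteInner, Forest.discrete]

/-- The only splitting is the empty one, `γ` consists of the discrete forest alone, and `R' ∧ r ∧
R''` is compatible with `R`. -/
theorem coproduct_discrete [Finite I] :
    coproduct I (Bess.discrete I) = Bess.discrete I ⊗ₜ Bess.discrete I := by
  have hg : ∀ {V : Finset (Set I)} (hV : V = ∅) (o : GlobalOrientation V), o.word = [none] →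
      gammaSum (discreteInner I) o = Bess.discrete I := by
    intro V hV o ho
    subst hV
    let p : Gamma (discreteInner I).forest ∅ := ⟨Forest.discrete I,
      { toFun := id
        injective := Function.injective_id
        increasing := fun _ _ h => h
        leaves := fun _ _ h => h
        branches := fun v A B h => ⟨A, B, h, subset_rfl, subset_rfl⟩ },
      fun v => ⟨fun h => absurd h (Finset.notMem_empty v),
        fun ⟨w, _⟩ => absurd w.2 (Finset.notMem_empty _)⟩⟩
    have : Subsingleton (Gamma (discreteInner I).forest ∅) := ⟨fun p q =>
      Gamma.forest_injective _ ((Gamma.forest_eq_discrete rfl p).trans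
        (Gamma.forest_eq_discrete rfl q).symm)⟩
    rw [gammaSum, Fintype.sum_subsingleton _ p]
    refine Bess.of_congr rfl ?_ ?_
    · simp [gammaInner, GlobalOrientation.map, ho, discreteInner]
    · funext w
      exact InnerForest.loc_off _ w (Finset.notMem_empty w)
  have hs : IsWord (∅ : Finset (Set I)) [none] := ⟨by simp, by simp⟩
  have hs' : IsWord ((discreteInner I).forest.verts \ ∅) [none] := hs
  have ht := splitTerm_eq (c := 1) (discreteInner I) (Finset.empty_subset _)
    ⟨[none], hs.1, hs.2⟩ ⟨[none], hs'.1, hs'.2⟩ (by rw [one_smul]; rfl)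
  rw [one_smul] at ht
  conv_lhs => rw [Bess.discrete, coproduct_of]
  exact (Finset.sum_singleton _ _).trans (ht.trans
    (congrArg₂ (fun a b => a ⊗ₜ[ℚ] b) (hg rfl _ rfl) (hg Finset.sdiff_empty _ rfl)))

/-- The sign compares `R ∧ v`, the orientation of `Ω`, with `v ∧ R`, that of a join. -/
theorem omega_eq [Finite I] {i j : I} (hij : i ≠ j) :
    Bess.omega i j hij = -Bess.joins {i} {j} (Bess.discrete I) := by
  have hi : ({i} ∪ {j} : Set I) = {i, j} := Set.singleton_union
  rw [Bess.discrete, Bess.joins_of_isJoin (discreteInner I) (discrete_isJoin hij),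
    eq_neg_iff_add_eq_zero]
  refine Bess.of_flip ⟨Forest.ext ?_, Or.inl ⟨⟨[], none, some {i, j}, [], rfl, ?_⟩, ?_⟩⟩
  · simp only [cherryInner, cherry, InnerForest.join, Forest.join, hi]
    rfl
  · simp [InnerForest.join, discreteInner]
  · funext w
    simp only [cherryInner, InnerForest.join, discreteInner, hi, Function.update_apply]

theorem coproduct_omega [Finite I] {i j : I} (hij : i ≠ j) :
    coproduct I (Bess.omega i j hij) =
      Bess.discrete I ⊗ₜ Bess.omega i j hij + Bess.omega i j hij ⊗ₜ Bess.discrete I := by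
  have h := coproduct_joins (discreteInner I) (discrete_isTree i).saturated
    (discrete_isTree j).saturated (discrete_isJoin hij).disjoint
  change coproduct I (Bess.joins {i} {j} (Bess.discrete I)) =
    tensorJoins {i} {j} (coproduct I (Bess.discrete I)) at h
  rw [omega_eq, map_neg, h, coproduct_discrete, tensorJoins_tmul, Bess.sign_discrete,
    TensorProduct.tmul_neg, TensorProduct.neg_tmul, neg_add, add_comm]

/-! ### Relabelling -/

theorem relabel_saturated (e : I ≃ K) {F : Forest I} {A : Set I} (hA : Saturated F A) :
    Saturated (F.relabel e) (e '' A) := by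
  intro w hw
  obtain ⟨v, hv, rfl⟩ := Finset.mem_image.1 hw
  exact (hA v hv).imp Set.image_mono fun h => (Set.disjoint_image_iff e.injective).2 h

theorem Bess.sign_relabel (e : I ≃ K) (z : Bess I) :
    Bess.sign K (Bess.relabel e z) = Bess.relabel e (Bess.sign I z) := by
  suffices Bess.sign K ∘ₗ Bess.relabel e = Bess.relabel e ∘ₗ Bess.sign I from
    LinearMap.congr_fun this z
  refine Bess.hom_ext fun x => ?_
  rw [LinearMap.comp_apply, LinearMap.comp_apply, Bess.relabel_of, Bess.sign_of, Bess.sign_of,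
    map_smul, Bess.relabel_of]
  congr 2
  exact Finset.card_image_of_injective _ e.injective.image_injective

theorem Bess.relabel_discrete (e : I ≃ K) :
    Bess.relabel e (Bess.discrete I) = Bess.discrete K := by
  rw [Bess.discrete, Bess.relabel_of]
  refine Bess.of_congr (Forest.ext ?_) rfl ?_
  · exact Finset.image_empty _
  · funext w
    refine InnerForest.loc_off _ w fun hw => ?_
    obtain ⟨v, hv, -⟩ := Finset.mem_image.1 hw
    exact Finset.notMem_empty v hv

/-- Relabelling respects joins and the degree, so it suffices to compare the two sides on the
discrete forest. -/
theorem coproduct_relabel [Finite I] [Finite K] (e : I ≃ K) (z : Bess I) :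
    coproduct K (Bess.relabel e z) =
      TensorProduct.map (Bess.relabel e) (Bess.relabel e) (coproduct I z) := by
  have key : ∀ (A B : Set I) (X : Bess I ⊗[ℚ] Bess I),
      TensorProduct.map (Bess.relabel e) (Bess.relabel e) (tensorJoins A B X) =
        tensorJoins (e '' A) (e '' B) (TensorProduct.map (Bess.relabel e) (Bess.relabel e) X) := by
    intro A B X
    induction X using TensorProduct.induction_on with
    | zero => simp
    | add X Y hX hY => simp only [map_add, hX, hY]
    | tmul a b =>
      simp only [tensorJoins_tmul, map_add, TensorProduct.map_tmul, Bess.relabel_joins,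
        Bess.sign_relabel]
  induction z using Bess.join_induction with
  | discrete =>
    rw [Bess.relabel_discrete, coproduct_discrete, coproduct_discrete, TensorProduct.map_tmul,
      Bess.relabel_discrete]
  | add x y hx hy => simp only [map_add, hx, hy]
  | smul c x hx => simp only [map_smul, hx]
  | join x A B h ih =>
    rw [coproduct_joins x h.left.saturated h.right.saturated h.disjoint, key, ← ih,
      Bess.relabel_joins, Bess.relabel_of]
    exact coproduct_joins _ (relabel_saturated e h.left.saturated)
      (relabel_saturated e h.right.saturated) ((Set.disjoint_image_iff e.injective).2 h.disjoint)

/-! ### Composition -/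

theorem graft_card {F : Forest (Option I)} {F₂ : Forest J} (s : PathVert F → Tree F₂) :
    (graft F F₂ s).verts.card = F.verts.card + F₂.verts.card := by
  change (F.verts.image (graftVert F F₂ s) ∪ F₂.verts.image fun u => Sum.inr '' u).card = _
  rw [Finset.card_union_of_disjoint, Finset.card_image_of_injOn (graftVert_injOn s),
    Finset.card_image_of_injective _ Sum.inr_injective.image_injective]
  rw [Finset.disjoint_left]
  intro w hw hw'
  obtain ⟨v, hv, rfl⟩ := Finset.mem_image.1 hw
  obtain ⟨u, -, e⟩ := Finset.mem_image.1 hw'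
  exact graftVert_ne s hv u e.symm

theorem Bess.sign_comp [Finite J] (x : InnerForest (Option I)) (y : InnerForest J) :
    Bess.sign (I ⊕ J) (Bess.comp I J (Bess.of x) (Bess.of y)) =
      (-1 : ℚ) ^ (x.forest.verts.card + y.forest.verts.card) •
        Bess.comp I J (Bess.of x) (Bess.of y) := by
  rw [Bess.comp_of, map_smul, map_sum, smul_comm]
  congr 1
  rw [Finset.smul_sum]
  refine Finset.sum_congr rfl fun s _ => ?_
  rw [Bess.sign_of]
  congr 2
  exact graft_card s

theorem Bess.sign_joins [Finite I] (A B : Set I) (x : InnerForest I) :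
    Bess.sign I (Bess.joins A B (Bess.of x)) =
      (-1 : ℚ) ^ (x.forest.verts.card + 1) • Bess.joins A B (Bess.of x) := by
  rw [Bess.joins_of, map_sum, Finset.smul_sum]
  refine Finset.sum_congr rfl fun P _ => ?_
  rw [Bess.sign_of]
  congr 2
  exact card_join P.2.1

theorem Bess.oddPart_of_sign {z : Bess I} {k : ℕ} (h : Bess.sign I z = (-1 : ℚ) ^ k • z) :
    (2 : ℚ) • Bess.oddPart I z = z - (-1 : ℚ) ^ k • z := by
  rw [← h, Bess.sign, LinearMap.sub_apply, LinearMap.smul_apply, LinearMap.id_apply, sub_sub_cancel]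

theorem tensorComp_add_left [Finite J] (X X' : Bess (Option I) ⊗[ℚ] Bess (Option I))
    (Y : Bess J ⊗[ℚ] Bess J) :
    tensorComp I J (X + X') Y = tensorComp I J X Y + tensorComp I J X' Y := by
  simp only [tensorComp, map_add, LinearMap.add_apply, smul_add]
  abel

theorem tensorComp_smul_left [Finite J] (c : ℚ) (X : Bess (Option I) ⊗[ℚ] Bess (Option I))
    (Y : Bess J ⊗[ℚ] Bess J) : tensorComp I J (c • X) Y = c • tensorComp I J X Y := by
  simp only [tensorComp, map_smul, LinearMap.smul_apply, smul_sub, smul_comm c (2 : ℚ)]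

theorem tensorComp_add_right [Finite J] (X : Bess (Option I) ⊗[ℚ] Bess (Option I))
    (Y Y' : Bess J ⊗[ℚ] Bess J) :
    tensorComp I J X (Y + Y') = tensorComp I J X Y + tensorComp I J X Y' := by
  simp only [tensorComp, map_add, smul_add]
  abel

theorem tensorComp_smul_right [Finite J] (c : ℚ) (X : Bess (Option I) ⊗[ℚ] Bess (Option I))
    (Y : Bess J ⊗[ℚ] Bess J) : tensorComp I J X (c • Y) = c • tensorComp I J X Y := by
  simp only [tensorComp, map_smul, smul_sub, smul_comm c (2 : ℚ)]

/-- Only the parity of `a'` matters for the Koszul sign. Its eigenvalue equation under `Bess.sign`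
is assumed instead of the form `o ⊗ F`, so that `a'` may be a sum of joins. -/
theorem tensorComp_tmul [Finite J] {a a' : Bess (Option I)} {k : ℕ}
    (h : Bess.sign (Option I) a' = (-1 : ℚ) ^ k • a') (y : InnerForest J) (b' : Bess J) :
    tensorComp I J (a ⊗ₜ a') (Bess.of y ⊗ₜ b') = (-1 : ℚ) ^ (k * y.forest.verts.card) •
      Bess.comp I J a (Bess.of y) ⊗ₜ Bess.comp I J a' b' := by
  have e : tensorComp I J (a ⊗ₜ a') (Bess.of y ⊗ₜ b') =
      Bess.comp I J a (Bess.of y) ⊗ₜ Bess.comp I J a' b' -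
        Bess.comp I J a (Bess.oddPart J (Bess.of y)) ⊗ₜ
          Bess.comp I J ((2 : ℚ) • Bess.oddPart (Option I) a') b' := by
    simp only [tensorComp, TensorProduct.map_tmul, TensorProduct.map₂_apply_tmul,
      LinearMap.id_apply, map_smul, LinearMap.smul_apply, TensorProduct.tmul_smul]
  rw [e, Bess.oddPart_of, Bess.oddPart_of_sign h]
  split_ifs with hy
  · rcases Nat.even_or_odd k with hk | hk
    · rw [hk.neg_one_pow, (hk.mul_right _).neg_one_pow]
      simp
    · rw [hk.neg_one_pow, (hk.mul hy).neg_one_pow,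
        show a' - (-1 : ℚ) • a' = (2 : ℚ) • a' by module, map_smul, LinearMap.smul_apply,
        TensorProduct.tmul_smul]
      module
  · rw [((Nat.not_odd_iff_even.1 hy).mul_left _).neg_one_pow]
    simp

theorem tensorComp_discrete [Finite J] (b b' : Bess J) :
    tensorComp I J (Bess.discrete (Option I) ⊗ₜ Bess.discrete (Option I)) (b ⊗ₜ b') =
      Bess.comp I J (Bess.discrete (Option I)) b ⊗ₜ Bess.comp I J (Bess.discrete (Option I)) b' := by
  induction b using Bess.induction with
  | of y =>
    rw [tensorComp_tmul (k := 0)]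
    · simp
    · rw [Bess.sign_discrete]
      simp
  | add x y hx hy => rw [TensorProduct.add_tmul, tensorComp_add_right, hx, hy, map_add,
      TensorProduct.add_tmul]
  | smul c x hx => rw [← TensorProduct.smul_tmul', tensorComp_smul_right, hx, map_smul,
      TensorProduct.smul_tmul']

theorem Bess.sign_discrete_comp [Finite J] (b : Bess J) :
    Bess.sign (I ⊕ J) (Bess.comp I J (Bess.discrete (Option I)) b) =
      Bess.comp I J (Bess.discrete (Option I)) (Bess.sign J b) := by
  suffices Bess.sign (I ⊕ J) ∘ₗ Bess.comp I J (Bess.discrete (Option I)) =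
      Bess.comp I J (Bess.discrete (Option I)) ∘ₗ Bess.sign J from LinearMap.congr_fun this b
  refine Bess.hom_ext fun y => ?_
  rw [LinearMap.comp_apply, LinearMap.comp_apply, Bess.discrete, Bess.sign_comp, Bess.sign_of,
    map_smul]
  simp [discreteInner, Forest.discrete]

theorem tensorComp_discrete_tensorJoins [Finite I] [Finite J] (A B : Set J) (Y : Bess J ⊗[ℚ] Bess J) :
    tensorComp I J (Bess.discrete (Option I) ⊗ₜ Bess.discrete (Option I)) (tensorJoins A B Y) =
      tensorJoins (Sum.inr '' A) (Sum.inr '' B)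
        (tensorComp I J (Bess.discrete (Option I) ⊗ₜ Bess.discrete (Option I)) Y) := by
  induction Y using tensor_induction with
  | add X Y hX hY => simp only [map_add, tensorComp_add_right, hX, hY]
  | smul c X hX => simp only [map_smul, tensorComp_smul_right, hX]
  | tmul y y' =>
    simp only [tensorJoins_tmul, tensorComp_add_right, tensorComp_discrete,
      Bess.discrete_comp_joins, Bess.sign_discrete_comp]

/-- When the join acts on `z'`, the degree of `z'` rises by one and the Koszul sign with `y` gains
`(-1) ^ deg y`. The derivation on the composed side passes the join over `z ∘ y` instead of `z`,
which yields the same factor. -/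
theorem tensorComp_tensorJoins [Finite I] [Finite J] [Nonempty J] (z z' : InnerForest (Option I)) {A B : Set (Option I)}
    (hA : Saturated z.forest A) (hB : Saturated z.forest B) (hA' : Saturated z'.forest A)
    (hB' : Saturated z'.forest B) (hAB : Disjoint A B) (Y : Bess J ⊗[ℚ] Bess J) :
    tensorComp I J (tensorJoins A B (Bess.of z ⊗ₜ Bess.of z')) Y =
      tensorJoins (collapse ⁻¹' A) (collapse ⁻¹' B)
        (tensorComp I J (Bess.of z ⊗ₜ Bess.of z') Y) := by
  induction Y using tensor_induction with
  | add X Y hX hY => simp only [map_add, tensorComp_add_right, hX, hY]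
  | smul c X hX => simp only [map_smul, tensorComp_smul_right, hX]
  | tmul y y' =>
    rw [tensorJoins_tmul, tensorComp_add_left, tensorComp_tmul (Bess.sign_of z'),
      tensorComp_tmul (Bess.sign_joins A B z'), tensorComp_tmul (Bess.sign_of z'), map_smul,
      tensorJoins_tmul, Bess.comp_joins z hA hB hAB, Bess.comp_joins z' hA' hB' hAB,
      Bess.sign_comp, Bess.sign_of, map_smul, LinearMap.smul_apply, smul_add,
      ← TensorProduct.smul_tmul', ← TensorProduct.smul_tmul', smul_smul, smul_smul]
    congr 2
    ring

/-- The preimages of `A` and `B` are unions of trees in every term of the composition, so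
`coproduct_joins` applies to each term. -/
theorem coproduct_joins_comp [Finite I] [Finite J] (x : InnerForest (Option I)) {A B : Set (Option I)}
    (hA : Saturated x.forest A) (hB : Saturated x.forest B) (hAB : Disjoint A B) (y : Bess J) :
    coproduct (I ⊕ J) (Bess.joins (collapse ⁻¹' A) (collapse ⁻¹' B)
        (Bess.comp I J (Bess.of x) y)) =
      tensorJoins (collapse ⁻¹' A) (collapse ⁻¹' B)
        (coproduct (I ⊕ J) (Bess.comp I J (Bess.of x) y)) := by
  induction y using Bess.induction with
  | add x y hx hy => simp only [map_add, hx, hy]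
  | smul c x hx => simp only [map_smul, hx]
  | of y =>
    rw [Bess.comp_of]
    simp only [map_smul, map_sum]
    congr 1
    refine Finset.sum_congr rfl fun s _ => ?_
    exact coproduct_joins _ (graft_saturated s hA) (graft_saturated s hB) (hAB.preimage _)

theorem Bess.discrete_comp_discrete [Finite J] :
    Bess.comp I J (Bess.discrete (Option I)) (Bess.discrete J) = Bess.discrete (I ⊕ J) := by
  have h : Bess.comp I J (Bess.discrete (Option I)) (Bess.discrete J) =
      Bess.of (addLeaves I (discreteInner J)) := by
    rw [Bess.discrete, Bess.discrete, ← Bess.discrete, Bess.discrete_comp_of]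
    simp [discreteInner, beforeR]
  rw [h]
  have hv : (addLeaves I (discreteInner J)).forest.verts = ∅ := graft_discrete_verts _
  refine Bess.of_congr (Forest.ext hv) ?_ ?_
  · simp [addLeaves, graftInner, graftGlob, discreteInner, eraseR]
  · funext w
    rw [InnerForest.loc_off]
    · rfl
    · rw [hv]
      exact Finset.notMem_empty w

/-- Joins of `x` pass through the composition and the coproduct on both sides, which leaves discrete
`x`; joins of `y` then do the same, which leaves two discrete forests. -/
theorem coproduct_comp [Finite I] [Finite J] [Nonempty J] (x : Bess (Option I)) (y : Bess J) :
    coproduct (I ⊕ J) (Bess.comp I J x y) =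
      tensorComp I J (coproduct (Option I) x) (coproduct J y) := by
  induction x using Bess.join_induction with
  | add x x' hx hx' => simp only [map_add, LinearMap.add_apply, hx, hx', tensorComp_add_left]
  | smul c x hx => simp only [map_smul, LinearMap.smul_apply, hx, tensorComp_smul_left]
  | discrete =>
    rw [coproduct_discrete]
    induction y using Bess.join_induction with
    | add x x' hx hx' => simp only [map_add, hx, hx', tensorComp_add_right]
    | smul c x hx => simp only [map_smul, hx, tensorComp_smul_right]
    | discrete =>
      rw [coproduct_discrete, tensorComp_discrete, Bess.discrete_comp_discrete, coproduct_discrete]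
    | join y A B h ih =>
      rw [coproduct_joins y h.left.saturated h.right.saturated h.disjoint,
        tensorComp_discrete_tensorJoins, ← ih, Bess.discrete_comp_joins, Bess.discrete_comp_of]
      simp only [map_smul]
      rw [coproduct_joins _ (graft_discrete_saturated _ h.left.saturated)
        (graft_discrete_saturated _ h.right.saturated)
        ((Set.disjoint_image_iff Sum.inr_injective).2 h.disjoint)]
  | join x A B h ih =>
    have hA := h.left.saturated
    have hB := h.right.saturated
    rw [Bess.comp_joins x hA hB h.disjoint, coproduct_joins_comp x hA hB h.disjoint, ih,
      coproduct_joins x hA hB h.disjoint]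
    -- The trees `A` and `B` of `x` may be broken up in the terms of its coproduct, but they remain
    -- unions of trees there.
    refine coproduct_of_induction x
      (P := fun X => tensorJoins (collapse ⁻¹' A) (collapse ⁻¹' B)
        (tensorComp I J X (coproduct J y)) =
          tensorComp I J (tensorJoins A B X) (coproduct J y)) ?_ ?_ ?_ ?_
    · simp [tensorComp]
    · intro X Y hX hY
      simp only [map_add, tensorComp_add_left, hX, hY]
    · intro c X hX
      simp only [map_smul, tensorComp_smul_left, hX]
    · intro z z' hz hz'
      exact (tensorComp_tensorJoins z z' (hz.saturated hA) (hz.saturated hB) (hz'.saturated hA)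
        (hz'.saturated hB) h.disjoint _).symm

end Operad

theorem isCoproduct_coproduct :
    IsCoproduct fun (I : Type u) [Finite I] [Nonempty I] => coproduct I where
  relabel _ _ _ _ _ _ e x := coproduct_relabel e x
  unit _ _ _ _ := coproduct_discrete
  comp _ _ _ _ _ x y := coproduct_comp x y
  gen_E _ _ _ _ := coproduct_discrete
  gen_omega _ _ _ _ _ _ hij := coproduct_omega hij

/-! ## Uniqueness of the coproduct -/

section Contract

variable {I K : Type u}

/-- Contraction of the minimal vertex `v` to a leaf. -/
def Forest.contract (F : Forest I) {v : Set I} (hv : v ∈ F.verts)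
    (hmin : ∀ w ∈ F.verts, w ⊆ v → w = v) (π : I → K) (k : K) (hk : ∀ a ∈ v, π a = k)
    (hπ : ∀ a b, π a = π b → a = b ∨ a ∈ v ∧ b ∈ v) : Forest K where
  verts := (F.verts.erase v).image fun w => π '' w
  nonempty := by
    intro U hU
    obtain ⟨w, hw, rfl⟩ := Finset.mem_image.1 hU
    exact (F.nonempty w (Finset.mem_of_mem_erase hw)).image π
  laminar := by
    intro U hU U' hU'
    obtain ⟨w, hw, rfl⟩ := Finset.mem_image.1 hU
    obtain ⟨w', hw', rfl⟩ := Finset.mem_image.1 hU'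
    rw [Finset.mem_erase] at hw hw'
    rcases F.laminar w hw.2 w' hw'.2 with h | h | h
    · exact Or.inl (Set.image_mono h)
    · exact Or.inr (Or.inl (Set.image_mono h))
    · refine Or.inr (Or.inr (Set.disjoint_left.2 ?_))
      rintro _ ⟨a, ha, rfl⟩ ⟨b, hb, hab⟩
      -- If the images meet at the contracted leaf, then `w` and `w'` both meet the minimal vertex
      -- `v`, hence both contain it, and cannot be disjoint.
      rcases hπ b a hab with rfl | ⟨hbv, hav⟩
      · exact Set.disjoint_left.1 h ha hb
      · rcases F.laminar v hv w hw.2 with h' | h' | h'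
        · rcases F.laminar v hv w' hw'.2 with h'' | h'' | h''
          · exact Set.disjoint_left.1 h (h' hav) (h'' hav)
          · exact hw'.1 (hmin w' hw'.2 h'')
          · exact Set.disjoint_left.1 h'' hbv hb
        · exact hw.1 (hmin w hw.2 h')
        · exact Set.disjoint_left.1 h' hav ha
  binary := by
    have node : ∀ N, IsNode F.verts N → IsNode ((F.verts.erase v).image fun w => π '' w) (π '' N) := by
      rintro N (hN | ⟨i, rfl⟩)
      · by_cases hNv : N = v
        · subst hNv
          obtain ⟨a, ha⟩ := F.nonempty N hN
          refine Or.inr ⟨k, Set.Subset.antisymm ?_ ?_⟩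
          · rintro _ ⟨b, hb, rfl⟩
            exact hk b hb
          · rintro _ rfl
            exact ⟨a, ha, hk a ha⟩
        · exact Or.inl (Finset.mem_image_of_mem _ (Finset.mem_erase.2 ⟨hNv, hN⟩))
      · exact Or.inr ⟨π i, Set.image_singleton⟩
    intro U hU
    obtain ⟨w, hw, rfl⟩ := Finset.mem_image.1 hU
    rw [Finset.mem_erase] at hw
    obtain ⟨A, B, hs⟩ := F.binary w hw.2
    have hAw : A ⊆ w := hs.2.2.2 ▸ Set.subset_union_left
    refine ⟨π '' A, π '' B, node A hs.1, node B hs.2.1, Set.disjoint_left.2 ?_, ?_⟩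
    · rintro _ ⟨a, ha, rfl⟩ ⟨b, hb, hab⟩
      rcases hπ b a hab with rfl | ⟨hbv, hav⟩
      · exact Set.disjoint_left.1 hs.2.2.1 ha hb
      · have hvw : v ⊆ w := by
          rcases F.laminar v hv w hw.2 with h' | h' | h'
          · exact h'
          · exact absurd (hmin w hw.2 h') hw.1
          · exact absurd (hAw ha) (Set.disjoint_left.1 h' hav)
        rcases F.node_sub_branch hs (Or.inl hv) hvw (fun e => hw.1 e.symm) with h' | h'
        · exact Set.disjoint_left.1 hs.2.2.1 (h' hbv) hb
        · exact Set.disjoint_left.1 hs.2.2.1 ha (h' hav)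
    · rw [← Set.image_union, hs.2.2.2]

/-- A remaining vertex contains `v` or is disjoint from it, so the contraction loses no information
about it. -/
theorem Forest.preimage_image_contract (F : Forest I) {v : Set I} (hv : v ∈ F.verts)
    (hmin : ∀ w ∈ F.verts, w ⊆ v → w = v) {π : I → K}
    (hπ : ∀ a b, π a = π b → a = b ∨ a ∈ v ∧ b ∈ v) {w : Set I} (hw : w ∈ F.verts.erase v) :
    π ⁻¹' (π '' w) = w := by
  rw [Finset.mem_erase] at hw
  refine Set.Subset.antisymm ?_ (Set.subset_preimage_image π w)
  rintro a ⟨b, hb, hab⟩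
  rcases hπ b a hab with rfl | ⟨hbv, hav⟩
  · exact hb
  · rcases F.laminar v hv w hw.2 with h' | h' | h'
    · exact h' hav
    · exact absurd (hmin w hw.2 h') hw.1
    · exact absurd hb (Set.disjoint_left.1 h' hbv)

end Contract

/-! ### Decomposition into generators and induction on the number of leaves -/

section Unique

variable {I J : Type u}

/-- Composition with a tree is substitution. -/
theorem graftVert_of_tree {F : Forest (Option I)} {F₂ : Forest J} (s : PathVert F → Tree F₂)
    (hF₂ : ∀ T : Tree F₂, T.1 = Set.univ) {v : Set (Option I)} (hv : v ∈ F.verts) :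
    graftVert F F₂ s v = collapse ⁻¹' v := by
  by_cases hn : none ∈ v
  · refine Set.Subset.antisymm (graftVert_subset s v) ?_
    have e := graftVert_path s ⟨v, hv, hn⟩
    simp only at e
    rw [e]
    rintro (i | j) hx
    · obtain ⟨u, hu, hi⟩ := exists_mem_side (⟨v, hv, hn⟩ : PathVert F) hx
      exact (inl_mem_grow s _ i).2 ⟨u, hu, Subtype.ext ((hF₂ _).trans (hF₂ _).symm), hi⟩
    · rw [inr_mem_grow, hF₂]
      trivial
  · exact graftVert_of_notMem s hn

theorem cherry_tree {i j : J} (hij : i ≠ j) (hJ : ({i, j} : Set J) = Set.univ)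
    (T : Tree (cherry i j hij)) : T.1 = Set.univ := by
  rw [← hJ]
  refine (T.2.2 {i, j} (Or.inl (Finset.mem_singleton_self _)) ?_).symm
  rw [hJ]
  exact Set.subset_univ _

/-- The decomposition of the leaves in the complement of `v` and `v`. -/
def splitLeaves (v : Set I) : ↥(vᶜ) ⊕ ↥v ≃ I := (Equiv.sumComm _ _).trans (Equiv.Set.sumCompl v)

theorem splitLeaves_inl (v : Set I) (i : ↥(vᶜ)) : splitLeaves v (Sum.inl i) = i := by
  simp [splitLeaves]

theorem splitLeaves_inr (v : Set I) (j : v) : splitLeaves v (Sum.inr j) = j := by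
  simp [splitLeaves]

/-- A forest with an inner vertex is the composition of a smaller forest with a tree with one
inner vertex. -/
theorem exists_comp_omega [Finite I] (x : InnerForest I) (hx : x.forest.verts.Nonempty) :
    ∃ (v : Set I) (i j : v) (hij : i ≠ j) (a : InnerForest (Option ↥(vᶜ))) (ε : ℚ),
      ({i, j} : Set v) = Set.univ ∧ Bess.of x = ε •
        Bess.relabel (splitLeaves v) (Bess.comp ↥(vᶜ) ↥v (Bess.of a) (Bess.omega i j hij)) := by
  obtain ⟨v, hv, hmin⟩ := Finset.exists_minimal hx
  have hmin : ∀ w ∈ x.forest.verts, w ⊆ v → w = v := fun w hw h => h.antisymm (hmin hw h)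
  obtain ⟨A, B, hs⟩ := x.forest.binary v hv
  -- A branch that is an inner vertex would contradict the minimality of `v`.
  have leaf : ∀ {A B : Set I}, IsSplit x.forest.verts v A B → ∃ i, A = {i} := by
    intro A B hs
    refine hs.1.resolve_left fun hA => ?_
    obtain ⟨b, hb⟩ := x.forest.node_nonempty hs.2.1
    have e : A = v := hmin A hA (hs.2.2.2 ▸ Set.subset_union_left)
    exact Set.disjoint_left.1 hs.2.2.1 (e ▸ hs.2.2.2 ▸ Or.inr hb) hb
  obtain ⟨i, rfl⟩ := leaf hs
  obtain ⟨j, rfl⟩ := leaf (Forest.split_symm hs)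
  have hv' : ∀ a, a ∈ v ↔ a = i ∨ a = j := by
    intro a
    rw [← hs.2.2.2]
    rfl
  have hij : (⟨i, (hv' i).2 (Or.inl rfl)⟩ : v) ≠ ⟨j, (hv' j).2 (Or.inr rfl)⟩ := by
    intro e
    exact Set.disjoint_left.1 hs.2.2.1 rfl (Subtype.mk.inj e)
  have huniv : ({⟨i, (hv' i).2 (Or.inl rfl)⟩, ⟨j, (hv' j).2 (Or.inr rfl)⟩} : Set v) =
      Set.univ := by
    refine Set.eq_univ_of_forall fun a => ?_
    rcases (hv' a.1).1 a.2 with h | h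
    · exact Or.inl (Subtype.ext h)
    · exact Or.inr (Subtype.ext h)
  let π : I → Option ↥(vᶜ) := fun a => collapse ((splitLeaves v).symm a)
  have hk : ∀ a ∈ v, π a = none := by
    intro a ha
    have : (splitLeaves v).symm a = Sum.inr ⟨a, ha⟩ := by
      rw [Equiv.symm_apply_eq, splitLeaves_inr]
    simp only [π, this]
    rfl
  have hk' : ∀ a (ha : a ∉ v), π a = some ⟨a, ha⟩ := by
    intro a ha
    have : (splitLeaves v).symm a = Sum.inl ⟨a, ha⟩ := by
      rw [Equiv.symm_apply_eq, splitLeaves_inl]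
    simp only [π, this]
    rfl
  have hπ : ∀ a b, π a = π b → a = b ∨ a ∈ v ∧ b ∈ v := by
    intro a b hab
    by_cases ha : a ∈ v <;> by_cases hb : b ∈ v
    · exact Or.inr ⟨ha, hb⟩
    · rw [hk a ha, hk' b hb] at hab
      cases hab
    · rw [hk' a ha, hk b hb] at hab
      cases hab
    · rw [hk' a ha, hk' b hb, Option.some.injEq] at hab
      exact Or.inl (Subtype.mk.inj hab)
  obtain ⟨a, ha⟩ := (x.forest.contract hv hmin π none hk hπ).exists_inner
  have htree := cherry_tree hij huniv
  -- The inserted forest is a single tree, so this choice is the only one and the composition has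
  -- one term.
  let s : PathVert a.forest → Tree (cherryInner _ _ hij).forest := fun _ =>
    ⟨{⟨i, (hv' i).2 (Or.inl rfl)⟩, ⟨j, (hv' j).2 (Or.inr rfl)⟩},
      Or.inl (Finset.mem_singleton_self _), fun N _ hN => Set.Subset.antisymm
        (huniv ▸ Set.subset_univ N) hN⟩
  have : Subsingleton (Tree (cherryInner _ _ hij).forest) :=
    ⟨fun T T' => Subtype.ext ((htree T).trans (htree T').symm)⟩
  have hcomp : Bess.comp ↥(vᶜ) ↥v (Bess.of a) (Bess.omega _ _ hij) =
      Bess.of (graftInner a (cherryInner _ _ hij) s) := by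
    rw [Bess.omega, Bess.comp_of, Fintype.sum_subsingleton _ s]
    simp [cherryInner, beforeR]
  -- Only the underlying forests have to be compared; all orientations of `a` and of the composition
  -- are absorbed in `ε`.
  obtain ⟨ε, -, hε⟩ := Bess.of_eq_smul_of (x := x)
    (y := (graftInner a (cherryInner _ _ hij) s).relabel (splitLeaves v)) <| by
    refine Forest.ext ?_
    change _ = Finset.image _ (Finset.image _ a.forest.verts ∪ Finset.image _ {_})
    rw [Finset.image_congr fun w hw => graftVert_of_tree s htree hw, ha]
    simp only [Forest.contract, Finset.image_union, Finset.image_image, Finset.image_singleton]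
    have e₁ : (x.forest.verts.erase v).image ((fun w => splitLeaves v '' w) ∘
        (fun w => collapse ⁻¹' w) ∘ fun w => π '' w) = x.forest.verts.erase v := by
      refine (Finset.image_congr (g := id) fun w hw => ?_).trans Finset.image_id
      have := x.forest.preimage_image_contract hv hmin hπ hw
      simp only [Function.comp_apply, id]
      rw [Equiv.image_eq_preimage_symm]
      exact this
    have e₂ : splitLeaves v '' (Sum.inr '' ({⟨i, (hv' i).2 (Or.inl rfl)⟩,
        ⟨j, (hv' j).2 (Or.inr rfl)⟩} : Set v)) = v := by
      rw [huniv, Set.image_univ]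
      ext a
      constructor
      · rintro ⟨_, ⟨b, rfl⟩, rfl⟩
        rw [splitLeaves_inr]
        exact b.2
      · intro ha
        exact ⟨_, ⟨⟨a, ha⟩, rfl⟩, splitLeaves_inr v _⟩
    rw [e₁, e₂, Finset.union_comm, ← Finset.insert_eq, Finset.insert_erase hv]
  exact ⟨v, _, _, hij, a, ε, huniv, by rw [hcomp, Bess.relabel_of, hε]⟩

theorem card_splitLeaves [Finite I] {v : Set I} (hv : Nat.card v = 2) :
    Nat.card (Option ↥(vᶜ)) + 1 = Nat.card I := by
  rw [← Nat.card_congr (splitLeaves v), Nat.card_sum, hv, Finite.card_option]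

/-- Contracting a pair of leaves lowers the number of leaves by one, and on the pair itself the
values on `E` and `Ω` are prescribed. Compatibility with composition and relabelling then determines
the value on the whole. -/
theorem IsCoproduct.unique
    {Δ₁ Δ₂ : ∀ (I : Type u) [Finite I] [Nonempty I], Bess I →ₗ[ℚ] Bess I ⊗[ℚ] Bess I}
    (h₁ : IsCoproduct Δ₁) (h₂ : IsCoproduct Δ₂) (I : Type u) [Finite I] [Nonempty I] :
    Δ₁ I = Δ₂ I := by
  induction hn : Nat.card I using Nat.strong_induction_on generalizing I with
  | _ n ih =>
  have step : ∀ (v : Set I) [Nonempty v] (a : Bess (Option ↥(vᶜ))) (b : Bess ↥v),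
      Nat.card v = 2 → Δ₁ v b = Δ₂ v b →
      Δ₁ I (Bess.relabel (splitLeaves v) (Bess.comp ↥(vᶜ) ↥v a b)) =
        Δ₂ I (Bess.relabel (splitLeaves v) (Bess.comp ↥(vᶜ) ↥v a b)) := by
    intro v _ a b hv hb
    have hlt : Nat.card (Option ↥(vᶜ)) < n := by
      rw [← hn, ← card_splitLeaves hv]
      exact Nat.lt_succ_self _
    rw [h₁.relabel, h₂.relabel, h₁.comp, h₂.comp, ih _ hlt _ rfl, hb]
  refine Bess.hom_ext fun x => ?_
  by_cases hx : x.forest.verts.Nonempty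
  · obtain ⟨v, i, j, hij, a, ε, huniv, hx⟩ := exists_comp_omega x hx
    have hv : Nat.card v = 2 := by
      rw [← Nat.card_univ, ← huniv]
      exact Set.ncard_pair hij
    have : Nonempty v := ⟨i⟩
    rw [hx, map_smul, map_smul, step v (Bess.of a) _ hv]
    rw [h₁.gen_omega v hv, h₂.gen_omega v hv]
  · obtain ⟨ε, -, hε⟩ := Bess.of_eq_smul_of (x := x) (y := discreteInner I)
      (Forest.eq_discrete (Finset.not_nonempty_iff_eq_empty.1 hx))
    rw [hε, map_smul, map_smul]
    congr 1
    change Δ₁ I (Bess.discrete I) = Δ₂ I (Bess.discrete I)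
    -- With one leaf the discrete forest is the unit; with at least two it is a discrete forest
    -- composed with `E` on two of the leaves.
    rcases subsingleton_or_nontrivial I with hI | hI
    · have h1 : Nat.card I = 1 := Nat.card_eq_one_iff_unique.2 ⟨hI, inferInstance⟩
      rw [h₁.unit I h1, h₂.unit I h1]
    · obtain ⟨i, j, hij⟩ := exists_pair_ne I
      have hv : Nat.card ({i, j} : Set I) = 2 := Set.ncard_pair hij
      have : Nonempty ({i, j} : Set I) := ⟨⟨i, Or.inl rfl⟩⟩
      have := step {i, j} (Bess.discrete _) (Bess.discrete _) hv
        (by rw [h₁.gen_E _ hv, h₂.gen_E _ hv])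
      rwa [Bess.discrete_comp_discrete, Bess.relabel_discrete] at this

end Unique

end Bessel

end

theorem mainTheorem2 :
    (∃! Δ : ∀ (I : Type u) [Finite I] [Nonempty I],
        Bessel.Bess I →ₗ[ℚ] Bessel.Bess I ⊗[ℚ] Bessel.Bess I, Bessel.IsCoproduct Δ) ∧
    ∀ Δ : ∀ (I : Type u) [Finite I] [Nonempty I],
        Bessel.Bess I →ₗ[ℚ] Bessel.Bess I ⊗[ℚ] Bessel.Bess I,
      Bessel.IsCoproduct Δ →
      ∀ (I : Type u) [Finite I] [Nonempty I] (x : Bessel.InnerForest I)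
        (o' : ∀ V' : Finset (Set I), Bessel.GlobalOrientation V')
        (o'' : ∀ V' : Finset (Set I), Bessel.GlobalOrientation (x.forest.verts \ V')),
        (∀ V' ⊆ x.forest.verts, Bessel.Compatible (o' V') (o'' V') x.glob) →
        Δ I (Bessel.Bess.of x) =
          ∑ V' ∈ x.forest.verts.powerset,
            Bessel.gammaSum x (o' V') ⊗ₜ[ℚ] Bessel.gammaSum x (o'' V') := by
  refine ⟨⟨_, Bessel.isCoproduct_coproduct, fun Δ h => ?_⟩, fun Δ h I _ _ x o' o'' ho => ?_⟩
  · funext I _ _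
    exact h.unique Bessel.isCoproduct_coproduct I
  · rw [h.unique Bessel.isCoproduct_coproduct I]
    exact Bessel.coproduct_formula x o' o'' ho
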